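/- **Theorem (Power-Ginibre decomposition).** Let $N\ge 1$ and $M\ge 1$ be integers. Let $G$ be a complex Ginibre matrix of size $N$, i.e. an $N\times N$ matrix with independent entries of law $\mathscr N_{\mathbb C}(0,\frac1N)$ (centred complex Gaussian with $\mathbb E|G_{ij}|^2=\frac1N$), and let $\{\lambda_1,\dots,\lambda_N\}$ be the multiset of its eigenvalues. For $1\le k\le M$ put $I_k=\{i\in\{1,\dots,N\} : i\equiv k \bmod M\}$ and $c_k=|I_k|$, and let $m$ be Lebesgue measure on $\mathbb C$. Let $\mathrm R(N,M,k)$ be the law on $\mathbb C^{I_k}$ with joint density $$\frac{1}{c_k!\prod_{j\in I_k}(j-1)!}\prod_{\substack{i<j\\ i,j\in I_k}}N^M|z_i^M-z_j^M|^2\prod_{i\in I_k}N^k|z_i|^{2(k-1)}\,\frac1\pi e^{-N|z_i|^2}\,\mathrm dm(z_i),$$ and let $\mathrm{Gin}(N,M,k)$ be the law on $\mathbb C^{I_k}$ with joint density $$\frac{1}{\pi^{c_k}\,c_k!\,M^{c_k}\prod_{j\in I_k}(j-1)!}\prod_{\substack{i<j\\ i,j\in I_k}}N^M|z_i-z_j|^2\prod_{i\in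 I_k}N^k|z_i|^{\frac{2(k-M)}{M}}e^{-N|z_i|^{2/M}}\,\mathrm dm(z_i)$$ (if $I_k=\emptyset$, both are the law of the empty configuration). Then, for every $1\le k\le M$, these are probability measures, $\mathrm{Gin}(N,M,k)$ is the image of $\mathrm R(N,M,k)$ under the coordinatewise power map $z\mapsto z^M$, and $\mathrm{Gin}(N,M,k)$ is a determinantal point process: for some measurable positive semidefinite kernel $K$ on $\mathbb C$, its $n$-point correlation functions with respect to Lebesgue measure are $\det(K(x_a,x_b))_{a,b=1}^n$, for all $n\ge0$. Moreover, as point processes (random multisets of points of $\mathbb C$), $$\{\lambda_1^M,\dots,\lambda_N^M\}\ \stackrel{d}{=}\ \bigcup_{k=1}^M\{z_i^M : i\in I_k\}\ \stackrel{d}{=}\ \bigcup_{k=1}^M\{w_i : i\in I_k\},$$ where unions are taken with multiplicity, the blocks $(z_i)_{i\in I_k}$ have law $\mathrm R(N,M,k)$ and are independent for different $k$, and the blocks $(w_i)_{i\in I_k}$ have law $\mathrm{Gin}(N,M,k)$ and are independent for different $k$. -/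

import Mathlib

open MeasureTheory ProbabilityTheory
open scoped ENNReal NNReal ComplexOrder

noncomputable section

/-- The centred complex Gaussian distribution `𝒩_ℂ(0, v)`: real and imaginary parts are
independent real Gaussian variables with mean `0` and variance `v / 2`, so `E|Z|² = v`. -/
def complexGaussian (v : ℝ≥0) : Measure ℂ :=
  ((gaussianReal 0 (v / 2)).prod (gaussianReal 0 (v / 2))).map
    Complex.measurableEquivRealProd.symm

/-- The law of the entries of a complex Ginibre matrix of size `N`: they are independent with
distribution `𝒩_ℂ(0, 1/N)`. -/
def ginibreEntries (N : ℕ) : Measure (Fin N → Fin N → ℂ) :=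
  Measure.pi fun _ => Measure.pi fun _ => complexGaussian (1 / (N : ℝ≥0))

/-- The multiset of eigenvalues of the matrix with the given entries, counted with algebraic
multiplicity. -/
def eigenvalues {N : ℕ} (x : Fin N → Fin N → ℂ) : Multiset ℂ :=
  (Matrix.of x).charpoly.roots

/-- The point configuration (a counting measure, `∑ δ_z` over the points with multiplicity)
associated with a finite multiset of points. A finite point process is a random element of
`Measure ℂ` of this form, the space `Measure ℂ` carrying the σ-algebra generated by the counts
`ν ↦ ν B` of Borel sets `B`. -/
def pointConfiguration (s : Multiset ℂ) : Measure ℂ :=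
  (s.map fun z => Measure.dirac z).sum

/-- The arithmetic progression `I_k = {i ∈ {1, …, N} | i ≡ k mod M}`. -/
def progression (N M k : ℕ) : Finset ℕ :=
  (Finset.Icc 1 N).filter fun i => i ≡ k [MOD M]

/-- The normalising constant `c_k! ∏_{j ∈ I_k} (j - 1)!` of the root distribution. -/
def rootConstant (N M k : ℕ) : ℝ :=
  ((progression N M k).card.factorial : ℝ) *
    ∏ j ∈ progression N M k, ((j - 1).factorial : ℝ)

/-- The joint density, with respect to Lebesgue measure on `ℂ^{I_k}`, of `R(N,M,k)`. -/
def rootDensity (N M k : ℕ) (z : progression N M k → ℂ) : ℝ :=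
  (rootConstant N M k)⁻¹ *
    (∏ i, ∏ j with i < j, (N : ℝ) ^ M * ‖z i ^ M - z j ^ M‖ ^ 2) *
    ∏ i, (N : ℝ) ^ k * ‖z i‖ ^ (2 * (k - 1)) *
      (Real.pi⁻¹ * Real.exp (-(N : ℝ) * ‖z i‖ ^ 2))

/-- The root distribution `R(N,M,k)`, as a joint law on `ℂ^{I_k}`. -/
def rootDistribution (N M k : ℕ) : Measure (progression N M k → ℂ) :=
  volume.withDensity fun z => ENNReal.ofReal (rootDensity N M k z)

/-- The normalising constant `π^{c_k} c_k! M^{c_k} ∏_{j ∈ I_k} (j - 1)!` of `Gin(N,M,k)`. -/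
def powerGinibreConstant (N M k : ℕ) : ℝ :=
  Real.pi ^ (progression N M k).card * ((progression N M k).card.factorial : ℝ) *
    ((M : ℝ) ^ (progression N M k).card * ∏ j ∈ progression N M k, ((j - 1).factorial : ℝ))

/-- The joint density, with respect to Lebesgue measure on `ℂ^{I_k}`, of `Gin(N,M,k)`. -/
def powerGinibreDensity (N M k : ℕ) (z : progression N M k → ℂ) : ℝ :=
  (powerGinibreConstant N M k)⁻¹ *
    (∏ i, ∏ j with i < j, (N : ℝ) ^ M * ‖z i - z j‖ ^ 2) *
    ∏ i, (N : ℝ) ^ k * ‖z i‖ ^ (2 * ((k : ℝ) - M) / M) *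
      Real.exp (-(N : ℝ) * ‖z i‖ ^ (2 / (M : ℝ)))

/-- The Power-Ginibre distribution `Gin(N,M,k)`, as a joint law on `ℂ^{I_k}`. -/
def powerGinibre (N M k : ℕ) : Measure (progression N M k → ℂ) :=
  volume.withDensity fun z => ENNReal.ofReal (powerGinibreDensity N M k z)

/-- The superposition (union with multiplicity) of the blocks `(z_i)_{i ∈ I_k}`, `1 ≤ k ≤ M`. -/
def superposition {N M : ℕ} (z : ∀ k : Finset.Icc 1 M, progression N M k → ℂ) : Multiset ℂ :=
  ∑ k, Finset.univ.val.map (z k)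

/-- A finite family of random points of `ℂ` with joint law `ρ` forms a determinantal point
process: for some measurable positive semidefinite (in particular Hermitian) kernel `K`, the
`n`-point correlation function with respect to Lebesgue measure is `det (K (x_a, x_b))`, for
every `n`; that is, the expected sum of `f` over `n`-tuples of points with distinct indices is
the integral of `f` against it. -/
def IsDeterminantal {ι : Type*} [Fintype ι] (ρ : Measure (ι → ℂ)) : Prop :=
  ∃ K : ℂ → ℂ → ℂ,
    Measurable (Function.uncurry K) ∧
    (∀ (n : ℕ) (x : Fin n → ℂ), (Matrix.of fun a b => K (x a) (x b)).PosSemidef) ∧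
    ∀ (n : ℕ) (f : (Fin n → ℂ) → ℝ≥0∞), Measurable f →
      ∫⁻ z, ∑ e : Fin n ↪ ι, f (fun a => z (e a)) ∂ρ =
        ∫⁻ x, f x * ENNReal.ofReal (Matrix.of fun a b => K (x a) (x b)).det.re

end

open scoped ComplexConjugate

/-! The proof has two independent halves: the joint law of the Ginibre eigenvalues, and a decoupling
principle for determinantal projection processes.

Eigenvalue law. It is proved by induction on the size that the eigenvalues of a Gaussian matrix have
density proportional to `∏ |z_i - z_j|² ∏ e^{-s|z_i|²}` (`hasEigenvalueDensity`), in the sense of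
integrals of functions of the multiset. Write a matrix of size `n + 1` with corner `a`, first row
`w`, first column `c` and lower block `D`. For fixed `a, w, D`, trade `c` for the vector `v` such
that `(1, v)` is an eigenvector. Generically `c` has `n + 1` preimages `v`, one for each eigenvalue,
and the Jacobian is `|det(l - B)|²`, where `l = a + w·v` is the eigenvalue and `B = D - v wᵀ`
carries the other eigenvalues. After translating `D` and `a`, the matrix is the conjugate of the
block triangular matrix `(l, w; 0, B)` by a unipotent shear depending on `v`. The shear is a unitary
matrix times a block triangular one. The unitary factor is invisible to the Gaussian weight, and the
other factor is absorbed by a linear change of the block triangular variables, which keeps `l` and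
the spectrum of `B` and costs a constant depending on `v` only. So the integral splits, and the
Jacobian supplies the new Vandermonde factors.

The resulting density is `|det φ_j(z_i)|² / N!` for the orthonormal functions `φ_p ∝ z^p
e^{-N|z|²/2}`, `0 ≤ p < N`. All constants are fixed by total mass.

Decoupling. For a symmetric event `S`, one of the two determinants may be replaced by its diagonal
term, so the probability of `S` is `∑_τ sgn τ ∫_S ∏ φ_i(z_i) conj φ_{τ i}(z_i)`. If `S` depends only
on the `z_i^M`, it is invariant under rotating a single coordinate by a primitive `M`-th root of
unity. This rotation multiplies the term of `τ` by a number different from `1` as soon as `τ`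
changes the residue class of that coordinate, so the term vanishes. Only permutations preserving
residue classes remain, and they give the law of independent blocks
(`IsOrthonormalFamily.slaterMeasure_eq_setLIntegral`, `IsOrthonormalFamily.pi_slaterMeasure`).

The block of class `k` consists of the functions `z^{k-1} (z^M)^q e^{-N|z|²/2}`. Its determinant is
a Vandermonde determinant in `z^M`, which is the density of `R(N,M,k)`. Changing variables to `w =
z^M` gives `Gin(N,M,k)`, again the squared determinant of an orthonormal family, hence determinantal
with kernel `∑ φ_j(x) conj φ_j(y)`. -/

/-! ### Products of measures with densities -/

theorem lintegral_fin_prod_eq_prod {n : ℕ} {E : Fin n → Type*} {mE : ∀ i, MeasurableSpace (E i)}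
    {μ : (i : Fin n) → Measure (E i)} [∀ i, SigmaFinite (μ i)]
    {f : (i : Fin n) → E i → ℝ≥0∞} (hf : ∀ i, Measurable (f i)) :
    ∫⁻ x, ∏ i, f i (x i) ∂Measure.pi μ = ∏ i, ∫⁻ x, f i x ∂μ i := by
  induction n with
  | zero => simp
  | succ n ih =>
    rw [← (measurePreserving_piFinSuccAbove μ 0).symm.lintegral_comp_emb
      (MeasurableEquiv.measurableEmbedding _)]
    simp_rw [MeasurableEquiv.piFinSuccAbove_symm_apply, Fin.insertNthEquiv,
      Fin.prod_univ_succ, Fin.insertNth_zero]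
    simp only [Fin.zero_succAbove]
    rw [← ih (fun i => hf _)]
    exact lintegral_prod_mul (μ := μ 0) (ν := Measure.pi fun i : Fin n => μ i.succ) (f := f 0)
      (g := fun x => ∏ i, f (Fin.succ i) (x i)) (hf 0).aemeasurable
      (Finset.measurable_prod _ fun i _ => (hf _).comp (measurable_pi_apply i)).aemeasurable

theorem lintegral_pi_prod_eq_prod {ι : Type*} [Fintype ι] {E : ι → Type*}
    {mE : ∀ i, MeasurableSpace (E i)} {μ : (i : ι) → Measure (E i)} [∀ i, SigmaFinite (μ i)]
    {f : (i : ι) → E i → ℝ≥0∞} (hf : ∀ i, Measurable (f i)) :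
    ∫⁻ x, ∏ i, f i (x i) ∂Measure.pi μ = ∏ i, ∫⁻ x, f i x ∂μ i := by
  let e := (Fintype.equivFin ι).symm
  rw [← (measurePreserving_piCongrLeft _ e).lintegral_comp_emb
    (MeasurableEquiv.measurableEmbedding _)]
  simp_rw [← e.prod_comp, MeasurableEquiv.coe_piCongrLeft, Equiv.piCongrLeft_apply_apply]
  exact lintegral_fin_prod_eq_prod fun i => hf _

/-- A finite product of measures with densities has the product of the densities as density. -/
theorem pi_withDensity {ι : Type*} [Fintype ι] {E : ι → Type*}
    {mE : ∀ i, MeasurableSpace (E i)} {μ : (i : ι) → Measure (E i)} [∀ i, SigmaFinite (μ i)]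
    {f : (i : ι) → E i → ℝ≥0∞} (hf : ∀ i, Measurable (f i))
    [∀ i, SigmaFinite ((μ i).withDensity (f i))] :
    Measure.pi (fun i => (μ i).withDensity (f i)) =
      (Measure.pi μ).withDensity fun x => ∏ i, f i (x i) := by
  refine Measure.pi_eq fun s hs => ?_
  rw [withDensity_apply _ (MeasurableSet.univ_pi hs), ← lintegral_indicator (MeasurableSet.univ_pi hs)]
  have h : ∀ x : (i : ι) → E i, (Set.univ.pi s).indicator (fun x => ∏ i, f i (x i)) x =
      ∏ i, (s i).indicator (f i) (x i) := by
    intro x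
    by_cases hx : x ∈ Set.univ.pi s
    · rw [Set.indicator_of_mem hx]
      exact Finset.prod_congr rfl fun i _ => (Set.indicator_of_mem (hx i trivial) _).symm
    · rw [Set.indicator_of_notMem hx]
      simp only [Set.mem_pi, Set.mem_univ, true_implies, not_forall] at hx
      obtain ⟨i, hi⟩ := hx
      exact (Finset.prod_eq_zero (Finset.mem_univ i) (Set.indicator_of_notMem hi _)).symm
  simp_rw [h]
  rw [lintegral_pi_prod_eq_prod fun i => (hf i).indicator (hs i)]
  exact Finset.prod_congr rfl fun i _ => by
    rw [lintegral_indicator (hs i), withDensity_apply _ (hs i)]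

/-! ### Changes of variables with several preimages; the power map -/

/-- Change of variables for a `C¹` map almost every value of which has exactly `K` regular
preimages. -/
theorem lintegral_abs_det_fderiv_mul_comp {E : Type*} [NormedAddCommGroup E] [NormedSpace ℝ E]
    [FiniteDimensional ℝ E] [MeasurableSpace E] [BorelSpace E] (μ : Measure E) [μ.IsAddHaarMeasure]
    {f : E → E} (hf : ContDiff ℝ 1 f) {K : ℕ}
    (hK : ∀ᵐ y ∂μ, {x | f x = y ∧ (fderiv ℝ f x).det ≠ 0}.encard = K)
    {g : E → ℝ≥0∞} (hg : Measurable g) :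
    ∫⁻ x, ENNReal.ofReal |(fderiv ℝ f x).det| * g (f x) ∂μ = K * ∫⁻ y, g y ∂μ := by
  have hdet : Continuous fun x => (fderiv ℝ f x).det :=
    ContinuousLinearMap.continuous_det.comp (hf.continuous_fderiv one_ne_zero)
  set U : Set E := {x | (fderiv ℝ f x).det ≠ 0} with hU
  have hUo : IsOpen U := isOpen_ne_fun hdet continuous_const
  -- The inverse function theorem covers the regular set `U` by open sets on which `f` is injective.
  -- Points outside `U` get the empty set, so that the choice is total. A countable subcover made
  -- disjoint then cuts `U` into injectivity pieces.
  have hloc : ∀ x, ∃ V : Set E, MeasurableSet V ∧ V ⊆ U ∧ Set.InjOn f V ∧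
      (x ∈ U → V ∈ nhdsWithin x U) := by
    intro x
    by_cases hx : x ∈ U
    · have hs : HasStrictFDerivAt f
          (((fderiv ℝ f x).toContinuousLinearEquivOfDetNeZero hx : E ≃L[ℝ] E) : E →L[ℝ] E) x := by
        rw [ContinuousLinearMap.coe_toContinuousLinearEquivOfDetNeZero]
        exact hf.contDiffAt.hasStrictFDerivAt one_ne_zero
      refine ⟨(hs.toOpenPartialHomeomorph f).source ∩ U,
        ((hs.toOpenPartialHomeomorph f).open_source.inter hUo).measurableSet,
        Set.inter_subset_right, (hs.toOpenPartialHomeomorph f).injOn.mono Set.inter_subset_left,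
        fun _ => mem_nhdsWithin_of_mem_nhds (((hs.toOpenPartialHomeomorph f).open_source.inter
          hUo).mem_nhds ⟨hs.mem_toOpenPartialHomeomorph_source, hx⟩)⟩
    · exact ⟨∅, MeasurableSet.empty, Set.empty_subset _, Set.injOn_empty _, fun h => absurd h hx⟩
  choose V hVm hVU hVi hVn using hloc
  obtain ⟨t, -, htc, htU⟩ := TopologicalSpace.countable_cover_nhdsWithin fun x hx => hVn x hx
  obtain ⟨s, hs⟩ := Set.countable_iff_exists_subset_range.1 htc
  set S : ℕ → Set E := disjointed fun n => V (s n) with hS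
  have hSV : ∀ n, S n ⊆ V (s n) := fun n => disjointed_subset _ n
  have hSm : ∀ n, MeasurableSet (S n) := MeasurableSet.disjointed fun n => hVm _
  have hSd : Pairwise (Function.onFun Disjoint S) := disjoint_disjointed _
  have hSU : ⋃ n, S n = U := by
    rw [hS, iUnion_disjointed]
    refine (Set.iUnion_subset fun n => hVU _).antisymm (htU.trans (Set.iUnion₂_subset ?_))
    intro x hx
    obtain ⟨n, rfl⟩ := hs hx
    exact Set.subset_iUnion (fun n => V (s n)) n
  have hSinj : ∀ n, Set.InjOn f (S n) := fun n => (hVi _).mono (hSV n)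
  have hd : ∀ x, HasFDerivAt f (fderiv ℝ f x) x := fun x =>
    (hf.differentiable one_ne_zero x).hasFDerivAt
  have himg : ∀ n, MeasurableSet (f '' S n) := fun n =>
    measurable_image_of_fderivWithin (hSm n) (fun x _ => (hd x).hasFDerivWithinAt) (hSinj n)
  have h1 : ∫⁻ x, ENNReal.ofReal |(fderiv ℝ f x).det| * g (f x) ∂μ =
      ∫⁻ x in U, ENNReal.ofReal |(fderiv ℝ f x).det| * g (f x) ∂μ := by
    rw [← lintegral_indicator hUo.measurableSet]
    refine lintegral_congr fun x => ?_
    by_cases hx : x ∈ U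
    · rw [Set.indicator_of_mem hx]
    · rw [Set.indicator_of_notMem hx]
      simp only [hU, Set.mem_ofPred_eq, not_not] at hx
      simp [hx]
  rw [h1, ← hSU, lintegral_iUnion hSm hSd]
  simp_rw [← fun n => lintegral_image_eq_lintegral_abs_det_fderiv_mul μ (hSm n)
    (fun x _ => (hd x).hasFDerivWithinAt) (hSinj n) g, ← lintegral_indicator (himg _)]
  rw [← lintegral_tsum fun n => (hg.indicator (himg n)).aemeasurable, ← lintegral_const_mul _ hg]
  refine lintegral_congr_ae ?_
  filter_upwards [hK] with y hy
  have h2 : ∀ n, (f '' S n).indicator g y = {n | y ∈ f '' S n}.indicator 1 n * g y := by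
    intro n
    by_cases hn : y ∈ f '' S n
    · rw [Set.indicator_of_mem hn, Set.indicator_of_mem (by exact hn)]; simp
    · rw [Set.indicator_of_notMem hn, Set.indicator_of_notMem (by exact hn)]; simp
  simp_rw [h2]
  rw [ENNReal.tsum_mul_right]
  congr 1
  -- Each regular preimage of `y` lies in exactly one piece and each piece holds at most one, so the
  -- pieces whose image contains `y` are as many as the regular preimages.
  have h3 : {n | y ∈ f '' S n}.encard = (K : ℕ∞) := by
    rw [← hy]
    choose! x hx using fun n (hn : n ∈ {n | y ∈ f '' S n}) => hn
    have hinj : Set.InjOn x {n | y ∈ f '' S n} := by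
      intro n hn m hm h
      by_contra hne
      exact Set.disjoint_left.1 (hSd hne) (hx n hn).1 (h ▸ (hx m hm).1)
    rw [← hinj.encard_image]
    congr 1
    ext z
    constructor
    · rintro ⟨n, hn, rfl⟩
      exact ⟨(hx n hn).2, hVU _ (hSV _ (hx n hn).1)⟩
    · rintro ⟨hz, hzU⟩
      obtain ⟨n, hn⟩ := Set.mem_iUnion.1 (hSU.symm ▸ hzU : z ∈ ⋃ n, S n)
      have hmem : n ∈ {n | y ∈ f '' S n} := ⟨z, hn, hz⟩
      exact ⟨n, hmem, hSinj n (hx n hmem).1 hn ((hx n hmem).2.trans hz.symm)⟩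
  rw [← tsum_subtype {n | y ∈ f '' S n} (1 : ℕ → ℝ≥0∞)]
  simp only [Pi.one_apply]
  rw [ENNReal.tsum_set_one, h3]
  simp

/-- Restriction of scalars turns a determinant into its field norm, and the norm of `ℂ` over `ℝ` is
`|·|²`. Every squared modulus in a Jacobian below comes from here. -/
theorem det_restrictScalars_eq_norm_sq {E : Type*} [NormedAddCommGroup E] [NormedSpace ℂ E]
    (L : E →L[ℂ] E) : (L.restrictScalars ℝ).det = ‖L.det‖ ^ 2 := by
  rw [ContinuousLinearMap.det, ContinuousLinearMap.det, ContinuousLinearMap.coe_restrictScalars,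
    LinearMap.det_restrictScalars, Algebra.norm_complex_eq, ← Complex.normSq_eq_norm_sq]
  rfl

/-- The real Jacobian of `z ↦ z^M` is `M² |z|^{2(M-1)}`. Every `w ≠ 0` has `M` preimages, which
cancels one of the two factors `M`. -/
theorem lintegral_norm_pow_mul_comp_pow {M : ℕ} (hM : 1 ≤ M) {g : ℂ → ℝ≥0∞} (hg : Measurable g) :
    ∫⁻ z : ℂ, ENNReal.ofReal (M * ‖z‖ ^ (2 * (M - 1))) * g (z ^ M) = ∫⁻ w, g w := by
  have hM0 : M ≠ 0 := by omega
  have hfd : ∀ z : ℂ, fderiv ℝ (fun z : ℂ => z ^ M) z =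
      ((ContinuousLinearMap.toSpanSingleton ℂ ((M : ℂ) * z ^ (M - 1))).restrictScalars ℝ) := by
    intro z
    exact (((hasDerivAt_pow M z).hasFDerivAt).restrictScalars ℝ).fderiv
  have hdet : ∀ z : ℂ, (fderiv ℝ (fun z : ℂ => z ^ M) z).det =
      (M : ℝ) ^ 2 * ‖z‖ ^ (2 * (M - 1)) := by
    intro z
    have h1 : (ContinuousLinearMap.toSpanSingleton ℂ ((M : ℂ) * z ^ (M - 1))).det =
        (M : ℂ) * z ^ (M - 1) := by
      rw [ContinuousLinearMap.det, ← LinearMap.det_toMatrix (Module.Basis.singleton Unit ℂ)]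
      simp [LinearMap.toMatrix_apply]
    rw [hfd, det_restrictScalars_eq_norm_sq, h1, norm_mul, norm_pow, Complex.norm_natCast]
    ring
  have key := lintegral_abs_det_fderiv_mul_comp (volume : Measure ℂ) (f := fun z => z ^ M)
    (contDiff_fun_id.pow M) (K := M) (by
      filter_upwards [(Set.finite_singleton (0 : ℂ)).countable.ae_notMem volume] with w hw
      have hw0 : w ≠ 0 := by simpa using hw
      have hset : {z : ℂ | z ^ M = w ∧ (fderiv ℝ (fun z : ℂ => z ^ M) z).det ≠ 0} =
          ((Polynomial.nthRoots M w).toFinset : Set ℂ) := by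
        ext z
        simp only [Set.mem_ofPred_eq, Finset.mem_coe, Multiset.mem_toFinset,
          Polynomial.mem_nthRoots (Nat.pos_of_ne_zero hM0), hdet]
        refine ⟨fun h => h.1, fun h => ⟨h, ?_⟩⟩
        have hz : z ≠ 0 := by
          rintro rfl
          exact hw0 (by rw [← h, zero_pow hM0])
        have : (M : ℝ) ≠ 0 := by exact_mod_cast hM0
        positivity
      rw [hset, Set.encard_coe_eq_coe_finsetCard, Multiset.toFinset_card_of_nodup
        ((Complex.isPrimitiveRoot_exp M hM0).nthRoots_nodup hw0),
        (Complex.isPrimitiveRoot_exp M hM0).card_nthRoots, if_pos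
        (IsAlgClosed.exists_pow_nat_eq w (Nat.pos_of_ne_zero hM0))]) hg
  simp_rw [hdet] at key
  have hMt : (M : ℝ≥0∞) ≠ 0 := by exact_mod_cast hM0
  rw [← (ENNReal.mul_right_inj hMt (ENNReal.natCast_ne_top M)), ← key,
    ← lintegral_const_mul' _ _ (ENNReal.natCast_ne_top M)]
  refine lintegral_congr fun z => ?_
  rw [← mul_assoc, ← ENNReal.ofReal_natCast, ← ENNReal.ofReal_mul (by positivity),
    abs_of_nonneg (by positivity)]
  congr 2
  ring

/-- The density of the image of an absolutely continuous measure under the power map. -/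
theorem map_pow_withDensity {M : ℕ} (hM : 1 ≤ M) {p q : ℂ → ℝ≥0∞} (hp : Measurable p)
    (hq : Measurable q)
    (hpq : ∀ᵐ z : ℂ, p z = ENNReal.ofReal (M * ‖z‖ ^ (2 * (M - 1))) * q (z ^ M)) :
    (volume.withDensity p).map (fun z : ℂ => z ^ M) = volume.withDensity q := by
  refine Measure.ext_of_lintegral _ fun g hg => ?_
  have hm : Measurable fun z : ℂ => z ^ M := by fun_prop
  have hg' : Measurable fun z : ℂ => g (z ^ M) := hg.comp hm
  rw [lintegral_map hg hm, lintegral_withDensity_eq_lintegral_mul _ hp hg',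
    lintegral_withDensity_eq_lintegral_mul _ hq hg, ← lintegral_norm_pow_mul_comp_pow hM (hq.mul hg)]
  refine lintegral_congr_ae ?_
  filter_upwards [hpq] with z hz
  rw [Pi.mul_apply, Pi.mul_apply, hz, mul_assoc]

theorem measurePreserving_piCurry_symm {K : Type*} [Fintype K] {J : K → Type*}
    [∀ k, Fintype (J k)] {X : Type*} [MeasureSpace X] [SigmaFinite (volume : Measure X)] :
    MeasurePreserving (MeasurableEquiv.piCurry fun (k : K) (_ : J k) => X).symm volume volume := by
  refine ⟨MeasurableEquiv.measurable _, ?_⟩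
  refine (Measure.pi_eq fun s hs => ?_).symm
  rw [MeasurableEquiv.map_apply]
  have : (MeasurableEquiv.piCurry fun (k : K) (_ : J k) => X).symm ⁻¹' Set.univ.pi s =
      Set.univ.pi fun k => Set.univ.pi fun j => s ⟨k, j⟩ := by
    ext x
    simp [MeasurableEquiv.coe_piCurry_symm, Sigma.uncurry, Set.mem_pi, Sigma.forall]
  rw [this, volume_pi_pi]
  simp_rw [volume_pi_pi]
  rw [← Finset.univ_sigma_univ, Finset.prod_sigma]

/-! ### Orthonormal families -/

/-- A family of measurable functions on `ℂ` that is orthonormal in `L²(ℂ)`. -/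
structure IsOrthonormalFamily {ι : Type*} (φ : ι → ℂ → ℂ) : Prop where
  measurable : ∀ j, Measurable (φ j)
  lintegral_sq : ∀ j, ∫⁻ z, ‖φ j z‖ₑ ^ 2 = 1
  orthogonal : ∀ i j, i ≠ j → ∫ z, φ i z * conj (φ j z) = 0

namespace IsOrthonormalFamily

variable {ι : Type*} {φ : ι → ℂ → ℂ} (h : IsOrthonormalFamily φ)
include h

/-- The normalisation is an integral in `[0, ∞]`, so it carries square integrability and not only a
value. -/
theorem memLp (j : ι) : MemLp (φ j) 2 volume := by
  refine ⟨(h.measurable j).aestronglyMeasurable, ?_⟩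
  rw [eLpNorm_lt_top_iff_lintegral_rpow_enorm_lt_top two_ne_zero ENNReal.ofNat_ne_top]
  have := h.lintegral_sq j
  simp only [ENNReal.toReal_ofNat, ENNReal.rpow_ofNat]
  rw [this]
  exact ENNReal.one_lt_top

theorem integrable_mul_conj (i j : ι) : Integrable fun z => φ i z * conj (φ j z) :=
  (h.memLp i).integrable_mul (h.memLp j).star

theorem integral_mul_conj [DecidableEq ι] (i j : ι) :
    ∫ z, φ i z * conj (φ j z) = if i = j then 1 else 0 := by
  split_ifs with hij
  · subst hij
    have h1 : ∀ z, φ i z * conj (φ i z) = ((‖φ i z‖ ^ 2 : ℝ) : ℂ) := by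
      intro z
      rw [Complex.mul_conj, Complex.normSq_eq_norm_sq]
    simp_rw [h1]
    rw [integral_complex_ofReal, integral_eq_lintegral_of_nonneg_ae
      (Filter.Eventually.of_forall fun z => by positivity)
      ((h.measurable i).norm.pow_const 2).aestronglyMeasurable]
    have h2 : ∀ z, ENNReal.ofReal (‖φ i z‖ ^ 2) = ‖φ i z‖ₑ ^ 2 := by
      intro z
      rw [ENNReal.ofReal_pow (norm_nonneg _), ofReal_norm]
    simp_rw [h2, h.lintegral_sq]
    simp
  · exact h.orthogonal i j hij

theorem comp_injective {J : Type*} {e : J → ι} (he : Function.Injective e) :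
    IsOrthonormalFamily fun j => φ (e j) :=
  ⟨fun _ => h.measurable _, fun _ => h.lintegral_sq _, fun _ _ hij => h.orthogonal _ _ (he.ne hij)⟩

end IsOrthonormalFamily

/-! ### Slater determinants and symmetric observables -/

section Slater

variable {ι : Type*} [Fintype ι] [DecidableEq ι]

/-- The part of the Slater determinant of `φ` that preserves the classes of `κ`. -/
noncomputable def slaterDet {K : Type*} [DecidableEq K] (φ : ι → ℂ → ℂ) (κ : ι → K) (z : ι → ℂ) :
    ℂ :=
  (Matrix.of fun i j => if κ i = κ j then φ j (z i) else 0).det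

/-- The permutations that preserve the classes of `κ`. -/
def classPerms {K : Type*} [DecidableEq K] (κ : ι → K) : Finset (Equiv.Perm ι) :=
  Finset.univ.filter fun σ => ∀ i, κ (σ i) = κ i

variable {K : Type*} [DecidableEq K] (φ : ι → ℂ → ℂ) (κ : ι → K)

theorem mem_classPerms {σ : Equiv.Perm ι} : σ ∈ classPerms κ ↔ ∀ i, κ (σ i) = κ i := by
  simp [classPerms]

/-- Of the two expansions, this one permutes the coordinates and serves to symmetrise. The next one
permutes the functions and is paired with the diagonal product, coordinate by coordinate. -/
theorem slaterDet_eq_sum_apply_perm (z : ι → ℂ) :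
    slaterDet φ κ z = ∑ σ ∈ classPerms κ, (Equiv.Perm.sign σ : ℂ) * ∏ i, φ i (z (σ i)) := by
  rw [slaterDet, Matrix.det_apply', classPerms, Finset.sum_filter]
  refine Finset.sum_congr rfl fun σ _ => ?_
  simp only [Matrix.of_apply]
  split_ifs with hσ
  · simp [hσ]
  · push Not at hσ
    obtain ⟨i, hi⟩ := hσ
    rw [Finset.prod_eq_zero (Finset.mem_univ i) (if_neg hi), mul_zero]

theorem slaterDet_eq_sum_perm_apply (z : ι → ℂ) :
    slaterDet φ κ z = ∑ σ ∈ classPerms κ, (Equiv.Perm.sign σ : ℂ) * ∏ i, φ (σ i) (z i) := by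
  rw [slaterDet, ← Matrix.det_transpose, Matrix.det_apply', classPerms, Finset.sum_filter]
  refine Finset.sum_congr rfl fun σ _ => ?_
  simp only [Matrix.transpose_apply, Matrix.of_apply]
  split_ifs with hσ
  · simp [hσ]
  · push Not at hσ
    obtain ⟨i, hi⟩ := hσ
    rw [Finset.prod_eq_zero (Finset.mem_univ i) (if_neg (Ne.symm hi)), mul_zero]

theorem slaterDet_comp_perm {σ : Equiv.Perm ι} (hσ : σ ∈ classPerms κ) (z : ι → ℂ) :
    slaterDet φ κ (fun i => z (σ i)) = (Equiv.Perm.sign σ : ℂ) * slaterDet φ κ z := by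
  rw [slaterDet, slaterDet, ← Matrix.det_permute]
  congr 1
  ext i j
  simp only [Matrix.submatrix_apply, Matrix.of_apply, id_eq, (mem_classPerms κ).1 hσ i]

theorem measurable_slaterDet {φ : ι → ℂ → ℂ} (hφ : ∀ j, Measurable (φ j)) :
    Measurable (slaterDet φ κ) := by
  have : slaterDet φ κ = fun z =>
      ∑ σ ∈ classPerms κ, (Equiv.Perm.sign σ : ℂ) * ∏ i, φ i (z (σ i)) :=
    funext fun z => slaterDet_eq_sum_apply_perm φ κ z
  rw [this]
  refine Finset.measurable_sum _ fun σ _ => Measurable.const_mul ?_ _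
  exact Finset.measurable_prod _ fun i _ => (hφ i).comp (measurable_pi_apply _)

theorem measurePreserving_comp_perm {X : Type*} [MeasureSpace X] [SigmaFinite (volume : Measure X)]
    {ι' : Type*} [Fintype ι'] (σ : ι' ≃ ι) :
    MeasurePreserving (fun z : ι → X => fun i => z (σ i)) volume volume := by
  have := (volume_measurePreserving_piCongrLeft (fun _ : ι => X) σ).symm
  exact this

variable {φ}

theorem IsOrthonormalFamily.integrable_mul_prod (h : IsOrthonormalFamily φ) {G : (ι → ℂ) → ℂ}
    (hG : Measurable G) {C : ℝ} (hC : ∀ z, ‖G z‖ ≤ C) (τ : Equiv.Perm ι) :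
    Integrable fun z : ι → ℂ => G z * ∏ i, φ i (z i) * conj (φ (τ i) (z i)) :=
  (Integrable.fintype_prod fun i => h.integrable_mul_conj i (τ i)).bdd_mul hG.aestronglyMeasurable
    (Filter.Eventually.of_forall hC)

theorem mul_prod_mul_conj_slaterDet (G : ℂ) (z : ι → ℂ) :
    G * (∏ i, φ i (z i)) * conj (slaterDet φ κ z) =
      ∑ τ ∈ classPerms κ, (Equiv.Perm.sign τ : ℂ) *
        (G * ∏ i, φ i (z i) * conj (φ (τ i) (z i))) := by
  rw [slaterDet_eq_sum_perm_apply, map_sum, Finset.mul_sum]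
  refine Finset.sum_congr rfl fun τ _ => ?_
  rw [Finset.prod_mul_distrib, map_mul, map_prod, map_intCast]
  ring

theorem IsOrthonormalFamily.integrable_mul_prod_mul_conj_slaterDet (h : IsOrthonormalFamily φ)
    {G : (ι → ℂ) → ℂ} (hG : Measurable G) {C : ℝ} (hC : ∀ z, ‖G z‖ ≤ C) :
    Integrable fun z : ι → ℂ => G z * (∏ i, φ i (z i)) * conj (slaterDet φ κ z) := by
  simp_rw [mul_prod_mul_conj_slaterDet]
  exact integrable_finsetSum _ fun τ _ => (h.integrable_mul_prod hG hC τ).const_mul _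

/-- Expand one determinant over coordinate permutations: the sign of each term cancels against the
sign that the other determinant acquires under the same permutation. All terms are therefore one
function evaluated at permuted coordinates, and have equal integrals. -/
theorem mul_norm_sq_slaterDet_eq_sum {G : (ι → ℂ) → ℂ}
    (hs : ∀ σ ∈ classPerms κ, ∀ z, G (fun i => z (σ i)) = G z) (z : ι → ℂ) :
    G z * ((‖slaterDet φ κ z‖ ^ 2 : ℝ) : ℂ) = ∑ σ ∈ classPerms κ,
      (fun z => G z * (∏ i, φ i (z i)) * conj (slaterDet φ κ z)) fun i => z (σ i) := by
  rw [← Complex.normSq_eq_norm_sq, ← Complex.mul_conj]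
  nth_rw 1 [slaterDet_eq_sum_apply_perm φ κ z]
  rw [Finset.sum_mul, Finset.mul_sum]
  refine Finset.sum_congr rfl fun σ hσ => ?_
  simp only
  rw [hs σ hσ, slaterDet_comp_perm φ κ hσ, map_mul, map_intCast]
  ring

theorem IsOrthonormalFamily.integrable_mul_norm_sq_slaterDet (h : IsOrthonormalFamily φ)
    {G : (ι → ℂ) → ℂ} (hG : Measurable G) {C : ℝ} (hC : ∀ z, ‖G z‖ ≤ C)
    (hs : ∀ σ ∈ classPerms κ, ∀ z, G (fun i => z (σ i)) = G z) :
    Integrable fun z : ι → ℂ => G z * ((‖slaterDet φ κ z‖ ^ 2 : ℝ) : ℂ) := by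
  simp_rw [mul_norm_sq_slaterDet_eq_sum κ hs]
  refine integrable_finsetSum _ fun σ _ => ?_
  exact ((measurePreserving_comp_perm σ).integrable_comp
    (h.integrable_mul_prod_mul_conj_slaterDet κ hG hC).aestronglyMeasurable).2
    (h.integrable_mul_prod_mul_conj_slaterDet κ hG hC)

/-- For a symmetric observable, one of the two Slater determinants may be replaced by its diagonal
term. -/
theorem IsOrthonormalFamily.integral_mul_norm_sq_slaterDet (h : IsOrthonormalFamily φ)
    {G : (ι → ℂ) → ℂ} (hG : Measurable G) {C : ℝ} (hC : ∀ z, ‖G z‖ ≤ C)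
    (hs : ∀ σ ∈ classPerms κ, ∀ z, G (fun i => z (σ i)) = G z) :
    ∫ z : ι → ℂ, G z * ((‖slaterDet φ κ z‖ ^ 2 : ℝ) : ℂ) =
      (classPerms κ).card * ∑ τ ∈ classPerms κ, (Equiv.Perm.sign τ : ℂ) *
        ∫ z : ι → ℂ, G z * ∏ i, φ i (z i) * conj (φ (τ i) (z i)) := by
  have hint := h.integrable_mul_prod_mul_conj_slaterDet κ hG hC
  have h1 : ∀ σ : Equiv.Perm ι, ∫ z : ι → ℂ,
      (fun z => G z * (∏ i, φ i (z i)) * conj (slaterDet φ κ z)) (fun i => z (σ i)) =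
      ∫ z : ι → ℂ, G z * (∏ i, φ i (z i)) * conj (slaterDet φ κ z) := by
    intro σ
    have hmp := measurePreserving_comp_perm (X := ℂ) σ
    rw [← hmp.map_eq] at hint
    have := integral_map hmp.measurable.aemeasurable hint.aestronglyMeasurable
    rw [hmp.map_eq] at this
    exact this.symm
  simp_rw [mul_norm_sq_slaterDet_eq_sum κ hs]
  rw [integral_finsetSum]
  · rw [Finset.sum_congr rfl fun σ _ => h1 σ, Finset.sum_const, nsmul_eq_mul]
    congr 1
    simp_rw [mul_prod_mul_conj_slaterDet]
    rw [integral_finsetSum]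
    · exact Finset.sum_congr rfl fun τ _ => integral_const_mul _ _
    · exact fun τ _ => (h.integrable_mul_prod hG hC τ).const_mul _
  · exact fun σ _ => ((measurePreserving_comp_perm σ).integrable_comp
      hint.aestronglyMeasurable).2 hint

theorem IsOrthonormalFamily.integral_prod_mul_conj (h : IsOrthonormalFamily φ)
    (τ : Equiv.Perm ι) :
    ∫ z : ι → ℂ, ∏ i, φ i (z i) * conj (φ (τ i) (z i)) = if τ = 1 then 1 else 0 := by
  rw [integral_fintype_prod_volume_eq_prod fun i z => φ i z * conj (φ (τ i) z)]
  simp_rw [h.integral_mul_conj]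
  split_ifs with hτ
  · subst hτ; simp
  · obtain ⟨i, hi⟩ : ∃ i, τ i ≠ i := by
      by_contra! hc
      exact hτ (Equiv.ext hc)
    exact Finset.prod_eq_zero (Finset.mem_univ i) (if_neg (Ne.symm hi))

theorem one_mem_classPerms : (1 : Equiv.Perm ι) ∈ classPerms κ := by simp [mem_classPerms]

theorem IsOrthonormalFamily.integral_norm_sq_slaterDet (h : IsOrthonormalFamily φ) :
    ∫ z : ι → ℂ, ‖slaterDet φ κ z‖ ^ 2 = (classPerms κ).card := by
  have := h.integral_mul_norm_sq_slaterDet κ (G := fun _ => 1) measurable_const (C := 1)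
    (by simp) (by simp)
  simp only [one_mul, h.integral_prod_mul_conj] at this
  rw [integral_complex_ofReal] at this
  have h2 : ∑ τ ∈ classPerms κ, (Equiv.Perm.sign τ : ℂ) * (if τ = 1 then (1 : ℂ) else 0) = 1 := by
    rw [Finset.sum_eq_single_of_mem 1 (one_mem_classPerms κ)]
    · simp
    · intro τ _ hτ; simp [hτ]
  rw [h2, mul_one] at this
  exact_mod_cast this

end Slater

/-! ### Determinantal projection processes and their correlation functions -/

section SlaterMeasure

variable {ι : Type*} [Fintype ι] [DecidableEq ι] {φ : ι → ℂ → ℂ}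

/-- The law of the determinantal projection process of the orthonormal family `φ`. -/
noncomputable def slaterMeasure (φ : ι → ℂ → ℂ) : Measure (ι → ℂ) :=
  volume.withDensity fun z => ENNReal.ofReal
    (((Fintype.card ι).factorial : ℝ)⁻¹ * ‖slaterDet φ (fun _ => ()) z‖ ^ 2)

theorem card_classPerms_unit :
    (classPerms fun _ : ι => ()).card = (Fintype.card ι).factorial := by
  simp [classPerms, Fintype.card_perm]

theorem IsOrthonormalFamily.integrable_norm_sq_slaterDet {K : Type*} [DecidableEq K] (κ : ι → K)
    (h : IsOrthonormalFamily φ) : Integrable fun z : ι → ℂ => ‖slaterDet φ κ z‖ ^ 2 := by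
  have := h.integrable_mul_norm_sq_slaterDet κ (G := fun _ => 1) measurable_const (C := 1)
    (by simp) (by simp)
  simp only [one_mul] at this
  exact this.re

theorem IsOrthonormalFamily.isProbabilityMeasure_slaterMeasure (h : IsOrthonormalFamily φ) :
    IsProbabilityMeasure (slaterMeasure φ) := by
  constructor
  rw [slaterMeasure, withDensity_apply _ MeasurableSet.univ, Measure.restrict_univ,
    ← ofReal_integral_eq_lintegral_ofReal ((h.integrable_norm_sq_slaterDet _).const_mul _)
      (Filter.Eventually.of_forall fun z => by positivity), integral_const_mul,
    h.integral_norm_sq_slaterDet, card_classPerms_unit, inv_mul_cancel₀, ENNReal.ofReal_one]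
  exact_mod_cast (Nat.factorial_pos _).ne'

theorem measurable_ofReal_norm_sq_slaterDet {K : Type*} [DecidableEq K] (κ : ι → K)
    (hφ : ∀ j, Measurable (φ j)) (c : ℝ) :
    Measurable fun z => ENNReal.ofReal (c * ‖slaterDet φ κ z‖ ^ 2) :=
  (((measurable_slaterDet κ hφ).norm.pow_const 2).const_mul c).ennreal_ofReal

/-- The correlation kernel of `slaterMeasure φ`. -/
noncomputable def slaterKernel (φ : ι → ℂ → ℂ) (x y : ℂ) : ℂ :=
  ∑ j, φ j x * conj (φ j y)

/-- Fubini: the observable sees only the coordinates indexed by `A`, and the others are integrated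
out one by one. -/
theorem integral_mul_prod_sum_equiv {R A : Type*} [Fintype R] [Fintype A] (E : A ⊕ R ≃ ι)
    (f : (A → ℂ) → ℂ) (ψ : ι → ℂ → ℂ) :
    ∫ z : ι → ℂ, f (fun a => z (E (Sum.inl a))) * ∏ i, ψ i (z i) =
      (∫ x : A → ℂ, f x * ∏ a, ψ (E (Sum.inl a)) (x a)) * ∏ r, ∫ w, ψ (E (Sum.inr r)) w := by
  rw [← (volume_measurePreserving_piCongrLeft (fun _ : ι => ℂ) E).integral_comp
      (MeasurableEquiv.measurableEmbedding _),
    ← (volume_measurePreserving_sumPiEquivProdPi_symm (fun _ : A ⊕ R => ℂ)).integral_comp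
      (MeasurableEquiv.measurableEmbedding _),
    ← integral_fintype_prod_volume_eq_prod (fun r w => ψ (E (Sum.inr r)) w), ← integral_prod_mul]
  refine integral_congr_ae (Filter.Eventually.of_forall fun z => ?_)
  simp only
  rw [← E.prod_comp, Fintype.prod_sum_type, ← mul_assoc]
  have h1 : ∀ s : A ⊕ R, (MeasurableEquiv.piCongrLeft (fun _ : ι => ℂ) E)
      ((MeasurableEquiv.sumPiEquivProdPi fun _ : A ⊕ R => ℂ).symm z) (E s) = Sum.elim z.1 z.2 s := by
    intro s
    rw [MeasurableEquiv.coe_piCongrLeft, Equiv.piCongrLeft_apply_apply]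
    cases s <;> rfl
  simp [h1]

/-- Integrating out the coordinates of `R` leaves Kronecker deltas, which are the rows of an
identity block. The signed sum is then a block triangular determinant and reduces to its block on
`A`. -/
theorem sum_sign_mul_prod_ite_mul_prod {R A : Type*} [Fintype R] [Fintype A] [DecidableEq R]
    [DecidableEq A] (E : A ⊕ R ≃ ι) (u : ι → A → ℂ) :
    ∑ τ : Equiv.Perm ι, (Equiv.Perm.sign τ : ℂ) *
      ((∏ a, u (τ (E (Sum.inl a))) a) *
        ∏ r, if E (Sum.inr r) = τ (E (Sum.inr r)) then (1 : ℂ) else 0) =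
      (Matrix.of fun a b => u (E (Sum.inl b)) a).det := by
  set W : Matrix ι ι ℂ := Matrix.of fun i j =>
    Sum.elim (fun a => u j a) (fun r => if E (Sum.inr r) = j then 1 else 0) (E.symm i) with hW
  have h1 : W.det = ∑ τ : Equiv.Perm ι, (Equiv.Perm.sign τ : ℂ) *
      ((∏ a, u (τ (E (Sum.inl a))) a) *
        ∏ r, if E (Sum.inr r) = τ (E (Sum.inr r)) then (1 : ℂ) else 0) := by
    rw [← Matrix.det_transpose, Matrix.det_apply']
    refine Finset.sum_congr rfl fun τ _ => ?_
    rw [← E.prod_comp, Fintype.prod_sum_type]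
    simp [hW]
  rw [← h1, ← Matrix.det_submatrix_equiv_self E]
  have h2 : W.submatrix E E = Matrix.fromBlocks (Matrix.of fun a b => u (E (Sum.inl b)) a)
      (Matrix.of fun a r => u (E (Sum.inr r)) a) 0 1 := by
    ext s t
    rcases s with a | r <;> rcases t with b | t <;> simp [hW, Matrix.one_apply]
  rw [h2, Matrix.det_fromBlocks_zero₂₁, Matrix.det_one, mul_one]

/-- A Cauchy–Binet formula from multilinearity in the rows: index choices that are not injective
give two equal columns. It is kept as a sum over embeddings, with one determinant unexpanded, to
match the sum over tuples of distinct indices in the correlation functions. -/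
theorem det_slaterKernel {n : ℕ} (φ : ι → ℂ → ℂ) (x : Fin n → ℂ) :
    (Matrix.of fun a b => slaterKernel φ (x a) (x b)).det =
      ∑ e : Fin n ↪ ι, (∏ a, φ (e a) (x a)) *
        (Matrix.of fun a b => conj (φ (e b) (x a))).det := by
  have h1 : (Matrix.of fun a b => slaterKernel φ (x a) (x b)).det =
      Matrix.detRowAlternating fun a : Fin n => ∑ j : ι, φ j (x a) • fun b => conj (φ j (x b)) := by
    change _ = Matrix.det _
    congr 1
    ext a b
    simp [slaterKernel]
  have h2 : ∀ p : Fin n → ι,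
      Matrix.detRowAlternating (fun a : Fin n => φ (p a) (x a) • fun b => conj (φ (p a) (x b))) =
      (∏ a, φ (p a) (x a)) * (Matrix.of fun a b => conj (φ (p b) (x a))).det := by
    intro p
    rw [AlternatingMap.map_smul_univ, smul_eq_mul, ← Matrix.det_transpose]
    rfl
  rw [h1]
  change (Matrix.detRowAlternating (R := ℂ) (n := Fin n)).toMultilinearMap _ = _
  rw [MultilinearMap.map_sum]
  simp only [AlternatingMap.coe_multilinearMap, h2]
  symm
  refine Finset.sum_of_injOn (fun e => ⇑e) (DFunLike.coe_injective.injOn) (by simp) ?_ (by simp)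
  intro p _ hp
  have hp' : ¬ Function.Injective p := fun hi => hp ⟨⟨p, hi⟩, by simp, rfl⟩
  simp only [Function.Injective, not_forall] at hp'
  obtain ⟨a, b, hab, hne⟩ := hp'
  rw [Matrix.det_zero_of_column_eq hne, mul_zero]
  intro c
  simp [hab]

theorem posSemidef_slaterKernel {n : ℕ} (φ : ι → ℂ → ℂ) (x : Fin n → ℂ) :
    (Matrix.of fun a b => slaterKernel φ (x a) (x b)).PosSemidef := by
  have : (Matrix.of fun a b => slaterKernel φ (x a) (x b)) =
      (Matrix.of fun a j => φ j (x a)) * (Matrix.of fun a j => φ j (x a)).conjTranspose := by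
    ext a b
    simp [slaterKernel, Matrix.mul_apply]
  rw [this]
  exact Matrix.posSemidef_self_mul_conjTranspose _

/-- The contribution of one embedding `e`: coordinates outside its range are integrated out by
orthonormality, leaving exactly the term of `e` in the expansion of the kernel determinant. -/
theorem IsOrthonormalFamily.sum_integral_comp_embedding (h : IsOrthonormalFamily φ) {n : ℕ}
    (e : Fin n ↪ ι) {f : (Fin n → ℂ) → ℂ} (hf : Measurable f) {C : ℝ} (hC : ∀ x, ‖f x‖ ≤ C) :
    Integrable (fun x : Fin n → ℂ => f x *
        ((∏ a, φ (e a) (x a)) * (Matrix.of fun a b => conj (φ (e b) (x a))).det)) ∧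
    ∑ τ ∈ classPerms (fun _ : ι => ()), (Equiv.Perm.sign τ : ℂ) *
        ∫ z : ι → ℂ, f (fun a => z (e a)) * ∏ i, φ i (z i) * conj (φ (τ i) (z i)) =
      ∫ x : Fin n → ℂ, f x *
        ((∏ a, φ (e a) (x a)) * (Matrix.of fun a b => conj (φ (e b) (x a))).det) := by
  classical
  obtain ⟨E, hE⟩ : ∃ E : Fin n ⊕ ((Set.range e)ᶜ : Set ι) ≃ ι, ∀ a, E (Sum.inl a) = e a :=
    ⟨(Equiv.sumCongr (Equiv.ofInjective e e.injective) (Equiv.refl _)).trans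
      (Equiv.Set.sumCompl (Set.range e)), fun a => by simp⟩
  have hdet : ∀ x : Fin n → ℂ, f x *
      ((∏ a, φ (e a) (x a)) * (Matrix.of fun a b => conj (φ (e b) (x a))).det) =
      ∑ τ : Equiv.Perm ι, (Equiv.Perm.sign τ : ℂ) *
        ((f x * ∏ a, φ (E (Sum.inl a)) (x a) * conj (φ (τ (E (Sum.inl a))) (x a))) *
        ∏ r, if E (Sum.inr r) = τ (E (Sum.inr r)) then (1 : ℂ) else 0) := by
    intro x
    have := sum_sign_mul_prod_ite_mul_prod E fun j a => conj (φ j (x a))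
    simp only [hE] at this
    rw [← this, Finset.mul_sum, Finset.mul_sum]
    refine Finset.sum_congr rfl fun τ _ => ?_
    simp only [hE, Finset.prod_mul_distrib]
    ring
  have hint : ∀ τ : Equiv.Perm ι, Integrable fun x : Fin n → ℂ => f x *
      ∏ a, φ (E (Sum.inl a)) (x a) * conj (φ (τ (E (Sum.inl a))) (x a)) := fun τ =>
    (Integrable.fintype_prod fun a => h.integrable_mul_conj (E (Sum.inl a))
      (τ (E (Sum.inl a)))).bdd_mul hf.aestronglyMeasurable (Filter.Eventually.of_forall hC)
  simp_rw [hdet]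
  refine ⟨integrable_finsetSum _ fun τ _ => ((hint τ).mul_const _).const_mul _, ?_⟩
  rw [integral_finsetSum _ fun τ _ => ((hint τ).mul_const _).const_mul _]
  rw [show classPerms (fun _ : ι => ()) = Finset.univ by simp [classPerms]]
  refine Finset.sum_congr rfl fun τ _ => ?_
  rw [integral_const_mul, integral_mul_const]
  simp_rw [← hE]
  rw [integral_mul_prod_sum_equiv E f fun i w => φ i w * conj (φ (τ i) w)]
  simp_rw [h.integral_mul_conj]

/-- It suffices to identify a measure on `ℂ^n`, the sum over `e` of the laws of `(z_{e a})_a`. On a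
measurable set `s` this is the expectation of `∑_e 1_s(z ∘ e)`, a bounded symmetric observable, to
which the diagonal formula applies. -/
theorem IsOrthonormalFamily.isDeterminantal_slaterMeasure (h : IsOrthonormalFamily φ) :
    IsDeterminantal (slaterMeasure φ) := by
  have hK : Measurable (Function.uncurry (slaterKernel φ)) := by
    refine Finset.measurable_sum _ fun j _ => ((h.measurable j).comp measurable_fst).mul ?_
    exact Complex.continuous_conj.measurable.comp ((h.measurable j).comp measurable_snd)
  refine ⟨slaterKernel φ, hK, fun n x => posSemidef_slaterKernel φ x, fun n f hf => ?_⟩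
  set d : (Fin n → ℂ) → ℂ := fun x => (Matrix.of fun a b => slaterKernel φ (x a) (x b)).det with hd
  have hdm : Measurable d := by
    simp only [hd, Matrix.det_apply']
    refine Finset.measurable_sum _ fun σ _ => Measurable.const_mul
      (Finset.measurable_prod _ fun a _ => ?_) _
    exact hK.comp (g := Function.uncurry (slaterKernel φ)) (f := fun x : Fin n → ℂ => (x (σ a), x a))
      ((measurable_pi_apply _).prodMk (measurable_pi_apply _))
  have hdnn : ∀ x, 0 ≤ (d x).re := fun x =>
    (Complex.nonneg_iff.1 (posSemidef_slaterKernel φ x).det_nonneg).1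
  have hem : ∀ e : Fin n ↪ ι, Measurable fun z : ι → ℂ => fun a => z (e a) := fun e =>
    measurable_pi_lambda _ fun a => measurable_pi_apply _
  have hmeas : ∑ e : Fin n ↪ ι, (slaterMeasure φ).map (fun z a => z (e a)) =
      volume.withDensity fun x => ENNReal.ofReal (d x).re := by
    have := h.isProbabilityMeasure_slaterMeasure
    ext s hs
    set g : (Fin n → ℂ) → ℂ := s.indicator 1 with hg
    have hgm : Measurable g := measurable_one.indicator hs
    have hgC : ∀ x, ‖g x‖ ≤ 1 := fun x => by
      by_cases hx : x ∈ s <;> simp [hg, hx]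
    set G : (ι → ℂ) → ℂ := fun z => ∑ e : Fin n ↪ ι, g fun a => z (e a) with hG
    have hGm : Measurable G := Finset.measurable_sum _ fun e _ => hgm.comp (hem e)
    have hGC : ∀ z, ‖G z‖ ≤ Fintype.card (Fin n ↪ ι) := fun z => by
      refine (norm_sum_le _ _).trans ((Finset.sum_le_sum fun e _ => hgC _).trans ?_)
      simp
    have hGs : ∀ σ ∈ classPerms (fun _ : ι => ()), ∀ z, G (fun i => z (σ i)) = G z := by
      intro σ _ z
      refine Fintype.sum_equiv (Equiv.embeddingCongr (Equiv.refl _) σ) _ _ fun e => ?_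
      simp
    have hgd : ∀ x, g x * d x = ∑ e : Fin n ↪ ι, g x * ((∏ a, φ (e a) (x a)) *
        (Matrix.of fun a b => conj (φ (e b) (x a))).det) := fun x => by
      rw [hd]
      simp only
      rw [det_slaterKernel, Finset.mul_sum]
    have hgdint : Integrable fun x => g x * d x := by
      simp_rw [hgd]
      exact integrable_finsetSum _ fun e _ => (h.sum_integral_comp_embedding e hgm hgC).1
    have hkey : ∫ z, G z * ((‖slaterDet φ (fun _ => ()) z‖ ^ 2 : ℝ) : ℂ) =
        (Fintype.card ι).factorial * ∫ x, g x * d x := by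
      rw [h.integral_mul_norm_sq_slaterDet _ hGm hGC hGs, card_classPerms_unit]
      congr 1
      simp_rw [hgd]
      rw [integral_finsetSum _ fun e _ => (h.sum_integral_comp_embedding e hgm hgC).1]
      simp_rw [← fun e => (h.sum_integral_comp_embedding e hgm hgC).2]
      rw [Finset.sum_comm]
      refine Finset.sum_congr rfl fun τ _ => ?_
      simp_rw [hG, Finset.sum_mul]
      rw [integral_finsetSum, Finset.mul_sum]
      intro e _
      exact h.integrable_mul_prod (hgm.comp (hem e)) (fun z => hgC _) τ
    have hfac : ((Fintype.card ι).factorial : ℝ) ≠ 0 := by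
      exact_mod_cast (Nat.factorial_pos _).ne'
    have hGr : ∀ z, ((G z).re : ℂ) = G z := by
      intro z
      simp only [hG, Complex.re_sum, Complex.ofReal_sum]
      refine Finset.sum_congr rfl fun e _ => ?_
      by_cases hx : (fun a => z (e a)) ∈ s <;> simp [hg, hx]
    have hGnn : ∀ z, 0 ≤ (G z).re := by
      intro z
      simp only [hG, Complex.re_sum]
      refine Finset.sum_nonneg fun e _ => ?_
      by_cases hx : (fun a => z (e a)) ∈ s <;> simp [hg, hx]
    have hR : (volume.withDensity fun x => ENNReal.ofReal (d x).re) s =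
        ENNReal.ofReal (∫ x, g x * d x).re := by
      rw [withDensity_apply _ hs, ← lintegral_indicator hs]
      have h1 : ∀ x, s.indicator (fun x => ENNReal.ofReal (d x).re) x =
          ENNReal.ofReal (g x * d x).re := by
        intro x
        by_cases hx : x ∈ s <;> simp [hg, hx]
      have h2 := integral_re hgdint
      simp only [RCLike.re_eq_complex_re] at h2
      simp_rw [h1]
      have h6 : Integrable fun x => (g x * d x).re := hgdint.re
      rw [← h2, ofReal_integral_eq_lintegral_ofReal h6]
      · refine Filter.Eventually.of_forall fun x => ?_
        by_cases hx : x ∈ s <;> simp [hg, hx, hdnn]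
    have hL : (∑ e : Fin n ↪ ι, (slaterMeasure φ).map (fun z a => z (e a))) s =
        ENNReal.ofReal (∫ x, g x * d x).re := by
      have hGint := (h.integrable_mul_norm_sq_slaterDet _ hGm hGC hGs)
      have h3 : (∫ x, g x * d x).re = ∫ z, ((Fintype.card ι).factorial : ℝ)⁻¹ *
          ((G z).re * ‖slaterDet φ (fun _ => ()) z‖ ^ 2) := by
        have h4 : ∀ z, G z * ((‖slaterDet φ (fun _ => ()) z‖ ^ 2 : ℝ) : ℂ) =
            (((G z).re * ‖slaterDet φ (fun _ => ()) z‖ ^ 2 : ℝ) : ℂ) := by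
          intro z; rw [Complex.ofReal_mul, hGr]
        simp_rw [h4] at hkey
        rw [integral_complex_ofReal] at hkey
        rw [integral_const_mul]
        have := congrArg Complex.re hkey
        rw [← Complex.ofReal_natCast, Complex.re_ofReal_mul, Complex.ofReal_re] at this
        rw [this, inv_mul_cancel_left₀ hfac]
      rw [h3, ofReal_integral_eq_lintegral_ofReal]
      · rw [Measure.finsetSum_apply]
        simp_rw [fun e => Measure.map_apply (μ := slaterMeasure φ) (hem e) hs]
        have h5 : ∀ e : Fin n ↪ ι, slaterMeasure φ ((fun z a => z (e a)) ⁻¹' s) =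
            ∫⁻ z, ENNReal.ofReal (g fun a => z (e a)).re * ENNReal.ofReal
              (((Fintype.card ι).factorial : ℝ)⁻¹ * ‖slaterDet φ (fun _ => ()) z‖ ^ 2) := by
          intro e
          rw [slaterMeasure, withDensity_apply _ (hem e hs), ← lintegral_indicator (hem e hs)]
          refine lintegral_congr fun z => ?_
          by_cases hx : (fun a => z (e a)) ∈ s
          · rw [Set.indicator_of_mem (by exact hx)]; simp [hg, hx]
          · rw [Set.indicator_of_notMem (by exact hx)]; simp [hg, hx]
        simp_rw [h5]
        rw [← lintegral_finsetSum]
        · refine lintegral_congr fun z => ?_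
          rw [← Finset.sum_mul, ← ENNReal.ofReal_sum_of_nonneg, ← ENNReal.ofReal_mul]
          · congr 1
            simp only [hG, Complex.re_sum]
            ring
          · refine Finset.sum_nonneg fun e _ => ?_
            by_cases hx : (fun a => z (e a)) ∈ s <;> simp [hg, hx]
          · intro e _
            by_cases hx : (fun a => z (e a)) ∈ s <;> simp [hg, hx]
        · intro e _
          exact (Complex.measurable_re.comp (hgm.comp (hem e))).ennreal_ofReal.mul
            (measurable_ofReal_norm_sq_slaterDet _ h.measurable _)
      · have := hGint.re
        refine Integrable.const_mul ?_ _
        refine this.congr (Filter.Eventually.of_forall fun z => ?_)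
        simp only [RCLike.re_eq_complex_re, Complex.re_mul_ofReal]
      · exact Filter.Eventually.of_forall fun z =>
          mul_nonneg (by positivity) (mul_nonneg (hGnn z) (by positivity))
    rw [hL, hR]
  calc ∫⁻ z, ∑ e : Fin n ↪ ι, f (fun a => z (e a)) ∂slaterMeasure φ
      = ∫⁻ x, f x ∂(∑ e : Fin n ↪ ι, (slaterMeasure φ).map (fun z a => z (e a))) := by
        rw [lintegral_finsetSum_measure]
        simp_rw [fun e => lintegral_map (μ := slaterMeasure φ) hf (hem e)]
        exact lintegral_finsetSum _ fun e _ => hf.comp (hem e)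
    _ = ∫⁻ x, f x * ENNReal.ofReal (d x).re := by
        rw [hmeas, lintegral_withDensity_eq_lintegral_mul _
          (f := fun x => ENNReal.ofReal (d x).re) (Complex.measurable_re.comp hdm).ennreal_ofReal hf]
        exact lintegral_congr fun x => mul_comm _ _

end SlaterMeasure

/-! ### Decoupling on invariant events -/

section Decoupling

variable {ι : Type*} [Fintype ι] [DecidableEq ι] {φ : ι → ℂ → ℂ}

/-- One evaluation covers both sides of the decoupling: `κ` constant gives the full process, and a
general `κ` gives the process of separate classes. -/
theorem IsOrthonormalFamily.setLIntegral_norm_sq_slaterDet {K : Type*} [DecidableEq K] {κ : ι → K}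
    (h : IsOrthonormalFamily φ) {S : Set (ι → ℂ)} (hS : MeasurableSet S)
    (hperm : ∀ σ ∈ classPerms κ, ∀ z, (fun i => z (σ i)) ∈ S ↔ z ∈ S) :
    ∫⁻ z in S, ENNReal.ofReal (((classPerms κ).card : ℝ)⁻¹ * ‖slaterDet φ κ z‖ ^ 2) =
      ENNReal.ofReal (∑ τ ∈ classPerms κ, (Equiv.Perm.sign τ : ℂ) *
        ∫ z in S, ∏ i, φ i (z i) * conj (φ (τ i) (z i))).re := by
  set G : (ι → ℂ) → ℂ := S.indicator 1 with hG
  have hGs : ∀ σ ∈ classPerms κ, ∀ z, G (fun i => z (σ i)) = G z := by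
    intro σ hσ z
    by_cases hz : z ∈ S
    · simp [hG, hz, (hperm σ hσ z).2 hz]
    · simp [hG, hz, mt (hperm σ hσ z).1 hz]
  have hGC : ∀ z, ‖G z‖ ≤ 1 := fun z => by by_cases hz : z ∈ S <;> simp [hG, hz]
  have hmul : ∀ u : (ι → ℂ) → ℂ, ∫ z, G z * u z = ∫ z in S, u z := by
    intro u
    rw [← integral_indicator hS]
    refine integral_congr_ae (Filter.Eventually.of_forall fun z => ?_)
    by_cases hz : z ∈ S <;> simp [hG, hz]
  have key := h.integral_mul_norm_sq_slaterDet κ (measurable_one.indicator hS) hGC hGs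
  simp_rw [← hG, hmul] at key
  rw [integral_complex_ofReal] at key
  have hcard : ((classPerms κ).card : ℝ) ≠ 0 := by
    exact_mod_cast (Finset.card_pos.2 ⟨1, one_mem_classPerms κ⟩).ne'
  have hre := congrArg Complex.re key
  rw [← Complex.ofReal_natCast, Complex.re_ofReal_mul, Complex.ofReal_re] at hre
  rw [← ofReal_integral_eq_lintegral_ofReal
    ((h.integrable_norm_sq_slaterDet κ).const_mul _).integrableOn
    (Filter.Eventually.of_forall fun z => by positivity), integral_const_mul, hre,
    inv_mul_cancel_left₀ hcard]

/-- The blocks of a determinantal projection process that are orthogonal on an invariant event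
behave on this event as if they were independent. -/
theorem IsOrthonormalFamily.slaterMeasure_eq_setLIntegral {K : Type*} [DecidableEq K] (κ : ι → K)
    (h : IsOrthonormalFamily φ) {S : Set (ι → ℂ)} (hS : MeasurableSet S)
    (hperm : ∀ (σ : Equiv.Perm ι) z, (fun i => z (σ i)) ∈ S ↔ z ∈ S)
    (horth : ∀ τ : Equiv.Perm ι, τ ∉ classPerms κ →
      ∫ z in S, ∏ i, φ i (z i) * conj (φ (τ i) (z i)) = 0) :
    slaterMeasure φ S =
      ∫⁻ z in S, ENNReal.ofReal (((classPerms κ).card : ℝ)⁻¹ * ‖slaterDet φ κ z‖ ^ 2) := by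
  rw [h.setLIntegral_norm_sq_slaterDet hS fun σ _ z => hperm σ z, slaterMeasure,
    withDensity_apply _ hS, ← card_classPerms_unit, h.setLIntegral_norm_sq_slaterDet hS
      fun σ _ z => hperm σ z]
  congr 2
  symm
  -- The two signed sums differ only by the permutations that do not preserve the classes, and their
  -- terms vanish by `horth`.
  refine Finset.sum_subset (fun τ _ => by simp [classPerms]) fun τ _ hτ => ?_
  rw [horth τ hτ, mul_zero]

end Decoupling

/-! ### Independent blocks as a single density -/

section Blocks

variable {K : Type*} [Fintype K] [LinearOrder K] {J : K → Type*} [∀ k, Fintype (J k)]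
  [∀ k, DecidableEq (J k)] {φ : (Σ k, J k) → ℂ → ℂ}

/-- The matrix is block diagonal; the order on `K` allows it to be read as block triangular. -/
theorem slaterDet_sigma_fst (z : (Σ k, J k) → ℂ) :
    slaterDet φ Sigma.fst z =
      ∏ k, slaterDet (fun j => φ ⟨k, j⟩) (fun _ => ()) (fun j => z ⟨k, j⟩) := by
  have htri : (Matrix.of fun i j : Σ k, J k => if i.1 = j.1 then φ j (z i) else 0).BlockTriangular
      Sigma.fst := by
    intro i j hij
    rw [Matrix.of_apply, if_neg (ne_of_gt hij)]
  rw [slaterDet, htri.det_fintype]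
  refine Finset.prod_congr rfl fun k _ => ?_
  rw [slaterDet, ← Matrix.det_submatrix_equiv_self (Equiv.sigmaSubtype k).symm]
  congr 1
  ext i j
  have hs : ∀ i : J k, ((Equiv.sigmaSubtype k).symm i : Σ k, J k) = ⟨k, i⟩ := fun _ => rfl
  simp only [Matrix.submatrix_apply, Matrix.toSquareBlock_def, Matrix.of_apply, hs, if_true]

theorem IsOrthonormalFamily.pi_slaterMeasure (h : IsOrthonormalFamily φ) :
    (Measure.pi fun k => slaterMeasure fun j : J k => φ ⟨k, j⟩).map
        (MeasurableEquiv.piCurry fun (k : K) (_ : J k) => ℂ).symm =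
      volume.withDensity fun z => ENNReal.ofReal
        (((classPerms (Sigma.fst : (Σ k, J k) → K)).card : ℝ)⁻¹ * ‖slaterDet φ Sigma.fst z‖ ^ 2) := by
  have hk : ∀ k, IsOrthonormalFamily fun j : J k => φ ⟨k, j⟩ := fun k =>
    h.comp_injective sigma_mk_injective
  have hprob : ∀ k, IsProbabilityMeasure (slaterMeasure fun j : J k => φ ⟨k, j⟩) := fun k =>
    (hk k).isProbabilityMeasure_slaterMeasure
  set c : ℝ := ∏ k, ((Fintype.card (J k)).factorial : ℝ)⁻¹ with hc
  set p : ℝ := ((classPerms (Sigma.fst : (Σ k, J k) → K)).card : ℝ)⁻¹ with hp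
  have hc0 : 0 ≤ c := Finset.prod_nonneg fun k _ => by positivity
  have hmeas : ∀ a : ℝ, Measurable fun z => ENNReal.ofReal (a * ‖slaterDet φ Sigma.fst z‖ ^ 2) :=
    fun a => measurable_ofReal_norm_sq_slaterDet _ h.measurable a
  have h1 : (Measure.pi fun k => slaterMeasure fun j : J k => φ ⟨k, j⟩).map
        (MeasurableEquiv.piCurry fun (k : K) (_ : J k) => ℂ).symm =
      volume.withDensity fun z => ENNReal.ofReal (c * ‖slaterDet φ Sigma.fst z‖ ^ 2) := by
    have hfin : ∀ k, SigmaFinite ((volume : Measure (J k → ℂ)).withDensity fun z =>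
        ENNReal.ofReal (((Fintype.card (J k)).factorial : ℝ)⁻¹ *
          ‖slaterDet (fun j : J k => φ ⟨k, j⟩) (fun _ => ()) z‖ ^ 2)) := fun k => by
      change SigmaFinite (slaterMeasure fun j : J k => φ ⟨k, j⟩)
      infer_instance
    have hpi := pi_withDensity (μ := fun k => (volume : Measure (J k → ℂ)))
      (fun k => measurable_ofReal_norm_sq_slaterDet (φ := fun j : J k => φ ⟨k, j⟩) (fun _ => ())
        (hk k).measurable ((Fintype.card (J k)).factorial : ℝ)⁻¹)
    change Measure.map _ (Measure.pi fun k => volume.withDensity _) = _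
    rw [hpi]
    have hmp := measurePreserving_piCurry_symm (J := J) (X := ℂ)
    ext s hs
    rw [MeasurableEquiv.map_apply, withDensity_apply _ (MeasurableEquiv.measurable _ hs),
      withDensity_apply _ hs, ← hmp.setLIntegral_comp_preimage hs (hmeas c)]
    refine lintegral_congr fun z => ?_
    rw [← ENNReal.ofReal_prod_of_nonneg fun k _ => by positivity, slaterDet_sigma_fst,
      Finset.prod_mul_distrib, Finset.prod_pow, ← norm_prod]
    rfl
  have hp1 : ∫⁻ z, ENNReal.ofReal (p * ‖slaterDet φ Sigma.fst z‖ ^ 2) = 1 := by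
    rw [← ofReal_integral_eq_lintegral_ofReal ((h.integrable_norm_sq_slaterDet _).const_mul _)
      (Filter.Eventually.of_forall fun z => by positivity), integral_const_mul,
      h.integral_norm_sq_slaterDet, hp, inv_mul_cancel₀, ENNReal.ofReal_one]
    exact_mod_cast (Finset.card_pos.2 ⟨1, one_mem_classPerms _⟩).ne'
  have hc1 : ∫⁻ z, ENNReal.ofReal (c * ‖slaterDet φ Sigma.fst z‖ ^ 2) = 1 := by
    have := congrArg (fun m => m Set.univ) h1
    simp only [withDensity_apply _ MeasurableSet.univ, Measure.restrict_univ] at this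
    rw [← this, MeasurableEquiv.map_apply, Set.preimage_univ, measure_univ]
  -- Both densities have total mass one and are multiples of the same function, so the constants
  -- agree. This replaces counting the class-preserving permutations.
  have hcp : c = p := by
    rw [← ofReal_integral_eq_lintegral_ofReal ((h.integrable_norm_sq_slaterDet _).const_mul _)
      (Filter.Eventually.of_forall fun z => by positivity), integral_const_mul,
      ENNReal.ofReal_eq_one] at hp1 hc1
    have hI : (∫ z, ‖slaterDet φ Sigma.fst z‖ ^ 2) ≠ 0 := by
      intro h0; rw [h0, mul_zero] at hp1; exact zero_ne_one hp1
    exact mul_right_cancel₀ hI (hc1.trans hp1.symm)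
  rw [h1, hcp]

end Blocks

/-! ### Vanishing of terms by rotation of one coordinate -/

/-- Rotating one coordinate by a unit complex number preserves Lebesgue measure. -/
theorem measurePreserving_rotate_coord {ι : Type*} [Fintype ι] [DecidableEq ι] (i₀ : ι) {ω : ℂ}
    (hω : ‖ω‖ = 1) :
    MeasurePreserving (fun (z : ι → ℂ) i => (if i = i₀ then ω else 1) * z i) volume volume := by
  refine volume_preserving_pi fun i => ?_
  have h1 : ∀ c : ℂ, ‖c‖ = 1 → MeasurePreserving (fun w : ℂ => c * w) volume volume := by
    intro c hc
    exact (rotation ⟨c, by simpa [Submonoid.unitSphere] using hc⟩).measurePreserving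
  split_ifs
  · exact h1 ω hω
  · exact h1 1 norm_one

/-- The term of a permutation vanishes on an event invariant under the rotation of one coordinate,
if the two functions in this coordinate behave differently under this rotation. -/
theorem setIntegral_prod_mul_conj_eq_zero {ι : Type*} [Fintype ι] [DecidableEq ι]
    {φ : ι → ℂ → ℂ} {S : Set (ι → ℂ)} {τ : Equiv.Perm ι} {i₀ : ι} {ω c d : ℂ}
    (hω : ‖ω‖ = 1) (hrot : ∀ z : ι → ℂ, (fun i => (if i = i₀ then ω else 1) * z i) ∈ S ↔ z ∈ S)
    (hc : ∀ w, φ i₀ (ω * w) = c * φ i₀ w) (hd : ∀ w, φ (τ i₀) (ω * w) = d * φ (τ i₀) w)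
    (hcd : c * conj d ≠ 1) :
    ∫ z in S, ∏ i, φ i (z i) * conj (φ (τ i) (z i)) = 0 := by
  have hmp := measurePreserving_rotate_coord (ι := ι) i₀ hω
  set r : (ι → ℂ) → ι → ℂ := fun z i => (if i = i₀ then ω else 1) * z i with hr
  have hω0 : ω ≠ 0 := by rintro rfl; simp at hω
  have hemb : MeasurableEmbedding r := by
    refine hmp.measurable.measurableEmbedding fun z w hzw => funext fun i => ?_
    have := congrFun hzw i
    simp only [hr] at this
    refine mul_left_cancel₀ ?_ this
    split_ifs <;> simp [hω0]
  have h1 := hmp.setIntegral_preimage_emb hemb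
    (fun z => ∏ i, φ i (z i) * conj (φ (τ i) (z i))) S
  have hpre : r ⁻¹' S = S := Set.ext hrot
  have h2 : ∀ z, ∏ i, φ i (r z i) * conj (φ (τ i) (r z i)) =
      c * conj d * ∏ i, φ i (z i) * conj (φ (τ i) (z i)) := by
    intro z
    rw [← Finset.mul_prod_erase _ _ (Finset.mem_univ i₀),
      ← Finset.mul_prod_erase _ (fun i => φ i (z i) * conj (φ (τ i) (z i))) (Finset.mem_univ i₀)]
    have : ∏ i ∈ Finset.univ.erase i₀, φ i (r z i) * conj (φ (τ i) (r z i)) =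
        ∏ i ∈ Finset.univ.erase i₀, φ i (z i) * conj (φ (τ i) (z i)) :=
      Finset.prod_congr rfl fun i hi => by simp [hr, Finset.ne_of_mem_erase hi]
    rw [this]
    simp only [hr, if_true, hc, hd, map_mul]
    ring
  rw [hpre] at h1
  simp only [h2] at h1
  rw [integral_const_mul] at h1
  have h3 : (c * conj d - 1) * ∫ z in S, ∏ i, φ i (z i) * conj (φ (τ i) (z i)) = 0 := by
    rw [sub_mul, h1, one_mul, sub_self]
  exact (mul_eq_zero.1 h3).resolve_left (sub_ne_zero.2 hcd)

/-! ### Measurability of functions of the spectrum -/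

section EigenvalueMeasurability

open Polynomial

/-- The multiset of the coordinates of a vector. -/
def coordMultiset {ι : Type*} [Fintype ι] (z : ι → ℂ) : Multiset ℂ :=
  Finset.univ.val.map z

theorem coordMultiset_cons {n : ℕ} (l : ℂ) (z : Fin n → ℂ) :
    coordMultiset (Fin.cons l z : Fin (n + 1) → ℂ) = l ::ₘ coordMultiset z := by
  simp [coordMultiset, Fin.univ_val_map, List.ofFn_succ]

theorem coordMultiset_comp_equiv {ι ι' : Type*} [Fintype ι] [Fintype ι'] (σ : ι ≃ ι')
    (z : ι' → ℂ) : coordMultiset (fun i => z (σ i)) = coordMultiset z := by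
  rw [coordMultiset, coordMultiset, ← Multiset.map_univ_val_equiv σ, Multiset.map_map]
  rfl

theorem Multiset.exists_coordMultiset_eq {n : ℕ} {s : Multiset ℂ} (hs : s.card = n) :
    ∃ z : Fin n → ℂ, coordMultiset z = s := by
  subst hs
  obtain ⟨l, rfl⟩ := Quot.exists_rep s
  refine ⟨l.get, ?_⟩
  exact (Fin.univ_val_map l.get).trans (congrArg _ (List.ofFn_get l))

theorem card_eigenvalues {n : ℕ} (x : Fin n → Fin n → ℂ) : (eigenvalues x).card = n := by
  rw [eigenvalues, ← (IsAlgClosed.splits _).natDegree_eq_card_roots,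
    Matrix.charpoly_natDegree_eq_dim, Fintype.card_fin]

theorem prod_sub_eigenvalues {n : ℕ} (x : Fin n → Fin n → ℂ) (t : ℂ) :
    ((eigenvalues x).map fun l => t - l).prod = (Matrix.scalar (Fin n) t - Matrix.of x).det := by
  rw [← Matrix.eval_charpoly, eigenvalues]
  conv_rhs => rw [(IsAlgClosed.splits (Matrix.of x).charpoly).eq_prod_roots_of_monic
    (Matrix.charpoly_monic _)]
  rw [eval_multiset_prod, Multiset.map_map]
  simp

/-- A multiset of `n` complex numbers is determined by the values of its monic polynomial at
`0, …, n - 1`. -/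
theorem eq_of_prod_natCast_sub_eq {n : ℕ} {s t : Multiset ℂ} (hs : s.card = n) (ht : t.card = n)
    (h : ∀ i : Fin n, (s.map fun l => ((i : ℕ) : ℂ) - l).prod =
      (t.map fun l => ((i : ℕ) : ℂ) - l).prod) : s = t := by
  rw [← roots_multiset_prod_X_sub_C s, ← roots_multiset_prod_X_sub_C t]
  congr 1
  have hinj : Set.InjOn (fun i : Fin n => ((i : ℕ) : ℂ)) (Finset.univ : Finset (Fin n)) := by
    intro i _ j _ hij
    exact Fin.ext (Nat.cast_injective (R := ℂ) hij)
  have hms : ((s.map fun a => X - C a).prod).Monic := monic_multiset_prod_of_monic _ _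
    fun a _ => monic_X_sub_C a
  have hmt : ((t.map fun a => X - C a).prod).Monic := monic_multiset_prod_of_monic _ _
    fun a _ => monic_X_sub_C a
  have hds : ((s.map fun a => X - C a).prod).degree = ((n : ℕ) : WithBot ℕ) := by
    rw [degree_multiset_prod_of_monic]
    · simp [hs]
    · intro f hf
      obtain ⟨a, _, rfl⟩ := Multiset.mem_map.1 hf
      exact monic_X_sub_C a
  have hdt : ((t.map fun a => X - C a).prod).degree = ((n : ℕ) : WithBot ℕ) := by
    rw [degree_multiset_prod_of_monic]
    · simp [ht]
    · intro f hf
      obtain ⟨a, _, rfl⟩ := Multiset.mem_map.1 hf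
      exact monic_X_sub_C a
  refine eq_of_degree_sub_lt_of_eval_index_eq Finset.univ hinj ?_ fun i _ => ?_
  · rw [Finset.card_fin, ← hds]
    exact degree_sub_lt_left (hds.trans hdt.symm) hms.ne_zero (hms.leadingCoeff.trans hmt.leadingCoeff.symm)
  · rw [eval_multiset_prod, eval_multiset_prod, Multiset.map_map, Multiset.map_map]
    simpa using h i

/-- Any values at `0, …, n - 1` are those of a monic polynomial `X^n + q`, with `q` of degree less
than `n` found by interpolation, and this polynomial splits over `ℂ`. -/
theorem exists_coordMultiset_prod_eq {n : ℕ} (y : Fin n → ℂ) : ∃ z : Fin n → ℂ,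
    ∀ i : Fin n, ((coordMultiset z).map fun l => ((i : ℕ) : ℂ) - l).prod = y i := by
  set v : Fin n → ℂ := fun i => ((i : ℕ) : ℂ) with hv
  have hinj : Set.InjOn v (Finset.univ : Finset (Fin n)) := by
    intro i _ j _ hij
    exact Fin.ext (Nat.cast_injective (R := ℂ) hij)
  set q := Lagrange.interpolate Finset.univ v (fun i => y i - v i ^ n) with hq
  have hqd : q.degree < n := by
    have := Lagrange.degree_interpolate_lt (fun i => y i - v i ^ n) hinj
    rwa [Finset.card_fin] at this
  have hm : (X ^ n + q).Monic := monic_X_pow_add hqd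
  have hd : (X ^ n + q).natDegree = n := by
    refine natDegree_eq_of_degree_eq_some ?_
    rw [degree_add_eq_left_of_degree_lt] <;> simp [hqd]
  have hsp := IsAlgClosed.splits (X ^ n + q)
  obtain ⟨z, hz⟩ := Multiset.exists_coordMultiset_eq (hsp.natDegree_eq_card_roots.symm.trans hd)
  refine ⟨z, fun i => ?_⟩
  have h1 := congrArg (eval (v i)) (hsp.eq_prod_roots_of_monic hm)
  rw [eval_multiset_prod, Multiset.map_map, ← hz, eval_add, eval_pow, eval_X, hq,
    Lagrange.eval_interpolate_at_node _ hinj (Finset.mem_univ i)] at h1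
  simp only [add_sub_cancel, Function.comp_apply, eval_sub, eval_X, eval_C] at h1
  exact h1.symm

/-- A function of the eigenvalues is measurable if it is measurable as a symmetric function. -/
theorem measurable_comp_eigenvalues {n : ℕ} {β : Type*} [MeasurableSpace β] {g : Multiset ℂ → β}
    (hg : Measurable fun z : Fin n → ℂ => g (coordMultiset z)) :
    Measurable fun x : Fin n → Fin n → ℂ => g (eigenvalues x) := by
  choose q hq using fun y : Fin n → ℂ => exists_coordMultiset_prod_eq y
  set e : (Fin n → ℂ) → Fin n → ℂ :=
    fun z i => ((coordMultiset z).map fun l => ((i : ℕ) : ℂ) - l).prod with he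
  have hem : Measurable e := by
    refine measurable_pi_lambda _ fun i => ?_
    simp only [he, coordMultiset, Multiset.map_map]
    exact Finset.measurable_prod (s := Finset.univ) (f := fun (j : Fin n) (z : Fin n → ℂ) =>
      ((i : ℕ) : ℂ) - z j) fun j _ => by fun_prop
  have hes : Function.Surjective e := fun y => ⟨q y, funext (hq y)⟩
  have hqe : ∀ z, coordMultiset (q (e z)) = coordMultiset z := fun z =>
    eq_of_prod_natCast_sub_eq (by simp [coordMultiset]) (by simp [coordMultiset]) fun i => hq (e z) i
  -- The section `q` is a mere choice and need not be measurable. Since `e` is a measurable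
  -- surjection of standard Borel spaces, measurability of `g (coordMultiset (q y))` in `y` can be
  -- tested after composing with `e`, where `q` disappears. For the spectrum, the values at `0, …, n
  -- - 1` are determinants, continuous in the matrix.
  have hgq : Measurable fun y => g (coordMultiset (q y)) := by
    rw [← hem.measurable_comp_iff_of_surjective hes]
    simpa only [Function.comp_def, hqe] using hg
  have hdet : Measurable fun (x : Fin n → Fin n → ℂ) (i : Fin n) =>
      (Matrix.scalar (Fin n) ((i : ℕ) : ℂ) - Matrix.of x).det := by
    refine measurable_pi_lambda _ fun i => Continuous.measurable ?_
    refine Continuous.matrix_det ?_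
    exact continuous_const.sub continuous_id
  convert hgq.comp hdet using 2 with x
  simp only [Function.comp_apply]
  congr 1
  refine eq_of_prod_natCast_sub_eq (card_eigenvalues x) (by simp [coordMultiset]) fun i => ?_
  rw [hq, prod_sub_eigenvalues]

end EigenvalueMeasurability

/-! ### Bordered matrices and their parametrisation by eigenvectors -/

section Bordered

variable {n : ℕ}

/-- The matrix with a distinguished first row and first column. -/
def borderedMatrix (a : ℂ) (w c : Fin n → ℂ) (D : Fin n → Fin n → ℂ) :
    Matrix (Unit ⊕ Fin n) (Unit ⊕ Fin n) ℂ :=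
  Matrix.fromBlocks (Matrix.of fun _ _ => a) (Matrix.of fun _ j => w j)
    (Matrix.of fun i _ => c i) (Matrix.of D)

/-- The lower unitriangular matrix that maps the first basis vector to `(1, v)`. -/
def shearMatrix (v : Fin n → ℂ) : Matrix (Unit ⊕ Fin n) (Unit ⊕ Fin n) ℂ :=
  borderedMatrix 1 0 v fun i j => if i = j then 1 else 0

theorem borderedMatrix_mul (a a' : ℂ) (w w' c c' : Fin n → ℂ) (D D' : Fin n → Fin n → ℂ) :
    borderedMatrix a w c D * borderedMatrix a' w' c' D' =
      borderedMatrix (a * a' + ∑ j, w j * c' j) (fun j => a * w' j + ∑ i, w i * D' i j)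
        (fun i => c i * a' + ∑ j, D i j * c' j) (fun i j => c i * w' j + ∑ k, D i k * D' k j) := by
  ext (i | i) (j | j) <;> simp [borderedMatrix, Matrix.mul_apply, Fintype.sum_sum_type]

theorem borderedMatrix_one :
    borderedMatrix (n := n) 1 0 0 (fun i j => if i = j then 1 else 0) = 1 := by
  ext (i | i) (j | j) <;> simp [borderedMatrix, Matrix.one_apply]

theorem shearMatrix_mul_neg (v : Fin n → ℂ) : shearMatrix v * shearMatrix (-v) = 1 := by
  rw [shearMatrix, shearMatrix, borderedMatrix_mul, ← borderedMatrix_one]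
  congr 1
  · simp
  · ext; simp
  · ext; simp
  · ext; simp

/-- The left side is the bordered matrix having `(1, v)` as eigenvector with eigenvalue `l`. In a
basis starting with this vector it is block triangular, and `D - v wᵀ` is the action on the
quotient. -/
theorem borderedMatrix_eq_shearMatrix_conj (l : ℂ) (v w : Fin n → ℂ) (D : Fin n → Fin n → ℂ) :
    borderedMatrix (l - ∑ j, w j * v j) w (fun i => l * v i - ∑ j, D i j * v j) D =
      shearMatrix v * borderedMatrix l w 0 (fun i j => D i j - v i * w j) * shearMatrix (-v) := by
  rw [shearMatrix, shearMatrix, borderedMatrix_mul, borderedMatrix_mul]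
  congr 1
  · simp [sub_eq_add_neg]
  · ext; simp
  · ext i
    simp
    ring
  · ext i j; simp

theorem charpoly_borderedMatrix_zero (l : ℂ) (w : Fin n → ℂ) (B : Fin n → Fin n → ℂ) :
    (borderedMatrix l w 0 B).charpoly = (Polynomial.X - Polynomial.C l) * (Matrix.of B).charpoly := by
  have h0 : borderedMatrix l w 0 B = Matrix.fromBlocks (Matrix.of fun _ _ => l)
      (Matrix.of fun _ j => w j) 0 (Matrix.of B) := by
    ext (i | i) (j | j) <;> simp [borderedMatrix]
  rw [h0, Matrix.charpoly_fromBlocks_zero₂₁]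
  congr 1
  simp [Matrix.charpoly, Matrix.det_unique]

theorem charpoly_mul_mul_eq {m : Type*} [Fintype m] [DecidableEq m] {P Q : Matrix m m ℂ}
    (h : P * Q = 1) (A : Matrix m m ℂ) : (P * A * Q).charpoly = A.charpoly := by
  rw [Matrix.charpoly_mul_comm, ← mul_assoc, mul_eq_one_comm.1 h, one_mul]

theorem charpoly_borderedMatrix (l : ℂ) (v w : Fin n → ℂ) (D : Fin n → Fin n → ℂ) :
    (borderedMatrix (l - ∑ j, w j * v j) w (fun i => l * v i - ∑ j, D i j * v j) D).charpoly =
      (Polynomial.X - Polynomial.C l) * (Matrix.of fun i j => D i j - v i * w j).charpoly := by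
  rw [borderedMatrix_eq_shearMatrix_conj, charpoly_mul_mul_eq (shearMatrix_mul_neg v),
    charpoly_borderedMatrix_zero]

/-- The map whose fibre over `c` is the set of the `v` such that `(1, v)` is an eigenvector of the
bordered matrix. -/
def eigenvectorMap (a : ℂ) (w : Fin n → ℂ) (D : Fin n → Fin n → ℂ) (v : Fin n → ℂ) : Fin n → ℂ :=
  fun i => (a + ∑ j, w j * v j) * v i - ∑ j, D i j * v j

theorem charpoly_borderedMatrix_eigenvectorMap (a : ℂ) (v w : Fin n → ℂ) (D : Fin n → Fin n → ℂ) :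
    (borderedMatrix a w (eigenvectorMap a w D v) D).charpoly =
      (Polynomial.X - Polynomial.C (a + ∑ j, w j * v j)) *
        (Matrix.of fun i j => D i j - v i * w j).charpoly := by
  rw [← charpoly_borderedMatrix]
  congr 2
  simp

theorem contDiff_eigenvectorMap (a : ℂ) (w : Fin n → ℂ) (D : Fin n → Fin n → ℂ) :
    ContDiff ℝ 1 (eigenvectorMap a w D) := by
  unfold eigenvectorMap
  fun_prop

/-- The map is complex differentiable, with derivative `l - (D - v wᵀ)` at the eigenvalue `l = a +
w·v`. The Jacobian is thus the product of the squared distances from `l` to the other eigenvalues,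
which is the source of the Vandermonde factor. -/
theorem det_fderiv_eigenvectorMap (a : ℂ) (w : Fin n → ℂ) (D : Fin n → Fin n → ℂ) (v : Fin n → ℂ) :
    (fderiv ℝ (eigenvectorMap a w D) v).det =
      ‖(Matrix.scalar (Fin n) (a + ∑ j, w j * v j) -
        Matrix.of fun i j => D i j - v i * w j).det‖ ^ 2 := by
  set N := Matrix.scalar (Fin n) (a + ∑ j, w j * v j) - Matrix.of fun i j => D i j - v i * w j
    with hN
  have hd : HasFDerivAt (𝕜 := ℂ) (eigenvectorMap a w D)
      (LinearMap.toContinuousLinearMap (Matrix.toLin' N)) v := by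
    rw [hasFDerivAt_pi']
    intro i
    have hp : ∀ j : Fin n, HasFDerivAt (𝕜 := ℂ) (fun v : Fin n → ℂ => v j)
        (ContinuousLinearMap.proj j) v := fun j => hasFDerivAt_apply j v
    have h1 : HasFDerivAt (𝕜 := ℂ) (fun v : Fin n → ℂ => ∑ j, w j * v j)
        (∑ j, w j • ContinuousLinearMap.proj (R := ℂ) (φ := fun _ : Fin n => ℂ) j) v :=
      HasFDerivAt.fun_sum fun j _ => (hp j).const_mul (w j)
    have h2 : HasFDerivAt (𝕜 := ℂ) (fun v : Fin n → ℂ => ∑ j, D i j * v j)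
        (∑ j, D i j • ContinuousLinearMap.proj (R := ℂ) (φ := fun _ : Fin n => ℂ) j) v :=
      HasFDerivAt.fun_sum fun j _ => (hp j).const_mul (D i j)
    refine (((h1.const_add a).mul (hp i)).sub h2).congr_fderiv ?_
    ext u
    simp [hN, Matrix.mulVec, dotProduct, sub_mul, Finset.sum_sub_distrib,
      Finset.mul_sum]
    simp only [mul_assoc]
    ring
  rw [(hd.restrictScalars ℝ).fderiv, det_restrictScalars_eq_norm_sq]
  congr 2
  rw [ContinuousLinearMap.det, LinearMap.coe_toContinuousLinearMap, LinearMap.det_toLin']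

/-- No eigenvector of `D` is orthogonal to `w`. -/
def IsCyclicPair (w : Fin n → ℂ) (D : Fin n → Fin n → ℂ) : Prop :=
  ∀ (l : ℂ) (u : Fin n → ℂ), (∀ i, ∑ j, D i j * u j = l * u i) → ∑ j, w j * u j = 0 → u = 0

/-- The fibre is in bijection with the roots of the characteristic polynomial. An eigenvector with
first entry `0` would be an eigenvector of `D` orthogonal to `w`, so each root has an eigenvector
`(1, v)`. Two such vectors for one root would differ by another excluded eigenvector. Regularity
makes `l` a non-root of the quotient's polynomial, so the `n + 1` roots are simple. -/
theorem encard_eigenvectorMap_fiber {a : ℂ} {w c : Fin n → ℂ} {D : Fin n → Fin n → ℂ}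
    (hwD : IsCyclicPair w D)
    (hreg : ∀ v, eigenvectorMap a w D v = c → (fderiv ℝ (eigenvectorMap a w D) v).det ≠ 0) :
    {v | eigenvectorMap a w D v = c}.encard = (n + 1 : ℕ) := by
  set p := (borderedMatrix a w c D).charpoly with hp
  have hp0 : p ≠ 0 := (Matrix.charpoly_monic _).ne_zero
  have hex : ∀ l ∈ p.roots, ∃ v, eigenvectorMap a w D v = c ∧ a + ∑ j, w j * v j = l := by
    intro l hl
    rw [Polynomial.mem_roots hp0, ← Matrix.mem_spectrum_iff_isRoot_charpoly] at hl
    rw [← Matrix.spectrum_toLin', ← Module.End.hasEigenvalue_iff_mem_spectrum] at hl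
    obtain ⟨u, hu⟩ := hl.exists_hasEigenvector
    have hu1 := hu.apply_eq_smul
    rw [Matrix.toLin'_apply] at hu1
    have e0 : a * u (Sum.inl ()) + ∑ j, w j * u (Sum.inr j) = l * u (Sum.inl ()) := by
      have := congrFun hu1 (Sum.inl ())
      simpa [Matrix.mulVec, dotProduct, Fintype.sum_sum_type, borderedMatrix] using this
    have e1 : ∀ i, c i * u (Sum.inl ()) + ∑ j, D i j * u (Sum.inr j) = l * u (Sum.inr i) := by
      intro i
      have := congrFun hu1 (Sum.inr i)
      simpa [Matrix.mulVec, dotProduct, Fintype.sum_sum_type, borderedMatrix] using this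
    have hu0 : u (Sum.inl ()) ≠ 0 := by
      intro h0
      rw [h0] at e0
      simp only [h0, mul_zero, zero_add] at e0 e1
      have := hwD l (fun j => u (Sum.inr j)) e1 e0
      refine hu.2 (funext fun s => ?_)
      rcases s with s | s
      · exact h0
      · exact congrFun this s
    have hl' : a + ∑ j, w j * (u (Sum.inr j) / u (Sum.inl ())) = l := by
      simp_rw [mul_div_assoc']
      rw [← Finset.sum_div]
      field_simp
      linear_combination e0
    refine ⟨fun j => u (Sum.inr j) / u (Sum.inl ()), ?_, hl'⟩
    ext i
    rw [eigenvectorMap, hl']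
    simp_rw [mul_div_assoc']
    rw [← Finset.sum_div]
    field_simp
    linear_combination -(e1 i)
  have hroots : ∀ v, eigenvectorMap a w D v = c → p.roots = (a + ∑ j, w j * v j) ::ₘ
      (Matrix.of fun i j => D i j - v i * w j).charpoly.roots := by
    intro v hv
    rw [hp, ← hv, charpoly_borderedMatrix_eigenvectorMap, Polynomial.roots_mul, Polynomial.roots_X_sub_C,
      Multiset.singleton_add]
    exact mul_ne_zero (Polynomial.X_sub_C_ne_zero _) (Matrix.charpoly_monic _).ne_zero
  have hnd : p.roots.Nodup := by
    rw [Multiset.nodup_iff_count_le_one]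
    intro l
    by_cases hl : l ∈ p.roots
    · obtain ⟨v, hv, rfl⟩ := hex l hl
      rw [hroots v hv, Multiset.count_cons_self, Multiset.count_eq_zero_of_notMem]
      rw [Polynomial.mem_roots (Matrix.charpoly_monic _).ne_zero, Polynomial.IsRoot,
        Matrix.eval_charpoly]
      have := hreg v hv
      rw [det_fderiv_eigenvectorMap] at this
      intro h0
      rw [h0] at this
      simp at this
    · rw [Multiset.count_eq_zero_of_notMem hl]
      exact zero_le_one
  have hcard : p.roots.card = n + 1 := by
    rw [← (IsAlgClosed.splits p).natDegree_eq_card_roots, hp, Matrix.charpoly_natDegree_eq_dim]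
    simp [add_comm]
  have hinj : Set.InjOn (fun v : Fin n → ℂ => a + ∑ j, w j * v j)
      {v | eigenvectorMap a w D v = c} := by
    intro v hv v' hv' h
    simp only at h
    have := hwD (a + ∑ j, w j * v j) (v - v') (fun i => ?_) ?_
    · exact sub_eq_zero.1 this
    · have h1 := congrFun hv i
      have h2 := congrFun hv' i
      rw [eigenvectorMap] at h1 h2
      rw [← h] at h2
      simp only [Pi.sub_apply, mul_sub, Finset.sum_sub_distrib]
      linear_combination h2 - h1
    · simp only [Pi.sub_apply, mul_sub, Finset.sum_sub_distrib]
      linear_combination h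
  rw [← hinj.encard_image]
  have himg : (fun v : Fin n → ℂ => a + ∑ j, w j * v j) '' {v | eigenvectorMap a w D v = c} =
      (p.roots.toFinset : Set ℂ) := by
    ext l
    simp only [Set.mem_image, Set.mem_ofPred_eq, Finset.mem_coe, Multiset.mem_toFinset]
    refine ⟨?_, hex l⟩
    rintro ⟨v, hv, rfl⟩
    rw [hroots v hv]
    exact Multiset.mem_cons_self _ _
  rw [himg, Set.encard_coe_eq_coe_finsetCard, Multiset.toFinset_card_of_nodup hnd, hcard]

end Bordered

/-! ### Unitary invariance and removal of the shear -/

section Frobenius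

variable {m : Type*} [Fintype m]

/-- The squared Frobenius norm. -/
noncomputable def frobeniusSq (A : Matrix m m ℂ) : ℝ :=
  ∑ i, ∑ j, ‖A i j‖ ^ 2

theorem ofReal_frobeniusSq (A : Matrix m m ℂ) :
    (frobeniusSq A : ℂ) = (A * A.conjTranspose).trace := by
  simp only [frobeniusSq, Matrix.trace, Matrix.diag_apply, Matrix.mul_apply,
    Matrix.conjTranspose_apply, Complex.ofReal_sum]
  refine Finset.sum_congr rfl fun i _ => Finset.sum_congr rfl fun j _ => ?_
  rw [Complex.star_def, Complex.mul_conj, Complex.normSq_eq_norm_sq]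

theorem frobeniusSq_unitary_conj [DecidableEq m] {H : Matrix m m ℂ}
    (hH : H ∈ Matrix.unitaryGroup m ℂ) (A : Matrix m m ℂ) :
    frobeniusSq (H * A * H.conjTranspose) = frobeniusSq A := by
  have h1 : H.conjTranspose * H = 1 := (Matrix.mem_unitaryGroup_iff').1 hH
  have h2 : (frobeniusSq (H * A * H.conjTranspose) : ℂ) = frobeniusSq A := by
    rw [ofReal_frobeniusSq, ofReal_frobeniusSq, Matrix.conjTranspose_mul, Matrix.conjTranspose_mul,
      Matrix.conjTranspose_conjTranspose]
    have : H * A * H.conjTranspose * (H * (A.conjTranspose * H.conjTranspose)) =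
        H * (A * (H.conjTranspose * H) * A.conjTranspose * H.conjTranspose) := by
      simp only [mul_assoc]
    rw [this, h1, mul_one, Matrix.trace_mul_comm, mul_assoc, h1, mul_one]
  exact_mod_cast h2

end Frobenius

variable {n : ℕ}

/-- Normalise `(1, v)` and complete it to an orthonormal basis. The unitary matrix and the shear
then send the first basis vector to the same line. -/
theorem exists_unitary_first_column (v : Fin n → ℂ) :
    ∃ H ∈ Matrix.unitaryGroup (Unit ⊕ Fin n) ℂ, ∃ r : ℂ, H (Sum.inl ()) (Sum.inl ()) = r ∧
      ∀ i, H (Sum.inr i) (Sum.inl ()) = r * v i := by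
  set x : EuclideanSpace ℂ (Unit ⊕ Fin n) := WithLp.toLp 2 (Sum.elim (fun _ => 1) v) with hx
  have hx0 : x ≠ 0 := by
    intro h
    have := congrArg (fun y : EuclideanSpace ℂ (Unit ⊕ Fin n) => y (Sum.inl ())) h
    simp [hx] at this
  set u : EuclideanSpace ℂ (Unit ⊕ Fin n) := ((‖x‖⁻¹ : ℝ) : ℂ) • x with hu
  have hu1 : ‖u‖ = 1 := by
    rw [hu, norm_smul, Complex.norm_real, Real.norm_of_nonneg (by positivity),
      inv_mul_cancel₀ (norm_ne_zero_iff.2 hx0)]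
  have hon : Orthonormal ℂ (({Sum.inl ()} : Set (Unit ⊕ Fin n)).domRestrict fun _ => u) := by
    constructor
    · intro i; exact hu1
    · intro i j hij
      exact absurd (Subtype.ext (i.2.trans j.2.symm)) hij
  obtain ⟨b, hb⟩ := hon.exists_orthonormalBasis_extension_of_card_eq (by simp)
  have hb0 := hb (Sum.inl ()) rfl
  refine ⟨_, OrthonormalBasis.toMatrix_orthonormalBasis_mem_unitary
    (EuclideanSpace.basisFun (Unit ⊕ Fin n) ℂ) b, ((‖x‖⁻¹ : ℝ) : ℂ), ?_, fun i => ?_⟩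
  · simp [Module.Basis.toMatrix_apply, hb0, hu, hx]
  · simp [Module.Basis.toMatrix_apply, hb0, hu, hx]

/-- The space of block triangular matrices with a distinguished first row. -/
abbrev BlockTriangularSpace (n : ℕ) : Type :=
  (Fin n → ℂ) × (Fin n → Fin n → ℂ) × ℂ

/-- The block triangular matrix with the given blocks. -/
def blockTriangular (x : BlockTriangularSpace n) : Matrix (Unit ⊕ Fin n) (Unit ⊕ Fin n) ℂ :=
  borderedMatrix x.2.2 x.1 0 x.2.1

/-- Conjugation of a block triangular matrix by `R` (with `S` as its inverse). -/
def conjBlockTriangular (R S : Matrix (Unit ⊕ Fin n) (Unit ⊕ Fin n) ℂ) :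
    BlockTriangularSpace n →ₗ[ℝ] BlockTriangularSpace n where
  toFun x := (fun j => (R * blockTriangular x * S) (Sum.inl ()) (Sum.inr j),
    fun i j => (R * blockTriangular x * S) (Sum.inr i) (Sum.inr j),
    (R * blockTriangular x * S) (Sum.inl ()) (Sum.inl ()))
  map_add' x y := by
    have : blockTriangular (x + y) = blockTriangular x + blockTriangular y := by
      ext (i | i) (j | j) <;> simp [blockTriangular, borderedMatrix]
    rw [this, mul_add, add_mul]
    rfl
  map_smul' c x := by
    have : blockTriangular (c • x) = c • blockTriangular x := by
      ext (i | i) (j | j) <;> simp [blockTriangular, borderedMatrix]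
    rw [this, Matrix.mul_smul, Matrix.smul_mul]
    rfl

theorem blockTriangular_conjBlockTriangular {R S : Matrix (Unit ⊕ Fin n) (Unit ⊕ Fin n) ℂ}
    (hR : ∀ i, R (Sum.inr i) (Sum.inl ()) = 0) (hS : ∀ i, S (Sum.inr i) (Sum.inl ()) = 0)
    (x : BlockTriangularSpace n) :
    blockTriangular (conjBlockTriangular R S x) = R * blockTriangular x * S := by
  ext (i | i) (j | j)
  · rfl
  · rfl
  · simp [blockTriangular, borderedMatrix, Matrix.mul_apply, Fintype.sum_sum_type, hR, hS]
  · rfl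

theorem conjBlockTriangular_corner {R S : Matrix (Unit ⊕ Fin n) (Unit ⊕ Fin n) ℂ} (hRS : R * S = 1)
    (hS : ∀ i, S (Sum.inr i) (Sum.inl ()) = 0) (x : BlockTriangularSpace n) :
    (conjBlockTriangular R S x).2.2 = x.2.2 := by
  have h1 : R (Sum.inl ()) (Sum.inl ()) * S (Sum.inl ()) (Sum.inl ()) = 1 := by
    have := congrFun (congrFun hRS (Sum.inl ())) (Sum.inl ())
    simpa [Matrix.mul_apply, Fintype.sum_sum_type, hS] using this
  change (R * blockTriangular x * S) (Sum.inl ()) (Sum.inl ()) = x.2.2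
  simp only [Matrix.mul_apply, Fintype.sum_sum_type, hS, blockTriangular, borderedMatrix]
  simp
  linear_combination x.2.2 * h1

theorem eigenvalues_conjBlockTriangular {R S : Matrix (Unit ⊕ Fin n) (Unit ⊕ Fin n) ℂ}
    (hRS : R * S = 1) (hR : ∀ i, R (Sum.inr i) (Sum.inl ()) = 0)
    (hS : ∀ i, S (Sum.inr i) (Sum.inl ()) = 0) (x : BlockTriangularSpace n) :
    eigenvalues (conjBlockTriangular R S x).2.1 = eigenvalues x.2.1 := by
  have h1 := charpoly_mul_mul_eq hRS (blockTriangular x)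
  rw [← blockTriangular_conjBlockTriangular hR hS, blockTriangular, blockTriangular,
    charpoly_borderedMatrix_zero, charpoly_borderedMatrix_zero,
    conjBlockTriangular_corner hRS hS] at h1
  rw [eigenvalues, eigenvalues, mul_left_cancel₀ (Polynomial.X_sub_C_ne_zero _) h1]

theorem det_conjBlockTriangular_ne_zero {R S : Matrix (Unit ⊕ Fin n) (Unit ⊕ Fin n) ℂ}
    (hRS : R * S = 1) (hR : ∀ i, R (Sum.inr i) (Sum.inl ()) = 0)
    (hS : ∀ i, S (Sum.inr i) (Sum.inl ()) = 0) :
    LinearMap.det (conjBlockTriangular R S) ≠ 0 := by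
  intro h0
  have := LinearMap.bot_lt_ker_of_det_eq_zero h0
  refine this.ne' ?_
  rw [LinearMap.ker_eq_bot']
  intro x hx
  have h1 := blockTriangular_conjBlockTriangular hR hS x
  have hz : blockTriangular (0 : BlockTriangularSpace n) = 0 := by
    ext (i | i) (j | j) <;> simp [blockTriangular, borderedMatrix]
  rw [hx, hz] at h1
  have hSR := mul_eq_one_comm.1 hRS
  have h2 : blockTriangular x = 0 := by
    calc blockTriangular x = S * (R * blockTriangular x * S) * R := by
          rw [mul_assoc, mul_assoc, mul_assoc, hSR, mul_one, ← mul_assoc, hSR, one_mul]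
      _ = 0 := by rw [← h1, mul_zero, zero_mul]
  refine Prod.ext ?_ (Prod.ext ?_ ?_)
  · ext j; exact congrFun (congrFun h2 (Sum.inl ())) (Sum.inr j)
  · ext i j; exact congrFun (congrFun h2 (Sum.inr i)) (Sum.inr j)
  · exact congrFun (congrFun h2 (Sum.inl ())) (Sum.inl ())

theorem isAddHaarMeasure_pi_volume {ι : Type*} [Fintype ι] {X : Type*} [AddGroup X]
    [TopologicalSpace X] [MeasureSpace X] [IsTopologicalAddGroup X] [SecondCountableTopology X]
    [BorelSpace X] [SigmaFinite (volume : Measure X)] [(volume : Measure X).IsAddHaarMeasure] :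
    (volume : Measure (ι → X)).IsAddHaarMeasure :=
  inferInstanceAs (Measure.pi fun _ => (volume : Measure X)).IsAddHaarMeasure

theorem isAddHaarMeasure_prod_volume {X Y : Type*} [AddGroup X] [AddGroup Y]
    [TopologicalSpace X] [MeasureSpace X] [TopologicalSpace Y] [MeasureSpace Y]
    [IsTopologicalAddGroup X] [IsTopologicalAddGroup Y] [BorelSpace X] [BorelSpace Y]
    [SecondCountableTopology X] [SecondCountableTopology Y]
    [SigmaFinite (volume : Measure X)] [SigmaFinite (volume : Measure Y)]
    [(volume : Measure X).IsAddHaarMeasure] [(volume : Measure Y).IsAddHaarMeasure] :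
    (volume : Measure (X × Y)).IsAddHaarMeasure :=
  inferInstanceAs ((volume : Measure X).prod (volume : Measure Y)).IsAddHaarMeasure

/-- The Gaussian weight of a matrix. -/
noncomputable def gaussianWeight {m : Type*} [Fintype m] (s : ℝ) (A : Matrix m m ℂ) : ℝ≥0∞ :=
  ENNReal.ofReal (Real.exp (-s * frobeniusSq A))

/-- The conjugation by a shear can be undone at the price of a constant by a linear change of
variables among the block triangular matrices. -/
theorem exists_lintegral_shear_conj (s : ℝ) (v : Fin n → ℂ) :
    ∃ k : ℝ≥0∞, ∀ h : ℂ → Multiset ℂ → ℝ≥0∞,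
      Measurable (fun x : BlockTriangularSpace n => h x.2.2 (eigenvalues x.2.1)) →
      ∫⁻ x : BlockTriangularSpace n, h x.2.2 (eigenvalues x.2.1) *
          gaussianWeight s (shearMatrix v * blockTriangular x * shearMatrix (-v)) =
        k * ∫⁻ x : BlockTriangularSpace n, h x.2.2 (eigenvalues x.2.1) *
          gaussianWeight s (blockTriangular x) := by
  obtain ⟨H, hH, r, hr0, hr⟩ := exists_unitary_first_column v
  have hHH : H * H.conjTranspose = 1 := Matrix.mem_unitaryGroup_iff.1 hH
  have hHH' : H.conjTranspose * H = 1 := Matrix.mem_unitaryGroup_iff'.1 hH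
  have hL : shearMatrix v * shearMatrix (-v) = 1 := shearMatrix_mul_neg v
  have hL' : shearMatrix (-v) * shearMatrix v = 1 := mul_eq_one_comm.1 hL
  -- Since `H` and the shear map the first basis vector to the same line, `R` fixes that line and is
  -- block triangular, and so is its inverse `S`.
  set R := shearMatrix (-v) * H with hRdef
  set S := H.conjTranspose * shearMatrix v with hSdef
  have hRS : R * S = 1 := by
    rw [hRdef, hSdef, mul_assoc, ← mul_assoc H, hHH, one_mul, hL']
  have hR : ∀ i, R (Sum.inr i) (Sum.inl ()) = 0 := by
    intro i
    simp [hRdef, Matrix.mul_apply, Fintype.sum_sum_type, shearMatrix, borderedMatrix, hr0, hr]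
    ring
  have hr_ne : r ≠ 0 := by
    rintro rfl
    have := congrFun (congrFun hHH' (Sum.inl ())) (Sum.inl ())
    simp [Matrix.mul_apply, Fintype.sum_sum_type, hr0, hr] at this
  -- The other columns of `H` are orthogonal to the first one, which is `r` times `(1, v)`.
  have hS : ∀ i, S (Sum.inr i) (Sum.inl ()) = 0 := by
    intro i
    have := congrFun (congrFun hHH' (Sum.inr i)) (Sum.inl ())
    simp only [Matrix.mul_apply, Fintype.sum_sum_type, hr0, hr] at this
    simp [hSdef, Matrix.mul_apply, Fintype.sum_sum_type, shearMatrix, borderedMatrix]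
    refine mul_right_cancel₀ hr_ne ?_
    rw [zero_mul, add_mul, Finset.sum_mul]
    simp only [Finset.univ_unique, PUnit.default_eq_unit, Finset.sum_singleton,
      Matrix.conjTranspose_apply] at this
    rw [Matrix.one_apply_ne (by simp)] at this
    rw [← this]
    congr 1
    exact Finset.sum_congr rfl fun j _ => by simp; ring
  set ψ := conjBlockTriangular R S with hψ
  have hdet : LinearMap.det ψ ≠ 0 := det_conjBlockTriangular_ne_zero hRS hR hS
  have haar₁ : (volume : Measure (Fin n → Fin n → ℂ)).IsAddHaarMeasure := isAddHaarMeasure_pi_volume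
  have haar₂ : (volume : Measure ((Fin n → Fin n → ℂ) × ℂ)).IsAddHaarMeasure :=
    isAddHaarMeasure_prod_volume
  have haar₃ : (volume : Measure (BlockTriangularSpace n)).IsAddHaarMeasure :=
    isAddHaarMeasure_prod_volume
  have hmap := Measure.map_linearMap_addHaar_eq_smul_addHaar
    (volume : Measure (BlockTriangularSpace n)) hdet
  have hψm : Measurable ψ := (LinearMap.continuous_of_finiteDimensional ψ).measurable
  refine ⟨(ENNReal.ofReal |(LinearMap.det ψ)⁻¹|)⁻¹, fun h hh => ?_⟩
  set F : BlockTriangularSpace n → ℝ≥0∞ := fun x => h x.2.2 (eigenvalues x.2.1) *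
          gaussianWeight s (shearMatrix v * blockTriangular x * shearMatrix (-v)) with hF
  have hcont : Continuous (blockTriangular : BlockTriangularSpace n → _) := by
    refine continuous_matrix fun i j => ?_
    rcases i with i | i <;> rcases j with j | j <;>
      simp only [blockTriangular, borderedMatrix, Matrix.fromBlocks_apply₁₁,
        Matrix.fromBlocks_apply₁₂, Matrix.fromBlocks_apply₂₁, Matrix.fromBlocks_apply₂₂,
        Matrix.of_apply] <;> fun_prop
  have hFm : Measurable F := by
    refine hh.mul ?_
    refine ENNReal.measurable_ofReal.comp (Continuous.measurable ?_)
    have h2 : Continuous fun x : BlockTriangularSpace n =>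
        shearMatrix v * blockTriangular x * shearMatrix (-v) :=
      (continuous_const.matrix_mul hcont).matrix_mul continuous_const
    unfold frobeniusSq
    refine Real.continuous_exp.comp (continuous_const.mul ?_)
    exact continuous_finsetSum _ fun i _ => continuous_finsetSum _ fun j _ =>
      ((h2.matrix_elem i j).norm.pow 2)
  have h1 : ∫⁻ x, F x ∂(volume.map ψ) =
      ∫⁻ x : BlockTriangularSpace n, h x.2.2 (eigenvalues x.2.1) *
          gaussianWeight s (blockTriangular x) := by
    rw [lintegral_map hFm hψm]
    refine lintegral_congr fun x => ?_
    simp only [hF]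
    rw [hψ, conjBlockTriangular_corner hRS hS, eigenvalues_conjBlockTriangular hRS hR hS,
      blockTriangular_conjBlockTriangular hR hS]
    congr 1
    -- The shear composed with `R` is `H`, so the sheared conjugate becomes a unitary conjugate,
    -- which the Frobenius norm does not see.
    have : shearMatrix v * (R * blockTriangular x * S) * shearMatrix (-v) =
        H * blockTriangular x * H.conjTranspose := by
      calc shearMatrix v * (R * blockTriangular x * S) * shearMatrix (-v)
          = (shearMatrix v * shearMatrix (-v)) * H * blockTriangular x * H.conjTranspose *
            (shearMatrix v * shearMatrix (-v)) := by
            rw [hRdef, hSdef]; simp only [mul_assoc]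
        _ = _ := by rw [hL, one_mul, mul_one]
    rw [gaussianWeight, gaussianWeight, this, frobeniusSq_unitary_conj hH]
  rw [hmap, lintegral_smul_measure, smul_eq_mul] at h1
  rw [← h1, ← mul_assoc, ENNReal.inv_mul_cancel, one_mul]
  · simpa using inv_ne_zero hdet
  · exact ENNReal.ofReal_ne_top

/-! ### Integration over corner, row, column and block -/

section ConsMatrix

variable {n : ℕ}

/-- The entries of a matrix with prescribed corner, first row, first column and lower block. -/
def consMatrix (a : ℂ) (w c : Fin n → ℂ) (D : Fin n → Fin n → ℂ) : Fin (n + 1) → Fin (n + 1) → ℂ :=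
  Fin.cons (Fin.cons a w) fun i => Fin.cons (c i) (D i)

theorem eigenvalues_consMatrix (a : ℂ) (w c : Fin n → ℂ) (D : Fin n → Fin n → ℂ) :
    eigenvalues (consMatrix a w c D) = (borderedMatrix a w c D).charpoly.roots := by
  let e : Unit ⊕ Fin n ≃ Fin (n + 1) :=
    ((Equiv.sumComm _ _).trans (Equiv.optionEquivSumPUnit (Fin n)).symm).trans (finSuccEquiv n).symm
  have he0 : e (Sum.inl ()) = 0 := by simp [e]
  have he1 : ∀ i, e (Sum.inr i) = i.succ := fun i => by simp [e]
  have h1 : Matrix.of (consMatrix a w c D) = Matrix.reindex e e (borderedMatrix a w c D) := by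
    have hs0 : e.symm 0 = Sum.inl () := by rw [← he0, Equiv.symm_apply_apply]
    have hs1 : ∀ i, e.symm i.succ = Sum.inr i := fun i => by rw [← he1, Equiv.symm_apply_apply]
    ext i j
    refine Fin.cases ?_ (fun i => ?_) i <;> refine Fin.cases ?_ (fun j => ?_) j <;>
      simp [hs0, hs1, consMatrix, borderedMatrix]
  rw [eigenvalues, h1, Matrix.charpoly_reindex]

theorem frobeniusSq_consMatrix (a : ℂ) (w c : Fin n → ℂ) (D : Fin n → Fin n → ℂ) :
    frobeniusSq (Matrix.of (consMatrix a w c D)) = frobeniusSq (borderedMatrix a w c D) := by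
  simp [frobeniusSq, Fin.sum_univ_succ, consMatrix, borderedMatrix, Fintype.sum_sum_type]

theorem eigenvalues_consMatrix_eigenvectorMap (a : ℂ) (v w : Fin n → ℂ) (D : Fin n → Fin n → ℂ) :
    eigenvalues (consMatrix a w (eigenvectorMap a w D v) D) =
      (a + ∑ j, w j * v j) ::ₘ eigenvalues fun i j => D i j - v i * w j := by
  rw [eigenvalues_consMatrix, charpoly_borderedMatrix_eigenvectorMap, Polynomial.roots_mul,
    Polynomial.roots_X_sub_C, Multiset.singleton_add]
  · rfl
  · exact mul_ne_zero (Polynomial.X_sub_C_ne_zero _) (Matrix.charpoly_monic _).ne_zero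

theorem eigenvalues_consMatrix_zero (l : ℂ) (D : Fin n → Fin n → ℂ) :
    eigenvalues (consMatrix l 0 0 D) = l ::ₘ eigenvalues D := by
  rw [eigenvalues_consMatrix, charpoly_borderedMatrix_zero, Polynomial.roots_mul,
    Polynomial.roots_X_sub_C, Multiset.singleton_add]
  · rfl
  · exact mul_ne_zero (Polynomial.X_sub_C_ne_zero _) (Matrix.charpoly_monic _).ne_zero

theorem measurePreserving_fin_cons {X : Type*} [MeasureSpace X] [SigmaFinite (volume : Measure X)] :
    MeasurePreserving (fun p : X × (Fin n → X) => (Fin.cons p.1 p.2 : Fin (n + 1) → X))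
      volume volume := by
  have h1 := (volume_preserving_piFinSuccAbove (fun _ : Fin (n + 1) => X) 0).symm
  have h2 : ⇑(MeasurableEquiv.piFinSuccAbove (fun _ : Fin (n + 1) => X) 0).symm =
      fun p => Fin.cons p.1 p.2 := funext fun p => Fin.insertNth_zero' p.1 p.2
  rwa [h2] at h1

theorem measurePreserving_consMatrix :
    MeasurePreserving (fun p : (ℂ × (Fin n → ℂ)) × ((Fin n → ℂ) × (Fin n → Fin n → ℂ)) =>
      consMatrix p.1.1 p.1.2 p.2.1 p.2.2) volume volume := by
  have h1 : MeasurePreserving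
      (fun q : (Fin n → ℂ) × (Fin n → Fin n → ℂ) =>
        fun i => (Fin.cons (q.1 i) (q.2 i) : Fin (n + 1) → ℂ)) volume volume :=
    (volume_preserving_pi fun _ : Fin n => measurePreserving_fin_cons (n := n) (X := ℂ)).comp
      (volume_measurePreserving_arrowProdEquivProdArrow ℂ (Fin n → ℂ) (Fin n)).symm
  exact measurePreserving_fin_cons.comp (measurePreserving_fin_cons.prod h1)

theorem lintegral_consMatrix {F : (Fin (n + 1) → Fin (n + 1) → ℂ) → ℝ≥0∞} (hF : Measurable F) :
    ∫⁻ x, F x = ∫⁻ (D : Fin n → Fin n → ℂ) (w : Fin n → ℂ) (a : ℂ) (c : Fin n → ℂ),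
      F (consMatrix a w c D) := by
  have hm := measurePreserving_consMatrix (n := n)
  rw [← hm.lintegral_comp hF, Measure.volume_eq_prod,
    lintegral_prod (fun p : (ℂ × (Fin n → ℂ)) × ((Fin n → ℂ) × (Fin n → Fin n → ℂ)) =>
      F (consMatrix p.1.1 p.1.2 p.2.1 p.2.2)) (hF.comp hm.measurable).aemeasurable]
  have h1 : ∀ p : ℂ × (Fin n → ℂ), ∫⁻ q : (Fin n → ℂ) × (Fin n → Fin n → ℂ),
      F (consMatrix p.1 p.2 q.1 q.2) =
      ∫⁻ (D : Fin n → Fin n → ℂ) (c : Fin n → ℂ), F (consMatrix p.1 p.2 c D) := by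
    intro p
    rw [Measure.volume_eq_prod]
    exact lintegral_prod_symm' _ (hF.comp (hm.measurable.comp measurable_prodMk_left))
  simp_rw [h1]
  have hH : Measurable fun y : (ℂ × (Fin n → ℂ)) × (Fin n → Fin n → ℂ) =>
      ∫⁻ c : Fin n → ℂ, F (consMatrix y.1.1 y.1.2 c y.2) :=
    Measurable.lintegral_prod_right'
      (f := fun y : ((ℂ × (Fin n → ℂ)) × (Fin n → Fin n → ℂ)) × (Fin n → ℂ) =>
        F (consMatrix y.1.1.1 y.1.1.2 y.2 y.1.2))
      ((hF.comp hm.measurable).comp (f := fun y : ((ℂ × (Fin n → ℂ)) × (Fin n → Fin n → ℂ)) ×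
        (Fin n → ℂ) => (y.1.1, (y.2, y.1.2))) (by fun_prop))
  rw [lintegral_lintegral_swap hH.aemeasurable]
  refine lintegral_congr fun D => ?_
  rw [Measure.volume_eq_prod]
  exact lintegral_prod_symm' _ (hH.comp measurable_prodMk_right)

end ConsMatrix

/-! ### Generic matrices and the substitution of the eigenvector for the column -/

section GenericMatrix

variable {n : ℕ}

/-- With a simple spectrum, the eigenvectors of `D` fill finitely many lines, so `w` only has to
avoid finitely many proper subspaces, each of measure zero. -/
theorem ae_isCyclicPair {D : Fin n → Fin n → ℂ} (hD : (eigenvalues D).Nodup) :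
    ∀ᵐ w : Fin n → ℂ, IsCyclicPair w D := by
  have h1 : ∀ l ∈ (eigenvalues D).toFinset, ∀ᵐ w : Fin n → ℂ, ∀ u : Fin n → ℂ,
      (∀ i, ∑ j, D i j * u j = l * u i) → ∑ j, w j * u j = 0 → u = 0 := by
    intro l hl
    have hev : ∀ u : Fin n → ℂ, (∀ i, ∑ j, D i j * u j = l * u i) ↔
        u ∈ Module.End.eigenspace (Matrix.toLin' (Matrix.of D)) l := by
      intro u
      rw [Module.End.mem_eigenspace_iff, funext_iff]
      simp [Matrix.mulVec, dotProduct]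
    have hrank : Module.finrank ℂ (Module.End.eigenspace (Matrix.toLin' (Matrix.of D)) l) ≤ 1 := by
      refine (LinearMap.finrank_eigenspace_le _ l).trans ?_
      rw [Matrix.charpoly_toLin', ← Polynomial.count_roots]
      exact Multiset.nodup_iff_count_le_one.1 hD l
    obtain ⟨u₀, hu₀⟩ := finrank_le_one_iff.1 hrank
    by_cases hz : (u₀ : Fin n → ℂ) = 0
    · refine Filter.Eventually.of_forall fun w u hu _ => ?_
      obtain ⟨c, hc⟩ := hu₀ ⟨u, (hev u).1 hu⟩
      have := congrArg Subtype.val hc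
      simp only [Submodule.coe_smul, hz, smul_zero] at this
      exact this.symm
    · set P : Submodule ℝ (Fin n → ℂ) :=
        { carrier := {w | ∑ j, w j * (u₀ : Fin n → ℂ) j = 0}
          add_mem' := by
            intro a b ha hb
            simp only [Set.mem_ofPred_eq, Pi.add_apply, add_mul, Finset.sum_add_distrib] at *
            rw [ha, hb, add_zero]
          zero_mem' := by simp
          smul_mem' := by
            intro c a ha
            simp only [Set.mem_ofPred_eq, Pi.smul_apply, smul_mul_assoc, ← Finset.smul_sum] at *
            rw [ha, smul_zero] } with hP
      have hPt : P ≠ ⊤ := by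
        intro htop
        obtain ⟨i, hi⟩ := Function.ne_iff.1 hz
        have : Pi.single i 1 ∈ P := htop ▸ Submodule.mem_top
        change ∑ j, (Pi.single i 1 : Fin n → ℂ) j * (u₀ : Fin n → ℂ) j = 0 at this
        simp [Pi.single_apply] at this
        exact hi (by simpa using this)
      have hnull := Measure.addHaar_submodule (volume : Measure (Fin n → ℂ)) P hPt
      have hae : ∀ᵐ w : Fin n → ℂ, w ∉ P := measure_eq_zero_iff_ae_notMem.1 hnull
      filter_upwards [hae] with w hw u hu hwu
      obtain ⟨c, hc⟩ := hu₀ ⟨u, (hev u).1 hu⟩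
      have hcu : c • (u₀ : Fin n → ℂ) = u := congrArg Subtype.val hc
      have hc0 : c = 0 := by
        by_contra hc0
        refine hw ?_
        change ∑ j, w j * (u₀ : Fin n → ℂ) j = 0
        rw [← hcu] at hwu
        simp only [Pi.smul_apply, smul_eq_mul, mul_left_comm _ c, ← Finset.mul_sum] at hwu
        exact (mul_eq_zero.1 hwu).resolve_left hc0
      rw [← hcu, hc0, zero_smul]
  have h2 := (Filter.eventually_all_finset _).2 h1
  filter_upwards [h2] with w hw l u hu hwu
  by_contra hu0
  refine hu0 (hw l ?_ u hu hwu)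
  rw [Multiset.mem_toFinset, eigenvalues, Polynomial.mem_roots (Matrix.charpoly_monic _).ne_zero,
    ← Matrix.mem_spectrum_iff_isRoot_charpoly, ← Matrix.spectrum_toLin',
    ← Module.End.hasEigenvalue_iff_mem_spectrum]
  refine Module.End.hasEigenvalue_of_hasEigenvector (x := u) ⟨?_, hu0⟩
  rw [Module.End.mem_eigenspace_iff, funext_iff]
  simpa [Matrix.mulVec, dotProduct] using hu

/-- By Sard's theorem almost every `c` is a regular value, and for a cyclic pair a regular value has
exactly `n + 1` preimages. -/
theorem lintegral_eigenvectorMap {w : Fin n → ℂ} {D : Fin n → Fin n → ℂ} (hwD : IsCyclicPair w D)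
    (a : ℂ) {G : (Fin n → ℂ) → ℝ≥0∞} (hG : Measurable G) :
    ((n + 1 : ℕ) : ℝ≥0∞) * ∫⁻ c, G c = ∫⁻ v : Fin n → ℂ,
      ENNReal.ofReal (‖((eigenvalues fun i j => D i j - v i * w j).map
        fun l => a + ∑ j, w j * v j - l).prod‖ ^ 2) * G (eigenvectorMap a w D v) := by
  have hsard : volume (eigenvectorMap a w D ''
      {v | (fderiv ℝ (eigenvectorMap a w D) v).det = 0}) = 0 :=
    addHaar_image_eq_zero_of_det_fderivWithin_eq_zero volume
      (fun v _ => (((contDiff_eigenvectorMap a w D).differentiable one_ne_zero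
        v).hasFDerivAt).hasFDerivWithinAt) fun v hv => hv
  rw [← lintegral_abs_det_fderiv_mul_comp volume (contDiff_eigenvectorMap a w D) ?_ hG]
  · refine lintegral_congr fun v => ?_
    rw [det_fderiv_eigenvectorMap, abs_of_nonneg (by positivity), ← prod_sub_eigenvalues]
  · filter_upwards [measure_eq_zero_iff_ae_notMem.1 hsard] with c hc
    have hreg : ∀ v, eigenvectorMap a w D v = c →
        (fderiv ℝ (eigenvectorMap a w D) v).det ≠ 0 := fun v hv h0 => hc ⟨v, h0, hv⟩
    rw [← encard_eigenvectorMap_fiber hwD hreg]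
    congr 1
    ext v
    exact ⟨fun h => h.1, fun h => ⟨h, hreg v h⟩⟩

end GenericMatrix

/-! ### Iterated integrals and Gaussian weights -/

/-- Moving the outermost of four integrals to the innermost place, the two middle ones being
exchanged. -/
theorem lintegral_rotate_four {α β γ δ : Type*} [MeasureSpace α] [MeasureSpace β] [MeasureSpace γ]
    [MeasureSpace δ] [SFinite (volume : Measure α)] [SFinite (volume : Measure β)]
    [SFinite (volume : Measure γ)] [SFinite (volume : Measure δ)] {Θ : α → β → γ → δ → ℝ≥0∞}
    (hΘ : Measurable fun p : α × β × γ × δ => Θ p.1 p.2.1 p.2.2.1 p.2.2.2) :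
    ∫⁻ (v : α) (w : β) (D : γ) (a : δ), Θ v w D a =
      ∫⁻ (D : γ) (w : β) (a : δ) (v : α), Θ v w D a := by
  have h1 : Measurable fun p : (α × β × γ) => ∫⁻ a, Θ p.1 p.2.1 p.2.2 a :=
    Measurable.lintegral_prod_right' (f := fun q : (α × β × γ) × δ => Θ q.1.1 q.1.2.1 q.1.2.2 q.2)
      (hΘ.comp (f := fun q : (α × β × γ) × δ => (q.1.1, q.1.2.1, q.1.2.2, q.2)) (by fun_prop))
  have h2 : Measurable fun p : α × γ => ∫⁻ (w : β) (a : δ), Θ p.1 w p.2 a :=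
    Measurable.lintegral_prod_right' (f := fun q : (α × γ) × β => ∫⁻ a, Θ q.1.1 q.2 q.1.2 a)
      (h1.comp (f := fun q : (α × γ) × β => (q.1.1, q.2, q.1.2)) (by fun_prop))
  calc ∫⁻ (v : α) (w : β) (D : γ) (a : δ), Θ v w D a
      = ∫⁻ (v : α) (D : γ) (w : β) (a : δ), Θ v w D a :=
        lintegral_congr fun v => lintegral_lintegral_swap
          (h1.comp (f := fun q : β × γ => (v, q.1, q.2)) (by fun_prop)).aemeasurable
    _ = ∫⁻ (D : γ) (v : α) (w : β) (a : δ), Θ v w D a := lintegral_lintegral_swap h2.aemeasurable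
    _ = ∫⁻ (D : γ) (w : β) (v : α) (a : δ), Θ v w D a :=
        lintegral_congr fun D => lintegral_lintegral_swap
          (h1.comp (f := fun q : α × β => (q.1, q.2, D)) (by fun_prop)).aemeasurable
    _ = ∫⁻ (D : γ) (w : β) (a : δ) (v : α), Θ v w D a :=
        lintegral_congr fun D => lintegral_congr fun w => lintegral_lintegral_swap
          (hΘ.comp (f := fun q : α × δ => (q.1, w, D, q.2)) (by fun_prop)).aemeasurable

/-- The unnormalised joint density of the eigenvalues of a Gaussian matrix. -/
noncomputable def eigenvalueWeight {n : ℕ} (s : ℝ) (z : Fin n → ℂ) : ℝ≥0∞ :=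
  ENNReal.ofReal ((∏ i, ∏ j ∈ Finset.Ioi i, ‖z i - z j‖ ^ 2) * ∏ i, Real.exp (-s * ‖z i‖ ^ 2))

theorem measurable_eigenvalueWeight {n : ℕ} (s : ℝ) :
    Measurable (eigenvalueWeight s : (Fin n → ℂ) → ℝ≥0∞) := by
  refine ENNReal.measurable_ofReal.comp (Continuous.measurable ?_)
  fun_prop

/-- Adding the point `l` brings in its squared distances to the other points, the very factor
produced by the Jacobian of the eigenvector substitution. -/
theorem eigenvalueWeight_cons {n : ℕ} (s : ℝ) (l : ℂ) (z : Fin n → ℂ) :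
    eigenvalueWeight s (Fin.cons l z : Fin (n + 1) → ℂ) =
      ENNReal.ofReal (Real.exp (-s * ‖l‖ ^ 2)) *
        (ENNReal.ofReal (‖((coordMultiset z).map fun t => l - t).prod‖ ^ 2) *
          eigenvalueWeight s z) := by
  have h1 : ((coordMultiset z).map fun t => l - t).prod = ∏ j, (l - z j) := by
    rw [coordMultiset, Multiset.map_map]; rfl
  rw [eigenvalueWeight, eigenvalueWeight, ← ENNReal.ofReal_mul (by positivity),
    ← ENNReal.ofReal_mul (by positivity), h1, Fin.prod_univ_succ, Fin.prod_univ_succ,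
    Fin.prod_Ioi_zero]
  simp only [Fin.prod_Ioi_succ, Fin.cons_zero, Fin.cons_succ, norm_prod, Finset.prod_pow]
  congr 1
  ring

/-- The Gaussian weight of a complex number. -/
noncomputable def scalarWeight (s : ℝ) (l : ℂ) : ℝ≥0∞ :=
  ENNReal.ofReal (Real.exp (-s * ‖l‖ ^ 2))

theorem measurable_scalarWeight (s : ℝ) : Measurable (scalarWeight s) := by
  unfold scalarWeight; fun_prop

theorem lintegral_scalarWeight_ne_top {s : ℝ} (hs : 0 < s) : ∫⁻ l, scalarWeight s l ≠ ∞ := by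
  have h1 := Complex.integral_rpow_mul_exp_neg_mul_rpow (p := 2) (q := 0) (b := s) one_le_two
    (by norm_num) hs
  have h2 : Integrable fun x : ℂ => ‖x‖ ^ (0 : ℝ) * Real.exp (-s * ‖x‖ ^ (2 : ℝ)) := by
    -- The Bochner integral of a non-integrable function is `0` by convention, so its nonzero value
    -- proves integrability.
    refine Integrable.of_integral_ne_zero ?_
    rw [h1]
    have : Real.Gamma ((0 + 2) / 2) ≠ 0 := (Real.Gamma_pos_of_pos (by norm_num)).ne'
    positivity
  have h3 := h2.lintegral_lt_top
  simpa [scalarWeight] using h3.ne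

theorem lintegral_scalarWeight_ne_zero (s : ℝ) : ∫⁻ l, scalarWeight s l ≠ 0 := by
  rw [Ne, lintegral_eq_zero_iff (measurable_scalarWeight s)]
  intro h
  obtain ⟨l, hl⟩ := h.exists
  simp only [scalarWeight, Pi.zero_apply, ENNReal.ofReal_eq_zero] at hl
  exact absurd hl (not_le.2 (Real.exp_pos _))

/-- The Gaussian weight of a vector. -/
noncomputable def vectorWeight {n : ℕ} (s : ℝ) (w : Fin n → ℂ) : ℝ≥0∞ := ∏ i, scalarWeight s (w i)

theorem measurable_vectorWeight {n : ℕ} (s : ℝ) :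
    Measurable (vectorWeight s : (Fin n → ℂ) → ℝ≥0∞) :=
  Finset.measurable_prod _ fun i _ => (measurable_scalarWeight s).comp (measurable_pi_apply i)

theorem lintegral_vectorWeight {n : ℕ} (s : ℝ) :
    ∫⁻ w : Fin n → ℂ, vectorWeight s w = (∫⁻ l, scalarWeight s l) ^ n := by
  have := lintegral_pi_prod_eq_prod (ι := Fin n) (μ := fun _ => (volume : Measure ℂ))
    (f := fun _ => scalarWeight s) fun _ => measurable_scalarWeight s
  exact this.trans (by simp)

theorem gaussianWeight_of_eq {n : ℕ} (s : ℝ) (D : Fin n → Fin n → ℂ) :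
    gaussianWeight s (Matrix.of D) = ∏ i, vectorWeight s (D i) := by
  simp only [gaussianWeight, vectorWeight, scalarWeight, frobeniusSq, Matrix.of_apply]
  rw [Finset.mul_sum, Real.exp_sum, ENNReal.ofReal_prod_of_nonneg fun i _ => by positivity]
  refine Finset.prod_congr rfl fun i _ => ?_
  rw [Finset.mul_sum, Real.exp_sum, ENNReal.ofReal_prod_of_nonneg fun i _ => by positivity]

theorem measurable_gaussianWeight_of {n : ℕ} (s : ℝ) :
    Measurable fun D : Fin n → Fin n → ℂ => gaussianWeight s (Matrix.of D) := by
  simp_rw [gaussianWeight_of_eq]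
  exact Finset.measurable_prod _ fun i _ => (measurable_vectorWeight s).comp (measurable_pi_apply i)

theorem lintegral_gaussianWeight_of {n : ℕ} (s : ℝ) :
    ∫⁻ D : Fin n → Fin n → ℂ, gaussianWeight s (Matrix.of D) =
      ((∫⁻ l, scalarWeight s l) ^ n) ^ n := by
  simp_rw [gaussianWeight_of_eq]
  have := lintegral_pi_prod_eq_prod (ι := Fin n) (μ := fun _ => (volume : Measure (Fin n → ℂ)))
    (f := fun _ => vectorWeight s) fun _ => measurable_vectorWeight s
  exact this.trans (by simp [lintegral_vectorWeight])

theorem gaussianWeight_blockTriangular {n : ℕ} (s : ℝ) (x : BlockTriangularSpace n) :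
    gaussianWeight s (blockTriangular x) =
      vectorWeight s x.1 * (gaussianWeight s (Matrix.of x.2.1) * scalarWeight s x.2.2) := by
  have h1 : vectorWeight s x.1 = ENNReal.ofReal (Real.exp (-s * ∑ j, ‖x.1 j‖ ^ 2)) := by
    rw [vectorWeight, Finset.mul_sum, Real.exp_sum,
      ENNReal.ofReal_prod_of_nonneg fun i _ => by positivity]
    rfl
  rw [h1, gaussianWeight, gaussianWeight, scalarWeight, ← ENNReal.ofReal_mul (by positivity),
    ← ENNReal.ofReal_mul (by positivity), ← Real.exp_add, ← Real.exp_add]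
  congr 2
  simp [frobeniusSq, blockTriangular, borderedMatrix, Fintype.sum_sum_type]
  ring

theorem lintegral_blockTriangularSpace {n : ℕ} {F : BlockTriangularSpace n → ℝ≥0∞}
    (hF : Measurable F) :
    ∫⁻ x, F x = ∫⁻ (w : Fin n → ℂ) (D : Fin n → Fin n → ℂ) (l : ℂ), F (w, D, l) := by
  rw [Measure.volume_eq_prod, lintegral_prod _ hF.aemeasurable]
  refine lintegral_congr fun w => ?_
  rw [Measure.volume_eq_prod]
  exact lintegral_prod _ (hF.comp measurable_prodMk_left).aemeasurable

theorem lintegral_mul_gaussianWeight_blockTriangular {n : ℕ} (s : ℝ)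
    {h : ℂ → (Fin n → Fin n → ℂ) → ℝ≥0∞} (hh : Measurable (Function.uncurry h)) :
    ∫⁻ x : BlockTriangularSpace n, h x.2.2 x.2.1 * gaussianWeight s (blockTriangular x) =
      (∫⁻ l, scalarWeight s l) ^ n * ∫⁻ l, scalarWeight s l *
        ∫⁻ D : Fin n → Fin n → ℂ, h l D * gaussianWeight s (Matrix.of D) := by
  have hm : Measurable fun q : (Fin n → Fin n → ℂ) × ℂ =>
      h q.2 q.1 * (gaussianWeight s (Matrix.of q.1) * scalarWeight s q.2) :=
    (hh.comp measurable_swap).mul (((measurable_gaussianWeight_of s).comp measurable_fst).mul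
      ((measurable_scalarWeight s).comp measurable_snd))
  simp_rw [gaussianWeight_blockTriangular]
  have h1 : ∀ x : BlockTriangularSpace n, h x.2.2 x.2.1 *
      (vectorWeight s x.1 * (gaussianWeight s (Matrix.of x.2.1) * scalarWeight s x.2.2)) =
      vectorWeight s x.1 * (h x.2.2 x.2.1 *
        (gaussianWeight s (Matrix.of x.2.1) * scalarWeight s x.2.2)) := fun x => by ring
  simp_rw [h1]
  rw [Measure.volume_eq_prod, lintegral_prod_mul (f := vectorWeight s)
    (g := fun q : (Fin n → Fin n → ℂ) × ℂ =>
      h q.2 q.1 * (gaussianWeight s (Matrix.of q.1) * scalarWeight s q.2))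
    (measurable_vectorWeight s).aemeasurable hm.aemeasurable, lintegral_vectorWeight,
    Measure.volume_eq_prod, lintegral_prod_symm' _ hm]
  congr 1
  refine lintegral_congr fun l => ?_
  have hl : Measurable (h l) := hh.comp measurable_prodMk_left
  have hlm : Measurable fun D : Fin n → Fin n → ℂ => h l D * gaussianWeight s (Matrix.of D) :=
    hl.mul (measurable_gaussianWeight_of s)
  rw [← lintegral_const_mul _ hlm]
  exact lintegral_congr fun D => by ring

theorem measurable_lintegral_fin_cons {n : ℕ} {F : (Fin (n + 1) → ℂ) → ℝ≥0∞}
    (hF : Measurable F) :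
    Measurable fun l : ℂ => ∫⁻ z : Fin n → ℂ, F (Fin.cons l z : Fin (n + 1) → ℂ) :=
  Measurable.lintegral_prod_right' (f := fun q : ℂ × (Fin n → ℂ) =>
    F (Fin.cons q.1 q.2 : Fin (n + 1) → ℂ))
    (hF.comp (measurePreserving_fin_cons (n := n) (X := ℂ)).measurable)

theorem lintegral_fin_cons {n : ℕ} {F : (Fin (n + 1) → ℂ) → ℝ≥0∞} (hF : Measurable F) :
    ∫⁻ (l : ℂ) (z : Fin n → ℂ), F (Fin.cons l z : Fin (n + 1) → ℂ) = ∫⁻ z, F z := by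
  have hm := measurePreserving_fin_cons (n := n) (X := ℂ)
  rw [← hm.lintegral_comp hF, Measure.volume_eq_prod]
  exact (lintegral_prod (fun q : ℂ × (Fin n → ℂ) => F (Fin.cons q.1 q.2 : Fin (n + 1) → ℂ))
    (hF.comp hm.measurable).aemeasurable).symm

/-! ### The joint eigenvalue density, by induction on the size -/

section EigenvalueDensity

/-- The eigenvalues of a Gaussian matrix of size `n` have a joint density proportional to
`eigenvalueWeight`. -/
def HasEigenvalueDensity (s : ℝ) (n : ℕ) : Prop :=
  ∃ C : ℝ≥0∞, ∀ g : Multiset ℂ → ℝ≥0∞, Measurable (fun z : Fin n → ℂ => g (coordMultiset z)) →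
    ∫⁻ x : Fin n → Fin n → ℂ, g (eigenvalues x) * gaussianWeight s (Matrix.of x) =
      C * ∫⁻ z : Fin n → ℂ, g (coordMultiset z) * eigenvalueWeight s z

theorem hasEigenvalueDensity_zero (s : ℝ) : HasEigenvalueDensity s 0 := by
  refine ⟨1, fun g _ => ?_⟩
  have h1 : ∀ x : Fin 0 → Fin 0 → ℂ, eigenvalues x = 0 := fun x =>
    Multiset.card_eq_zero.1 (card_eigenvalues x)
  simp [h1, gaussianWeight, frobeniusSq, eigenvalueWeight, coordMultiset, volume_pi]

variable {n : ℕ} {s : ℝ}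

/-- Test the density on the indicator of multisets with a repetition. The diagonals are null, and
the Gaussian weight is positive everywhere. The induction thus supplies its own genericity. -/
theorem HasEigenvalueDensity.ae_nodup (h : HasEigenvalueDensity s n) :
    ∀ᵐ D : Fin n → Fin n → ℂ, (eigenvalues D).Nodup := by
  classical
  obtain ⟨C, hC⟩ := h
  set g : Multiset ℂ → ℝ≥0∞ := fun m => if m.Nodup then 0 else 1 with hg
  have hnd : ∀ z : Fin n → ℂ, (coordMultiset z).Nodup ↔ ∀ i j, i ≠ j → z i ≠ z j := by
    intro z
    rw [coordMultiset, Multiset.nodup_map_iff_inj_on Finset.univ.nodup]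
    constructor
    · intro hz i j hij hzz
      exact hij (hz i (Finset.mem_univ_val _) j (Finset.mem_univ_val _) hzz)
    · intro hz i _ j _ hzz
      by_contra hij
      exact hz i j hij hzz
  have hgm : Measurable fun z : Fin n → ℂ => g (coordMultiset z) := by
    refine Measurable.ite ?_ measurable_const measurable_const
    simp_rw [hnd]
    simp only [Set.ofPred_forall]
    refine MeasurableSet.iInter fun i => MeasurableSet.iInter fun j => MeasurableSet.iInter fun _ => ?_
    exact (isOpen_ne_fun (continuous_apply i) (continuous_apply j)).measurableSet
  have hae : ∀ᵐ z : Fin n → ℂ, (coordMultiset z).Nodup := by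
    simp_rw [hnd]
    rw [Filter.eventually_all]; intro i
    rw [Filter.eventually_all]; intro j
    by_cases hij : i = j
    · exact Filter.Eventually.of_forall fun _ h => absurd hij h
    · set P : Submodule ℝ (Fin n → ℂ) :=
        LinearMap.ker ((LinearMap.proj i : (Fin n → ℂ) →ₗ[ℝ] ℂ) - LinearMap.proj j) with hP
      have hPt : P ≠ ⊤ := by
        intro htop
        have : Pi.single i 1 ∈ P := htop ▸ Submodule.mem_top
        rw [hP, LinearMap.mem_ker] at this
        simp [Ne.symm hij] at this
      filter_upwards [measure_eq_zero_iff_ae_notMem.1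
        (Measure.addHaar_submodule (volume : Measure (Fin n → ℂ)) P hPt)] with z hz _ hzz
      refine hz ?_
      change z ∈ LinearMap.ker _
      rw [LinearMap.mem_ker]
      simp [hzz]
  have h0 := hC g hgm
  have hz : ∫⁻ z : Fin n → ℂ, g (coordMultiset z) * eigenvalueWeight s z = 0 := by
    have hm : Measurable fun z : Fin n → ℂ => g (coordMultiset z) * eigenvalueWeight s z :=
      hgm.mul (measurable_eigenvalueWeight s)
    rw [lintegral_eq_zero_iff hm]
    filter_upwards [hae] with z hz
    simp [hg, hz]
  have hm : Measurable fun x : Fin n → Fin n → ℂ =>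
      g (eigenvalues x) * gaussianWeight s (Matrix.of x) :=
    (measurable_comp_eigenvalues hgm).mul (measurable_gaussianWeight_of s)
  rw [hz, mul_zero, lintegral_eq_zero_iff hm] at h0
  filter_upwards [h0] with D hD
  by_contra hnot
  simp [hg, hnot, gaussianWeight] at hD
  exact absurd hD (not_le.2 (Real.exp_pos _))

/-- The multiset `l ::ₘ eigenvalues D` is the spectrum of a block diagonal matrix of size `n + 1`.
-/
theorem measurable_cons_eigenvalues {g : Multiset ℂ → ℝ≥0∞}
    (hg : Measurable fun z : Fin (n + 1) → ℂ => g (coordMultiset z)) :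
    Measurable fun q : ℂ × (Fin n → Fin n → ℂ) => g (q.1 ::ₘ eigenvalues q.2) := by
  simp_rw [← eigenvalues_consMatrix_zero]
  refine (measurable_comp_eigenvalues hg).comp
    (f := fun q : ℂ × (Fin n → Fin n → ℂ) => consMatrix q.1 0 0 q.2) ?_
  have hc : Measurable fun q : ℂ × (Fin n → Fin n → ℂ) => ((q.1, (0 : Fin n → ℂ)),
      ((0 : Fin n → ℂ), q.2)) := by fun_prop
  exact measurePreserving_consMatrix.measurable.comp hc

theorem measurable_norm_sq_prod_sub_eigenvalues :
    Measurable fun q : ℂ × (Fin n → Fin n → ℂ) =>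
      ENNReal.ofReal (‖((eigenvalues q.2).map fun t => q.1 - t).prod‖ ^ 2) := by
  simp_rw [prod_sub_eigenvalues]
  refine ENNReal.measurable_ofReal.comp (Continuous.measurable ?_)
  refine Continuous.pow (Continuous.norm (Continuous.matrix_det ?_)) 2
  refine Continuous.sub ?_ continuous_snd
  refine continuous_matrix fun i j => ?_
  simp only [Matrix.scalar_apply, Matrix.diagonal_apply]
  split_ifs <;> fun_prop

theorem continuous_borderedMatrix {X : Type*} [TopologicalSpace X] {a : X → ℂ} {w c : X → Fin n → ℂ}
    {D : X → Fin n → Fin n → ℂ} (ha : Continuous a) (hw : Continuous w) (hc : Continuous c)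
    (hD : Continuous D) : Continuous fun x => borderedMatrix (a x) (w x) (c x) (D x) := by
  refine continuous_matrix fun i j => ?_
  rcases i with i | i <;> rcases j with j | j <;>
    simp only [borderedMatrix, Matrix.fromBlocks_apply₁₁, Matrix.fromBlocks_apply₁₂,
      Matrix.fromBlocks_apply₂₁, Matrix.fromBlocks_apply₂₂, Matrix.of_apply] <;> fun_prop

theorem measurable_gaussianWeight_comp {X m : Type*} [Fintype m] [TopologicalSpace X]
    [MeasurableSpace X] [OpensMeasurableSpace X] {A : X → Matrix m m ℂ} (hA : Continuous A) :
    Measurable fun x => gaussianWeight s (A x) := by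
  refine ENNReal.measurable_ofReal.comp (Continuous.measurable ?_)
  unfold frobeniusSq
  refine Real.continuous_exp.comp (continuous_const.mul ?_)
  exact continuous_finsetSum _ fun i _ => continuous_finsetSum _ fun j _ =>
    ((hA.matrix_elem i j).norm.pow 2)

/-- Once `v` is outermost and `w` is fixed, the substitutions are translations of `D` by `v wᵀ` and
of `a` by `w·v`. -/
theorem lintegral_blockTriangularSpace_shift
    {Ψ : (Fin n → ℂ) → (Fin n → ℂ) → (Fin n → Fin n → ℂ) → ℂ → ℝ≥0∞}
    (hΨm : Measurable fun p : (Fin n → ℂ) × (Fin n → ℂ) × (Fin n → Fin n → ℂ) × ℂ =>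
      Ψ p.1 p.2.1 p.2.2.1 p.2.2.2) :
    ∫⁻ (v : Fin n → ℂ) (x : BlockTriangularSpace n), Ψ v x.1 x.2.1 x.2.2 =
      ∫⁻ (D : Fin n → Fin n → ℂ) (w : Fin n → ℂ) (a : ℂ) (v : Fin n → ℂ),
        Ψ v w (fun i j => D i j - v i * w j) (a + ∑ j, w j * v j) := by
  have hshift : Measurable fun p : (Fin n → ℂ) × (Fin n → ℂ) × (Fin n → Fin n → ℂ) × ℂ =>
      Ψ p.1 p.2.1 (fun i j => p.2.2.1 i j - p.1 i * p.2.1 j)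
        (p.2.2.2 + ∑ j, p.2.1 j * p.1 j) :=
    hΨm.comp (f := fun p : (Fin n → ℂ) × (Fin n → ℂ) × (Fin n → Fin n → ℂ) × ℂ =>
      (p.1, p.2.1, (fun i j => p.2.2.1 i j - p.1 i * p.2.1 j),
        p.2.2.2 + ∑ j, p.2.1 j * p.1 j)) (by fun_prop)
  have haar : (volume : Measure (Fin n → Fin n → ℂ)).IsAddHaarMeasure := isAddHaarMeasure_pi_volume
  rw [← lintegral_rotate_four hshift]
  refine lintegral_congr fun v => ?_
  have hv : Measurable fun x : BlockTriangularSpace n => Ψ v x.1 x.2.1 x.2.2 :=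
    hΨm.comp (f := fun x : BlockTriangularSpace n => (v, x)) measurable_prodMk_left
  rw [lintegral_blockTriangularSpace hv]
  refine lintegral_congr fun w => ?_
  rw [← lintegral_sub_right_eq_self _ (fun i j => v i * w j : Fin n → Fin n → ℂ)]
  refine lintegral_congr fun D => ?_
  rw [← lintegral_add_right_eq_self _ (∑ j, w j * v j)]
  rfl

/-- Integrating over the matrices of size `n + 1` amounts to integrating over their eigenvectors
`(1, v)` and their block triangular forms. -/
theorem HasEigenvalueDensity.lintegral_eq_shear (h : HasEigenvalueDensity s n)
    {g : Multiset ℂ → ℝ≥0∞} (hg : Measurable fun z : Fin (n + 1) → ℂ => g (coordMultiset z)) :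
    ((n + 1 : ℕ) : ℝ≥0∞) * ∫⁻ x : Fin (n + 1) → Fin (n + 1) → ℂ,
        g (eigenvalues x) * gaussianWeight s (Matrix.of x) =
      ∫⁻ (v : Fin n → ℂ) (x : BlockTriangularSpace n),
        (ENNReal.ofReal (‖((eigenvalues x.2.1).map fun t => x.2.2 - t).prod‖ ^ 2) *
          g (x.2.2 ::ₘ eigenvalues x.2.1)) *
        gaussianWeight s (shearMatrix v * blockTriangular x * shearMatrix (-v)) := by
  set Ψ : (Fin n → ℂ) → (Fin n → ℂ) → (Fin n → Fin n → ℂ) → ℂ → ℝ≥0∞ := fun v w B l =>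
    (ENNReal.ofReal (‖((eigenvalues B).map fun t => l - t).prod‖ ^ 2) * g (l ::ₘ eigenvalues B)) *
      gaussianWeight s (shearMatrix v * blockTriangular (w, B, l) * shearMatrix (-v)) with hΨ
  have hΨm : Measurable fun p : (Fin n → ℂ) × (Fin n → ℂ) × (Fin n → Fin n → ℂ) × ℂ =>
      Ψ p.1 p.2.1 p.2.2.1 p.2.2.2 := by
    refine Measurable.mul (Measurable.mul ?_ ?_) ?_
    · exact measurable_norm_sq_prod_sub_eigenvalues.comp
        (f := fun p : (Fin n → ℂ) × (Fin n → ℂ) × (Fin n → Fin n → ℂ) × ℂ =>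
          (p.2.2.2, p.2.2.1)) (by fun_prop)
    · exact (measurable_cons_eigenvalues hg).comp
        (f := fun p : (Fin n → ℂ) × (Fin n → ℂ) × (Fin n → Fin n → ℂ) × ℂ =>
          (p.2.2.2, p.2.2.1)) (by fun_prop)
    · refine measurable_gaussianWeight_comp (((continuous_borderedMatrix ?_ ?_ ?_ ?_).matrix_mul
        (continuous_borderedMatrix ?_ ?_ ?_ ?_)).matrix_mul
        (continuous_borderedMatrix ?_ ?_ ?_ ?_)) <;> fun_prop
  have hFm : Measurable fun x : Fin (n + 1) → Fin (n + 1) → ℂ =>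
      g (eigenvalues x) * gaussianWeight s (Matrix.of x) :=
    (measurable_comp_eigenvalues hg).mul (measurable_gaussianWeight_of s)
  refine Eq.trans ?_ (lintegral_blockTriangularSpace_shift hΨm).symm
  rw [lintegral_consMatrix hFm,
    ← lintegral_const_mul' _ _ (ENNReal.natCast_ne_top _)]
  refine lintegral_congr_ae ?_
  -- The genericity conditions are imposed as the variables are integrated: a simple spectrum for
  -- almost every `D`, then cyclicity for almost every `w` given that `D`.
  filter_upwards [h.ae_nodup] with D hD
  rw [← lintegral_const_mul' _ _ (ENNReal.natCast_ne_top _)]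
  refine lintegral_congr_ae ?_
  filter_upwards [ae_isCyclicPair hD] with w hw
  rw [← lintegral_const_mul' _ _ (ENNReal.natCast_ne_top _)]
  refine lintegral_congr fun a => ?_
  have hmc : Measurable fun c : Fin n → ℂ => consMatrix a w c D :=
    measurePreserving_consMatrix.measurable.comp
      (f := fun c : Fin n → ℂ => ((a, w), (c, D))) (by fun_prop)
  have hFc : Measurable fun c : Fin n → ℂ =>
      g (eigenvalues (consMatrix a w c D)) * gaussianWeight s (Matrix.of (consMatrix a w c D)) :=
    hFm.comp hmc
  rw [lintegral_eigenvectorMap hw a hFc]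
  refine lintegral_congr fun v => ?_
  simp only [hΨ]
  rw [eigenvalues_consMatrix_eigenvectorMap, ← mul_assoc]
  congr 1
  rw [gaussianWeight, gaussianWeight, frobeniusSq_consMatrix, blockTriangular]
  simp only
  rw [← borderedMatrix_eq_shearMatrix_conj]
  have : eigenvectorMap a w D v =
      fun i => (a + ∑ j, w j * v j) * v i - ∑ j, D i j * v j := rfl
  rw [this, add_sub_cancel_right]

theorem HasEigenvalueDensity.succ (hs : 0 < s) (h : HasEigenvalueDensity s n) :
    HasEigenvalueDensity s (n + 1) := by
  obtain ⟨C, hC⟩ := h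
  set c₀ := ∫⁻ l, scalarWeight s l with hc₀
  have hc0 : c₀ ≠ 0 := lintegral_scalarWeight_ne_zero s
  have hct : c₀ ≠ ∞ := lintegral_scalarWeight_ne_top hs
  set J := ∫⁻ x : BlockTriangularSpace n, gaussianWeight s (blockTriangular x) with hJ
  have hJ' : J = c₀ ^ n * ((c₀ ^ n) ^ n * c₀) := by
    have := lintegral_mul_gaussianWeight_blockTriangular (n := n) s (h := fun _ _ => 1)
      measurable_const
    simp only [one_mul] at this
    rw [hJ, this, lintegral_gaussianWeight_of, lintegral_mul_const _ (measurable_scalarWeight s),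
      mul_comm c₀]
  have hJ0 : J ≠ 0 := by rw [hJ']; simp [hc0]
  have hJt : J ≠ ∞ := by rw [hJ']; finiteness
  set κ : (Fin n → ℂ) → ℝ≥0∞ := fun v => ∫⁻ x : BlockTriangularSpace n,
    gaussianWeight s (shearMatrix v * blockTriangular x * shearMatrix (-v)) with hκ
  have hκm : Measurable κ := by
    refine Measurable.lintegral_prod_right' (f := fun q : (Fin n → ℂ) × BlockTriangularSpace n =>
      gaussianWeight s (shearMatrix q.1 * blockTriangular q.2 * shearMatrix (-q.1))) ?_
    refine measurable_gaussianWeight_comp (((continuous_borderedMatrix ?_ ?_ ?_ ?_).matrix_mul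
        (continuous_borderedMatrix ?_ ?_ ?_ ?_)).matrix_mul
        (continuous_borderedMatrix ?_ ?_ ?_ ?_)) <;> fun_prop
  -- Here `n + 1` is the number of preimages, `c₀ ^ n` the integral over the row `w`, and `(∫⁻ v, κ
  -- v) / J` the total cost of undoing the shears.
  refine ⟨(J * (n + 1 : ℕ))⁻¹ * ((∫⁻ v, κ v) * (c₀ ^ n * C)), fun g hg => ?_⟩
  have h1 := HasEigenvalueDensity.lintegral_eq_shear ⟨C, hC⟩ hg
  obtain ⟨H, hH⟩ : ∃ H : ℂ → Multiset ℂ → ℝ≥0∞, ∀ l m, H l m =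
    ENNReal.ofReal (‖(m.map fun t => l - t).prod‖ ^ 2) * g (l ::ₘ m) := ⟨_, fun _ _ => rfl⟩
  simp_rw [← hH] at h1
  have hHm : Measurable fun q : ℂ × (Fin n → Fin n → ℂ) => H q.1 (eigenvalues q.2) := by
    simp_rw [hH]
    exact measurable_norm_sq_prod_sub_eigenvalues.mul (measurable_cons_eigenvalues hg)
  have hHx : Measurable fun x : BlockTriangularSpace n => H x.2.2 (eigenvalues x.2.1) :=
    hHm.comp (f := fun x : BlockTriangularSpace n => (x.2.2, x.2.1)) (by fun_prop)
  set JH := ∫⁻ x : BlockTriangularSpace n,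
    H x.2.2 (eigenvalues x.2.1) * gaussianWeight s (blockTriangular x) with hJH
  -- The constant of the shear is found by testing with `1`, which gives `κ v = k J`. Multiplying by
  -- `J`, known to be finite and nonzero, avoids having to bound `∫⁻ v, κ v`.
  have h2 : ∀ v : Fin n → ℂ, J * ∫⁻ x : BlockTriangularSpace n, H x.2.2 (eigenvalues x.2.1) *
      gaussianWeight s (shearMatrix v * blockTriangular x * shearMatrix (-v)) = κ v * JH := by
    intro v
    obtain ⟨k, hk⟩ := exists_lintegral_shear_conj s v
    have h3 := hk (fun _ _ => 1) measurable_const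
    simp only [one_mul] at h3
    rw [hk H hHx, hκ]
    simp only
    rw [h3]
    ring
  have h4 : J * ((n + 1 : ℕ) * ∫⁻ x : Fin (n + 1) → Fin (n + 1) → ℂ,
      g (eigenvalues x) * gaussianWeight s (Matrix.of x)) = (∫⁻ v, κ v) * JH := by
    rw [h1, ← lintegral_const_mul' _ _ hJt, ← lintegral_mul_const _ hκm]
    exact lintegral_congr h2
  have hHz : Measurable fun q : ℂ × (Fin n → ℂ) => H q.1 (coordMultiset q.2) := by
    simp_rw [hH]
    refine Measurable.mul ?_ ?_
    · refine ENNReal.measurable_ofReal.comp (Continuous.measurable ?_)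
      have : ∀ q : ℂ × (Fin n → ℂ), ((coordMultiset q.2).map fun t => q.1 - t).prod =
          ∏ j, (q.1 - q.2 j) := fun q => by rw [coordMultiset, Multiset.map_map]; rfl
      simp_rw [this]
      fun_prop
    · simp_rw [← coordMultiset_cons]
      exact hg.comp (measurePreserving_fin_cons (n := n) (X := ℂ)).measurable
  have h5 : JH = c₀ ^ n * (C * ∫⁻ z : Fin (n + 1) → ℂ,
      g (coordMultiset z) * eigenvalueWeight s z) := by
    rw [hJH, lintegral_mul_gaussianWeight_blockTriangular s
      (h := fun l D => H l (eigenvalues D)) hHm]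
    congr 1
    have h6 : ∀ l : ℂ, ∫⁻ D : Fin n → Fin n → ℂ, H l (eigenvalues D) *
        gaussianWeight s (Matrix.of D) =
        C * ∫⁻ z : Fin n → ℂ, H l (coordMultiset z) * eigenvalueWeight s z := fun l =>
      hC (H l) (hHz.comp (f := fun z : Fin n → ℂ => (l, z)) measurable_prodMk_left)
    simp_rw [h6]
    have hm1 : Measurable fun q : ℂ × (Fin n → ℂ) =>
        H q.1 (coordMultiset q.2) * eigenvalueWeight s q.2 :=
      hHz.mul ((measurable_eigenvalueWeight s).comp measurable_snd)
    have hm2 : Measurable fun l : ℂ => scalarWeight s l *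
        ∫⁻ z : Fin n → ℂ, H l (coordMultiset z) * eigenvalueWeight s z :=
      (measurable_scalarWeight s).mul hm1.lintegral_prod_right'
    have hm3 : Measurable fun z : Fin (n + 1) → ℂ =>
        g (coordMultiset z) * eigenvalueWeight s z := hg.mul (measurable_eigenvalueWeight s)
    rw [← lintegral_fin_cons hm3, ← lintegral_const_mul _ (measurable_lintegral_fin_cons hm3)]
    refine lintegral_congr fun l => ?_
    rw [mul_left_comm]
    congr 1
    have hm4 : Measurable fun z : Fin n → ℂ => H l (coordMultiset z) * eigenvalueWeight s z :=
      hm1.comp (f := fun z : Fin n → ℂ => (l, z)) measurable_prodMk_left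
    rw [← lintegral_const_mul _ hm4]
    refine lintegral_congr fun z => ?_
    rw [hH, eigenvalueWeight_cons, coordMultiset_cons, scalarWeight]
    ring
  have hN0 : J * ((n + 1 : ℕ) : ℝ≥0∞) ≠ 0 := mul_ne_zero hJ0 (by simp)
  have hNt : J * ((n + 1 : ℕ) : ℝ≥0∞) ≠ ∞ := ENNReal.mul_ne_top hJt (ENNReal.natCast_ne_top _)
  rw [← mul_assoc, h5] at h4
  rw [← ENNReal.mul_right_inj hN0 hNt, h4, mul_assoc (J * _)⁻¹, ← mul_assoc (J * _) (J * _)⁻¹,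
    ENNReal.mul_inv_cancel hN0 hNt, one_mul]
  ring

theorem hasEigenvalueDensity (hs : 0 < s) (n : ℕ) : HasEigenvalueDensity s n := by
  induction n with
  | zero => exact hasEigenvalueDensity_zero s
  | succ n ih => exact ih.succ hs

end EigenvalueDensity

/-! ### The power map on several coordinates -/

theorem MeasureTheory.MeasurePreserving.map_withDensity_mul_comp {α β : Type*} [MeasurableSpace α]
    [MeasurableSpace β] {μ : Measure α} {ν : Measure β} {f : α → β} {p : α → ℝ≥0∞} {q : β → ℝ≥0∞}
    (hf : MeasurePreserving f (μ.withDensity p) ν) (hp : Measurable p) (hq : Measurable q) :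
    (μ.withDensity fun x => p x * q (f x)).map f = ν.withDensity q := by
  have hqf : Measurable fun x => q (f x) := hq.comp hf.measurable
  change (μ.withDensity (p * fun x => q (f x))).map f = _
  rw [withDensity_mul _ hp hqf]
  ext s hs
  rw [Measure.map_apply hf.measurable hs, withDensity_apply _ (hf.measurable hs),
    withDensity_apply _ hs, ← hf.setLIntegral_comp_preimage hs hq]

/-- Stated as preservation of measure from a weighted Lebesgue measure, the one-variable change of
variables passes to finite products. -/
theorem measurePreserving_pi_pow (ι : Type*) [Fintype ι] {M : ℕ} (hM : 1 ≤ M) :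
    MeasurePreserving (fun (z : ι → ℂ) i => z i ^ M)
      ((volume : Measure (ι → ℂ)).withDensity
        fun z => ∏ i, ENNReal.ofReal (M * ‖z i‖ ^ (2 * (M - 1)))) volume := by
  have hp : Measurable fun z : ℂ => ENNReal.ofReal (M * ‖z‖ ^ (2 * (M - 1))) := by fun_prop
  have hmp : MeasurePreserving (fun z : ℂ => z ^ M)
      (volume.withDensity fun z : ℂ => ENNReal.ofReal (M * ‖z‖ ^ (2 * (M - 1)))) volume := by
    refine ⟨by fun_prop, ?_⟩
    rw [map_pow_withDensity hM (q := fun _ => 1) hp measurable_const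
      (Filter.Eventually.of_forall fun z => by simp)]
    exact withDensity_one
  have hsf : SigmaFinite ((volume : Measure ℂ).withDensity
    fun z : ℂ => ENNReal.ofReal (M * ‖z‖ ^ (2 * (M - 1)))) := SigmaFinite.withDensity_ofReal _
  have hpi := measurePreserving_pi (ι := ι) (fun _ => volume.withDensity
    fun z : ℂ => ENNReal.ofReal (M * ‖z‖ ^ (2 * (M - 1))))
    (fun _ => (volume : Measure ℂ)) (fun _ => hmp)
  rwa [pi_withDensity fun _ => hp] at hpi

/-! ### Orthogonal monomials -/

theorem integral_mul_conj_eq_zero_of_rotate {f g : ℂ → ℂ} {p q : ℕ} (hpq : p ≠ q)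
    (hf : ∀ ω z : ℂ, ‖ω‖ = 1 → f (ω * z) = ω ^ p * f z)
    (hg : ∀ ω z : ℂ, ‖ω‖ = 1 → g (ω * z) = ω ^ q * g z) : ∫ z, f z * conj (g z) = 0 := by
  -- The angle is chosen so that `ω^p conj(ω^q) = -1`: the integral equals its own opposite.
  set t : ℝ := Real.pi / ((p : ℝ) - q) with ht
  set ω : ℂ := Complex.exp (t * Complex.I) with hω
  have hω1 : ‖ω‖ = 1 := Complex.norm_exp_ofReal_mul_I t
  have hpq' : (p : ℝ) - q ≠ 0 := sub_ne_zero.2 (by exact_mod_cast hpq)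
  have hprod : ω ^ p * conj (ω ^ q) = -1 := by
    rw [hω, map_pow, ← Complex.exp_conj, ← Complex.exp_nat_mul, ← Complex.exp_nat_mul,
      ← Complex.exp_add, ← Complex.exp_pi_mul_I]
    congr 1
    have : ((p : ℂ) - q) * t = Real.pi := by
      rw [ht]
      have : ((p : ℂ) - q) = (((p : ℝ) - q : ℝ) : ℂ) := by push_cast; rfl
      rw [this, ← Complex.ofReal_mul, mul_div_cancel₀ _ hpq']
    simp only [map_mul, Complex.conj_ofReal, Complex.conj_I]
    rw [← this]
    ring
  have h1 : ∫ z, f (ω * z) * conj (g (ω * z)) = ∫ z, f z * conj (g z) :=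
    (rotation ⟨ω, by simpa [Submonoid.unitSphere] using hω1⟩).measurePreserving.integral_comp
      (rotation _).toHomeomorph.measurableEmbedding fun z => f z * conj (g z)
  have h2 : ∀ z, f (ω * z) * conj (g (ω * z)) = -1 * (f z * conj (g z)) := by
    intro z
    rw [hf ω z hω1, hg ω z hω1, map_mul, ← hprod]
    ring
  simp_rw [h2] at h1
  rw [integral_const_mul] at h1
  have h3 : (2 : ℂ) * ∫ z, f z * conj (g z) = 0 := by linear_combination -h1
  exact (mul_eq_zero.1 h3).resolve_left two_ne_zero

/-- The normalised monomials of the Gaussian weight. -/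
noncomputable def gaussianMonomial (s : ℝ) (p : ℕ) (z : ℂ) : ℂ :=
  (Real.sqrt (s ^ (p + 1) / (Real.pi * p.factorial)) : ℂ) *
    (z ^ p * (Real.exp (-s * ‖z‖ ^ 2 / 2) : ℂ))

theorem gaussianMonomial_rotate {s : ℝ} (p : ℕ) (ω z : ℂ) (hω : ‖ω‖ = 1) :
    gaussianMonomial s p (ω * z) = ω ^ p * gaussianMonomial s p z := by
  simp only [gaussianMonomial, norm_mul, hω, one_mul, mul_pow]
  ring

theorem norm_sq_gaussianMonomial {s : ℝ} (hs : 0 < s) (p : ℕ) (z : ℂ) :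
    ‖gaussianMonomial s p z‖ ^ 2 =
      s ^ (p + 1) / (Real.pi * p.factorial) * (‖z‖ ^ (2 * p) * Real.exp (-s * ‖z‖ ^ 2)) := by
  rw [gaussianMonomial, norm_mul, norm_mul, Complex.norm_real, Complex.norm_real, norm_pow,
    Real.norm_of_nonneg (Real.sqrt_nonneg _), Real.norm_of_nonneg (Real.exp_nonneg _), mul_pow,
    mul_pow, Real.sq_sqrt (by positivity), ← Real.exp_nat_mul, ← pow_mul, mul_comm p 2]
  congr 3
  push_cast
  ring

theorem isOrthonormalFamily_gaussianMonomial {s : ℝ} (hs : 0 < s) :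
    IsOrthonormalFamily (gaussianMonomial s) := by
  refine ⟨fun p => ?_, fun p => ?_, fun p q hpq =>
    integral_mul_conj_eq_zero_of_rotate hpq (gaussianMonomial_rotate p) (gaussianMonomial_rotate q)⟩
  · refine Continuous.measurable ?_
    unfold gaussianMonomial
    fun_prop
  · have h1 := Complex.integral_rpow_mul_exp_neg_mul_rpow (p := 2) (q := 2 * p) (b := s) one_le_two
      (by have : (0 : ℝ) ≤ p := Nat.cast_nonneg p
          linarith) hs
    have h2 : ∀ z : ℂ, ‖z‖ ^ (2 * (p : ℝ)) * Real.exp (-s * ‖z‖ ^ (2 : ℝ)) =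
        ‖z‖ ^ (2 * p) * Real.exp (-s * ‖z‖ ^ 2) := by
      intro z
      rw [← Real.rpow_natCast _ (2 * p), Real.rpow_two]
      push_cast
      rfl
    have h3 : (2 * (p : ℝ) + 2) / 2 = p + 1 := by ring
    have h4 : -(2 * (p : ℝ) + 2) / 2 = -((p + 1 : ℕ) : ℝ) := by push_cast; ring
    simp_rw [h2, h3, h4] at h1
    rw [Real.Gamma_nat_eq_factorial, Real.rpow_neg hs.le, Real.rpow_natCast] at h1
    have hsp : s ^ (p + 1) ≠ 0 := (pow_pos hs _).ne'
    have hfac : (p.factorial : ℝ) ≠ 0 := by exact_mod_cast (Nat.factorial_pos p).ne'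
    have h5 : Integrable fun z : ℂ => ‖z‖ ^ (2 * p) * Real.exp (-s * ‖z‖ ^ 2) := by
      refine Integrable.of_integral_ne_zero ?_
      rw [h1]
      have := Real.pi_ne_zero
      positivity
    have h6 : ∀ z : ℂ, ‖gaussianMonomial s p z‖ₑ ^ 2 = ENNReal.ofReal
        (s ^ (p + 1) / (Real.pi * p.factorial) * (‖z‖ ^ (2 * p) * Real.exp (-s * ‖z‖ ^ 2))) := by
      intro z
      rw [← norm_sq_gaussianMonomial hs, ENNReal.ofReal_pow (norm_nonneg _), ofReal_norm]
    simp_rw [h6]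
    rw [← ofReal_integral_eq_lintegral_ofReal (h5.const_mul _)
      (Filter.Eventually.of_forall fun z => by positivity), integral_const_mul, h1,
      ENNReal.ofReal_eq_one]
    have := Real.pi_ne_zero
    field_simp

/-! ### Vandermonde determinants indexed by a finite order -/

section Vandermonde

/-- The element of rank `o j` has exactly `o j` predecessors. Constants attached to pairs thus
become powers attached to points. -/
theorem prod_filter_lt_const {ι : Type*} [Fintype ι] [LinearOrder ι] {c : ℕ} (o : ι ≃o Fin c)
    (x : ℝ) : ∏ i : ι, ∏ j : ι with i < j, x = ∏ j, x ^ (o j : ℕ) := by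
  rw [Finset.prod_comm' (t' := Finset.univ) (s' := fun j => Finset.univ.filter fun i => i < j)
    (by simp)]
  refine Finset.prod_congr rfl fun j _ => ?_
  rw [Finset.prod_const]
  congr 1
  rw [← Fin.card_Iio (o j)]
  refine Finset.card_bij (fun i _ => o i) (by simp) (fun _ _ _ _ h => o.injective h) ?_
  intro b hb
  exact ⟨o.symm b, by simpa [OrderIso.symm_apply_lt] using hb, by simp⟩

theorem det_pow_orderIso {ι : Type*} [Fintype ι] [DecidableEq ι] [LinearOrder ι] {c : ℕ}
    (o : ι ≃o Fin c)
    (y : ι → ℂ) :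
    ‖(Matrix.of fun i j => y i ^ (o j : ℕ)).det‖ = ∏ i, ∏ j : ι with i < j, ‖y i - y j‖ := by
  have h1 : (Matrix.of fun i j => y i ^ (o j : ℕ)).submatrix o.symm o.symm =
      Matrix.vandermonde fun i => y (o.symm i) := by
    ext i j
    simp [Matrix.vandermonde_apply]
  rw [← Matrix.det_submatrix_equiv_self o.symm.toEquiv]
  change ‖((Matrix.of fun i j => y i ^ (o j : ℕ)).submatrix o.symm o.symm).det‖ = _
  rw [h1, Matrix.det_vandermonde, norm_prod, ← o.toEquiv.prod_comp]
  refine Finset.prod_congr rfl fun i _ => ?_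
  rw [norm_prod]
  refine Finset.prod_bij' (fun j _ => o.symm j) (fun j _ => o j) ?_ ?_ ?_ ?_ ?_
  · intro j hj
    simpa [OrderIso.lt_symm_apply] using hj
  · intro j hj
    simpa using hj
  · simp
  · simp
  · intro j _
    simp [norm_sub_rev]

/-- The constants `A j` leave through the columns and the factors `u (z i)` through the rows, and a
Vandermonde matrix in the `y (z i)` remains. -/
theorem norm_sq_slaterDet_vandermonde {ι : Type*} [Fintype ι] [DecidableEq ι] [LinearOrder ι]
    {c : ℕ}
    (o : ι ≃o Fin c) {φ : ι → ℂ → ℂ} {A : ι → ℂ} {u y : ℂ → ℂ}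
    (hφ : ∀ j z, φ j z = A j * (u z * y z ^ (o j : ℕ))) (z : ι → ℂ) :
    ‖slaterDet φ (fun _ => ()) z‖ ^ 2 = (∏ j, ‖A j‖ ^ 2) *
      (∏ i, ∏ j : ι with i < j, ‖y (z i) - y (z j)‖ ^ 2) * ∏ i, ‖u (z i)‖ ^ 2 := by
  have h1 : (Matrix.of fun i j => if (fun _ : ι => ()) i = (fun _ : ι => ()) j then φ j (z i) else 0) =
      Matrix.of fun i j => A j * (Matrix.of fun i j => u (z i) *
        (Matrix.of fun i j => y (z i) ^ (o j : ℕ)) i j) i j := by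
    ext i j
    simp [hφ]
  rw [slaterDet, h1, Matrix.det_mul_row, Matrix.det_mul_column, norm_mul, norm_mul,
    det_pow_orderIso o fun i => y (z i), norm_prod, norm_prod]
  simp only [mul_pow, ← Finset.prod_pow]
  ring

end Vandermonde

/-! ### Arithmetic progressions and the two block laws -/

section Progression

variable {N M k : ℕ}

theorem exists_orderIso_progression (hk : k ∈ Finset.Icc 1 M) :
    ∃ (c : ℕ) (o : progression N M k ≃o Fin c), ∀ j : progression N M k, (j : ℕ) = k + M * o j := by
  obtain ⟨hk1, hkM⟩ := Finset.mem_Icc.1 hk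
  have hM : 0 < M := by omega
  -- The number of terms is `(N + M - k) / M`. As `k ≤ M`, the subtraction is never truncated, and
  -- the quotient is `0` when `k > N`.
  have hiff : ∀ i : ℕ, i < (N + M - k) / M ↔ k + M * i ≤ N := by
    intro i
    rw [← Nat.succ_le_iff, Nat.le_div_iff_mul_le hM, Nat.succ_mul, mul_comm i M]
    omega
  have hmem : ∀ i : Fin ((N + M - k) / M), k + M * i ∈ progression N M k := by
    intro i
    rw [progression, Finset.mem_filter, Finset.mem_Icc]
    refine ⟨⟨by omega, (hiff i).1 i.2⟩, ?_⟩
    simp [Nat.ModEq]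
  set f : Fin ((N + M - k) / M) → progression N M k := fun i => ⟨k + M * i, hmem i⟩ with hf
  have hmono : StrictMono f := by
    intro i j hij
    change k + M * (i : ℕ) < k + M * j
    have : (i : ℕ) < j := hij
    have := Nat.mul_lt_mul_of_pos_left this hM
    omega
  have hsurj : Function.Surjective f := by
    rintro ⟨j, hj⟩
    rw [progression, Finset.mem_filter, Finset.mem_Icc] at hj
    obtain ⟨⟨hj1, hjN⟩, hjk⟩ := hj
    have hkj : k ≤ j := by
      by_contra hlt
      push Not at hlt
      have h1 := (Nat.modEq_iff_dvd' hlt.le).1 hjk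
      have h2 := Nat.le_of_dvd (by omega) h1
      omega
    obtain ⟨q, hq⟩ := (Nat.modEq_iff_dvd' hkj).1 hjk.symm
    refine ⟨⟨q, (hiff q).2 (by omega)⟩, Subtype.ext ?_⟩
    change k + M * q = j
    omega
  refine ⟨_, (hmono.orderIsoOfSurjective f hsurj).symm, fun j => ?_⟩
  obtain ⟨i, rfl⟩ := hsurj j
  have : (hmono.orderIsoOfSurjective f hsurj).symm (f i) = i := by
    rw [OrderIso.symm_apply_eq]; rfl
  rw [this]

/-- Evaluation of the determinantal density of a family `A_j u y^q`, `j = k + M q`. -/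
theorem slaterDensity_progression {c : ℕ} (o : progression N M k ≃o Fin c)
    (ho : ∀ j : progression N M k, (j : ℕ) = k + M * o j)
    {φ : progression N M k → ℂ → ℂ} {A : progression N M k → ℂ}
    {u y : ℂ → ℂ} {U : ℂ → ℝ} {C : progression N M k → ℝ}
    (hφ : ∀ j z, φ j z = A j * (u z * y z ^ (o j : ℕ)))
    (hA : ∀ j, ‖A j‖ ^ 2 = (N : ℝ) ^ (j : ℕ) / C j) (hu : ∀ z, ‖u z‖ ^ 2 = U z)
    (z : progression N M k → ℂ) :
    ((Fintype.card (progression N M k)).factorial : ℝ)⁻¹ * ‖slaterDet φ (fun _ => ()) z‖ ^ 2 =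
      (((progression N M k).card.factorial : ℝ) * ∏ j, C j)⁻¹ *
        (∏ i, ∏ j : progression N M k with i < j, (N : ℝ) ^ M * ‖y (z i) - y (z j)‖ ^ 2) *
        ∏ i, (N : ℝ) ^ k * U (z i) := by
  -- The power `N^j`, `j = k + M q`, of the normalising constant is shared out as `N^k` per point
  -- and `N^M` per pair, since `q` counts the predecessors of `j`.
  have h1 : ∏ j : progression N M k, (N : ℝ) ^ (j : ℕ) =
      (∏ i : progression N M k, ∏ j : progression N M k with i < j, (N : ℝ) ^ M) *
        ∏ _j : progression N M k, (N : ℝ) ^ k := by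
    rw [prod_filter_lt_const o, ← Finset.prod_mul_distrib]
    refine Finset.prod_congr rfl fun j _ => ?_
    rw [ho j, pow_add, pow_mul, mul_comm]
  rw [norm_sq_slaterDet_vandermonde o hφ]
  simp only [hA, hu, Finset.prod_mul_distrib, Finset.prod_div_distrib, h1, Fintype.card_coe]
  rw [mul_inv]
  ring

/-- The family of functions whose determinantal projection process is `R(N,M,k)`. -/
noncomputable def rootFamily (N M k : ℕ) (j : progression N M k) : ℂ → ℂ :=
  gaussianMonomial N ((j : ℕ) - 1)

theorem one_le_of_mem_progression (j : progression N M k) : 1 ≤ (j : ℕ) :=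
  (Finset.mem_Icc.1 (Finset.mem_filter.1 j.2).1).1

theorem isOrthonormalFamily_rootFamily (hN : 1 ≤ N) : IsOrthonormalFamily (rootFamily N M k) := by
  refine (isOrthonormalFamily_gaussianMonomial (s := N) (by exact_mod_cast hN)).comp_injective
    (e := fun j : progression N M k => (j : ℕ) - 1) fun i j hij => Subtype.ext ?_
  have hi := one_le_of_mem_progression i
  have hj := one_le_of_mem_progression j
  simp only at hij
  omega

theorem rootDistribution_eq_slaterMeasure (hN : 1 ≤ N) (hk : k ∈ Finset.Icc 1 M) :
    rootDistribution N M k = slaterMeasure (rootFamily N M k) := by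
  obtain ⟨c, o, ho⟩ := exists_orderIso_progression (N := N) hk
  have hk1 := (Finset.mem_Icc.1 hk).1
  have hN0 : (0 : ℝ) < N := by exact_mod_cast hN
  rw [rootDistribution, slaterMeasure]
  congr 1
  ext z
  congr 1
  rw [slaterDensity_progression o ho (y := fun w => w ^ M)
    -- The density keeps a factor `π⁻¹` with each point, so it is moved from the normalising
    -- constant into `u`; hence the extra `π` here.
    (A := fun j => (Real.sqrt (Real.pi * ((N : ℝ) ^ (j : ℕ) / (Real.pi * ((j : ℕ) - 1).factorial))) : ℂ))
    (C := fun j => (((j : ℕ) - 1).factorial : ℝ))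
    (u := fun w => w ^ (k - 1) * ((Real.sqrt Real.pi)⁻¹ * Real.exp (-N * ‖w‖ ^ 2 / 2) : ℝ))
    (U := fun w => ‖w‖ ^ (2 * (k - 1)) * (Real.pi⁻¹ * Real.exp (-(N : ℝ) * ‖w‖ ^ 2)))]
  · rw [rootDensity, rootConstant, ← Finset.prod_coe_sort]
    simp only [mul_assoc]
  · intro j w
    have hj := one_le_of_mem_progression j
    have he : (j : ℕ) - 1 = (k - 1) + M * o j := by have := ho j; omega
    have hsq : Real.sqrt (Real.pi * ((N : ℝ) ^ (j : ℕ) / (Real.pi * ((j : ℕ) - 1).factorial))) *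
        (Real.sqrt Real.pi)⁻¹ = Real.sqrt ((N : ℝ) ^ (j : ℕ) / (Real.pi * ((j : ℕ) - 1).factorial)) := by
      rw [Real.sqrt_mul Real.pi_pos.le, mul_comm, inv_mul_cancel_left₀]
      exact (Real.sqrt_pos.2 Real.pi_pos).ne'
    rw [rootFamily, gaussianMonomial, Nat.sub_add_cancel hj, ← hsq]
    have hw : w ^ ((j : ℕ) - 1) = w ^ (k - 1) * (w ^ M) ^ (o j : ℕ) := by
      rw [he, pow_add, pow_mul]
    rw [hw]
    push_cast
    ring
  · intro j
    rw [Complex.norm_real, Real.norm_of_nonneg (Real.sqrt_nonneg _), Real.sq_sqrt (by positivity)]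
    have := Real.pi_ne_zero
    field_simp
  · intro w
    rw [norm_mul, Complex.norm_real, Real.norm_of_nonneg (by positivity), norm_pow, mul_pow,
      mul_pow, inv_pow, Real.sq_sqrt Real.pi_pos.le, ← Real.exp_nat_mul, ← pow_mul,
      mul_comm (k - 1) 2]
    congr 3
    push_cast
    ring_nf

/-- The family of functions whose determinantal projection process is `Gin(N,M,k)`. -/
noncomputable def powerGinibreMonomial (N M k q : ℕ) (w : ℂ) : ℂ :=
  (Real.sqrt ((N : ℝ) ^ (k + M * q) / (Real.pi * M * (k + M * q - 1).factorial)) : ℂ) *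
    (((‖w‖ ^ (((k : ℝ) - M) / M) * Real.exp (-N * ‖w‖ ^ (2 / (M : ℝ)) / 2) : ℝ) : ℂ) * w ^ q)

theorem norm_sq_powerGinibreMonomial (q : ℕ) (w : ℂ) :
    ‖powerGinibreMonomial N M k q w‖ ^ 2 =
      (N : ℝ) ^ (k + M * q) / (Real.pi * M * (k + M * q - 1).factorial) *
        (‖w‖ ^ (2 * ((k : ℝ) - M) / M) * Real.exp (-(N : ℝ) * ‖w‖ ^ (2 / (M : ℝ))) *
          ‖w‖ ^ (2 * q)) := by
  rw [powerGinibreMonomial, norm_mul, norm_mul, Complex.norm_real, Complex.norm_real, norm_pow,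
    Real.norm_of_nonneg (Real.sqrt_nonneg _), Real.norm_of_nonneg (by positivity), mul_pow,
    mul_pow, mul_pow, Real.sq_sqrt (by positivity), ← Real.exp_nat_mul, ← pow_mul, mul_comm q 2,
    ← Real.rpow_mul_natCast (norm_nonneg _)]
  congr 4
  · push_cast; ring
  · push_cast; ring

/-- Pulling the norm back along `z ↦ z^M` turns the function of index `q` into the Gaussian monomial
of degree `k + M q - 1`. Orthogonality follows from rotation, the weight being radial. -/
theorem isOrthonormalFamily_powerGinibreMonomial (hN : 1 ≤ N) (hk : k ∈ Finset.Icc 1 M) :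
    IsOrthonormalFamily (powerGinibreMonomial N M k) := by
  obtain ⟨hk1, hkM⟩ := Finset.mem_Icc.1 hk
  have hM : 1 ≤ M := hk1.trans hkM
  have hN0 : (0 : ℝ) < N := by exact_mod_cast hN
  have hM0 : (0 : ℝ) < M := by exact_mod_cast hM
  have hmeas : ∀ q, Measurable (powerGinibreMonomial N M k q) := by
    intro q
    unfold powerGinibreMonomial
    fun_prop
  have hrot : ∀ (q : ℕ) (ω z : ℂ), ‖ω‖ = 1 →
      powerGinibreMonomial N M k q (ω * z) = ω ^ q * powerGinibreMonomial N M k q z := by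
    intro q ω z hω
    simp only [powerGinibreMonomial, norm_mul, hω, one_mul, mul_pow]
    ring
  refine ⟨hmeas, fun q => ?_, fun p q hpq =>
    integral_mul_conj_eq_zero_of_rotate hpq (hrot p) (hrot q)⟩
  have hor := isOrthonormalFamily_gaussianMonomial hN0
  have hsq : ∀ w : ℂ, ‖powerGinibreMonomial N M k q w‖ₑ ^ 2 =
      ENNReal.ofReal (‖powerGinibreMonomial N M k q w‖ ^ 2) := fun w => by
    rw [ENNReal.ofReal_pow (norm_nonneg _), ofReal_norm]
  have hsq' : ∀ w : ℂ, ‖gaussianMonomial N (k + M * q - 1) w‖ₑ ^ 2 =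
      ENNReal.ofReal (‖gaussianMonomial N (k + M * q - 1) w‖ ^ 2) := fun w => by
    rw [ENNReal.ofReal_pow (norm_nonneg _), ofReal_norm]
  rw [← lintegral_norm_pow_mul_comp_pow hM ((hmeas q).enorm.pow_const 2),
    ← hor.lintegral_sq (k + M * q - 1)]
  refine lintegral_congr_ae ?_
  filter_upwards [(Set.finite_singleton (0 : ℂ)).countable.ae_notMem volume] with z hz
  have hz0 : 0 < ‖z‖ := norm_pos_iff.2 (by simpa using hz)
  rw [hsq, hsq', ← ENNReal.ofReal_mul (by positivity), norm_sq_powerGinibreMonomial,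
    norm_sq_gaussianMonomial hN0, norm_pow]
  congr 1
  have e1 : (‖z‖ ^ M) ^ (2 / (M : ℝ)) = ‖z‖ ^ 2 := by
    rw [← Real.rpow_natCast, ← Real.rpow_mul hz0.le, mul_div_cancel₀ _ hM0.ne', Real.rpow_two]
  have e2 : ‖z‖ ^ (2 * (M - 1)) * (‖z‖ ^ M) ^ (2 * ((k : ℝ) - M) / M) * (‖z‖ ^ M) ^ (2 * q) =
      ‖z‖ ^ (2 * (k + M * q - 1)) := by
    rw [← Real.rpow_natCast ‖z‖ M, ← Real.rpow_mul hz0.le, ← Real.rpow_mul_natCast hz0.le,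
      ← Real.rpow_natCast ‖z‖, ← Real.rpow_natCast ‖z‖, ← Real.rpow_add hz0, ← Real.rpow_add hz0]
    congr 1
    rw [mul_div_cancel₀ _ hM0.ne']
    have h1 : 1 ≤ k + M * q := by omega
    push_cast [Nat.cast_sub hM, Nat.cast_sub h1]
    ring
  rw [e1, ← e2, Nat.sub_add_cancel (by omega)]
  field_simp

theorem powerGinibre_eq_slaterMeasure (hN : 1 ≤ N) (hk : k ∈ Finset.Icc 1 M) :
    ∃ e : progression N M k → ℕ, Function.Injective e ∧
      powerGinibre N M k = slaterMeasure fun j => powerGinibreMonomial N M k (e j) := by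
  obtain ⟨c, o, ho⟩ := exists_orderIso_progression (N := N) hk
  refine ⟨fun j => o j, fun i j hij => o.injective (Fin.ext hij), ?_⟩
  rw [powerGinibre, slaterMeasure]
  congr 1
  ext z
  congr 1
  rw [slaterDensity_progression o ho (y := fun w => w)
    (A := fun j => (Real.sqrt ((N : ℝ) ^ (j : ℕ) / (Real.pi * M * ((j : ℕ) - 1).factorial)) : ℂ))
    (C := fun j => Real.pi * M * (((j : ℕ) - 1).factorial : ℝ))
    (u := fun w => ((‖w‖ ^ (((k : ℝ) - M) / M) * Real.exp (-N * ‖w‖ ^ (2 / (M : ℝ)) / 2) : ℝ) : ℂ))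
    (U := fun w => ‖w‖ ^ (2 * ((k : ℝ) - M) / M) * Real.exp (-(N : ℝ) * ‖w‖ ^ (2 / (M : ℝ))))]
  · rw [powerGinibreDensity, powerGinibreConstant, ← Finset.prod_coe_sort]
    simp only [Finset.prod_mul_distrib, Finset.prod_const, Finset.card_univ, Fintype.card_coe,
      mul_inv]
    ring
  · intro j w
    rw [powerGinibreMonomial, ← ho j]
  · intro j
    rw [Complex.norm_real, Real.norm_of_nonneg (Real.sqrt_nonneg _), Real.sq_sqrt (by positivity)]
  · intro w
    rw [Complex.norm_real, Real.norm_of_nonneg (by positivity), mul_pow, ← Real.exp_nat_mul,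
      ← Real.rpow_mul_natCast (norm_nonneg _)]
    congr 2
    · push_cast; ring
    · push_cast; ring

theorem measurable_powerGinibreDensity :
    Measurable fun z => ENNReal.ofReal (powerGinibreDensity N M k z) := by
  unfold powerGinibreDensity
  fun_prop

/-- The Jacobian shifts the exponent of each modulus to `2 (k - 1)`, and the leftover `π M` per
point accounts for the ratio of the two constants. The origin is excluded because of the negative
power of `‖z i‖` when `k < M`. -/
theorem rootDensity_eq_mul_powerGinibreDensity (hk : k ∈ Finset.Icc 1 M)
    {z : progression N M k → ℂ} (hz : ∀ i, z i ≠ 0) :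
    rootDensity N M k z =
      (∏ i, (M * ‖z i‖ ^ (2 * (M - 1)))) * powerGinibreDensity N M k fun i => z i ^ M := by
  obtain ⟨hk1, hkM⟩ := Finset.mem_Icc.1 hk
  have hM : 1 ≤ M := hk1.trans hkM
  have hM0 : (0 : ℝ) < M := by exact_mod_cast hM
  have hpi0 := Real.pi_ne_zero
  have h1 : ∀ i, (M * ‖z i‖ ^ (2 * (M - 1))) * ((N : ℝ) ^ k *
      ‖z i ^ M‖ ^ (2 * ((k : ℝ) - M) / M) * Real.exp (-(N : ℝ) * ‖z i ^ M‖ ^ (2 / (M : ℝ)))) =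
      (Real.pi * M) * ((N : ℝ) ^ k * ‖z i‖ ^ (2 * (k - 1)) *
        (Real.pi⁻¹ * Real.exp (-(N : ℝ) * ‖z i‖ ^ 2))) := by
    intro i
    have hz0 : 0 < ‖z i‖ := norm_pos_iff.2 (hz i)
    have e1 : (‖z i‖ ^ M) ^ (2 / (M : ℝ)) = ‖z i‖ ^ 2 := by
      rw [← Real.rpow_natCast, ← Real.rpow_mul hz0.le, mul_div_cancel₀ _ hM0.ne', Real.rpow_two]
    have e2 : ‖z i‖ ^ (2 * (M - 1)) * (‖z i‖ ^ M) ^ (2 * ((k : ℝ) - M) / M) =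
        ‖z i‖ ^ (2 * (k - 1)) := by
      rw [← Real.rpow_natCast ‖z i‖ M, ← Real.rpow_mul hz0.le,
        ← Real.rpow_natCast ‖z i‖, ← Real.rpow_natCast ‖z i‖, ← Real.rpow_add hz0]
      congr 1
      rw [mul_div_cancel₀ _ hM0.ne']
      push_cast [Nat.cast_sub hM, Nat.cast_sub hk1]
      ring
    rw [norm_pow, e1, ← e2]
    field_simp
  have h2 : (∏ i, (M * ‖z i‖ ^ (2 * (M - 1)))) * ∏ i, ((N : ℝ) ^ k *
      ‖z i ^ M‖ ^ (2 * ((k : ℝ) - M) / M) * Real.exp (-(N : ℝ) * ‖z i ^ M‖ ^ (2 / (M : ℝ)))) =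
      (Real.pi * M) ^ (progression N M k).card * ∏ i, ((N : ℝ) ^ k * ‖z i‖ ^ (2 * (k - 1)) *
        (Real.pi⁻¹ * Real.exp (-(N : ℝ) * ‖z i‖ ^ 2))) := by
    rw [← Finset.prod_mul_distrib, Finset.prod_congr rfl fun i _ => h1 i,
      Finset.prod_mul_distrib, Finset.prod_const, Finset.card_univ, Fintype.card_coe]
  have h3 : (powerGinibreConstant N M k)⁻¹ * (Real.pi * M) ^ (progression N M k).card =
      (rootConstant N M k)⁻¹ := by
    rw [powerGinibreConstant, rootConstant, mul_pow]
    field_simp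
  rw [powerGinibreDensity, rootDensity, mul_left_comm, h2, ← h3]
  ring

theorem map_pow_rootDistribution (hk : k ∈ Finset.Icc 1 M) :
    (rootDistribution N M k).map (fun z i => z i ^ M) = powerGinibre N M k := by
  obtain ⟨hk1, hkM⟩ := Finset.mem_Icc.1 hk
  have hne : ∀ᵐ z : progression N M k → ℂ, ∀ i, z i ≠ 0 := by
    rw [Filter.eventually_all]
    intro i
    exact measure_eq_zero_iff_ae_notMem.1
      (Measure.pi_hyperplane (fun _ : progression N M k => (volume : Measure ℂ)) i 0)
  have hdens : (fun z : progression N M k → ℂ => ENNReal.ofReal (rootDensity N M k z)) =ᵐ[volume]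
      fun z => (∏ i, ENNReal.ofReal (M * ‖z i‖ ^ (2 * (M - 1)))) *
        ENNReal.ofReal (powerGinibreDensity N M k fun i => z i ^ M) := by
    filter_upwards [hne] with z hz
    rw [rootDensity_eq_mul_powerGinibreDensity hk hz,
      ENNReal.ofReal_mul (Finset.prod_nonneg fun i _ => by positivity),
      ENNReal.ofReal_prod_of_nonneg fun i _ => by positivity]
  have hp : Measurable fun z : progression N M k → ℂ =>
      ∏ i, ENNReal.ofReal (M * ‖z i‖ ^ (2 * (M - 1))) := by fun_prop
  have hmap := (measurePreserving_pi_pow (progression N M k)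
    (hk1.trans hkM)).map_withDensity_mul_comp hp
    (measurable_powerGinibreDensity (N := N) (M := M) (k := k))
  rw [rootDistribution, withDensity_congr_ae hdens, powerGinibre]
  exact hmap

end Progression

/-! ### The Ginibre eigenvalues as a determinantal projection process -/

section GinibreLaw

/-- Each real coordinate has variance `1/(2N)`, so the exponent is `-N |z|²`. The constant may stay
implicit, as total mass fixes it later. -/
theorem exists_complexGaussian_eq_withDensity {N : ℕ} (hN : 1 ≤ N) :
    ∃ c : ℝ≥0∞, complexGaussian (1 / (N : ℝ≥0)) =
      volume.withDensity fun z => c * scalarWeight N z := by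
  have hN0 : (0 : ℝ) < N := by exact_mod_cast hN
  have hv : (1 / (N : ℝ≥0) / 2) ≠ 0 := by
    have : (N : ℝ≥0) ≠ 0 := by exact_mod_cast (by omega : N ≠ 0)
    positivity
  set a : ℝ := (Real.sqrt (2 * Real.pi * (1 / (N : ℝ≥0) / 2 : ℝ≥0)))⁻¹ with ha
  have ha0 : 0 ≤ a := by positivity
  have hpdf : ∀ x, gaussianPDF 0 (1 / (N : ℝ≥0) / 2) x =
      ENNReal.ofReal (a * Real.exp (-(N : ℝ) * x ^ 2)) := by
    intro x
    rw [gaussianPDF, gaussianPDFReal]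
    congr 3
    push_cast
    field_simp
    ring
  refine ⟨ENNReal.ofReal (a ^ 2), ?_⟩
  have hw : Measurable fun z : ℂ => ENNReal.ofReal (a ^ 2) * scalarWeight N z :=
    (measurable_scalarWeight (s := N)).const_mul _
  rw [complexGaussian, gaussianReal_of_var_ne_zero _ hv,
    prod_withDensity (measurable_gaussianPDF _ _) (measurable_gaussianPDF _ _)]
  have hmp := Complex.volume_preserving_equiv_real_prod.symm
  ext S hS
  rw [Measure.map_apply (MeasurableEquiv.measurable _) hS,
    withDensity_apply _ (MeasurableEquiv.measurable _ hS), withDensity_apply _ hS,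
    ← hmp.setLIntegral_comp_preimage hS hw]
  refine setLIntegral_congr_fun (MeasurableEquiv.measurable _ hS) fun p _ => ?_
  simp only [hpdf, scalarWeight]
  rw [← ENNReal.ofReal_mul (by positivity), ← ENNReal.ofReal_mul (by positivity)]
  congr 1
  rw [mul_mul_mul_comm, ← Real.exp_add, ← sq]
  congr 2
  rw [← Complex.normSq_eq_norm_sq, Complex.normSq_apply]
  simp only [Complex.measurableEquivRealProd_symm_apply]
  ring

theorem exists_ginibreEntries_eq_withDensity {N : ℕ} (hN : 1 ≤ N) :
    ∃ c : ℝ≥0∞, ginibreEntries N =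
      volume.withDensity fun x => c * gaussianWeight N (Matrix.of x) := by
  obtain ⟨c, hc⟩ := exists_complexGaussian_eq_withDensity hN
  have hprob : IsProbabilityMeasure (complexGaussian (1 / (N : ℝ≥0))) := by
    rw [complexGaussian]
    exact Measure.isProbabilityMeasure_map (MeasurableEquiv.measurable _).aemeasurable
  have hw : Measurable fun z : ℂ => c * scalarWeight N z :=
    (measurable_scalarWeight (s := N)).const_mul _
  have h1 : Measure.pi (fun _ : Fin N => complexGaussian (1 / (N : ℝ≥0))) =
      volume.withDensity fun z => ∏ i, (c * scalarWeight N (z i)) := by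
    have : SigmaFinite ((volume : Measure ℂ).withDensity fun z => c * scalarWeight N z) := by
      rw [← hc]; infer_instance
    rw [hc]
    exact pi_withDensity (μ := fun _ : Fin N => (volume : Measure ℂ)) fun _ => hw
  have hw' : Measurable fun z : Fin N → ℂ => ∏ i, (c * scalarWeight N (z i)) :=
    Finset.measurable_prod _ fun i _ => hw.comp (measurable_pi_apply i)
  have h2 : ginibreEntries N =
      volume.withDensity fun x : Fin N → Fin N → ℂ => ∏ i, ∏ j, (c * scalarWeight N (x i j)) := by
    have : SigmaFinite ((volume : Measure (Fin N → ℂ)).withDensity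
        fun z => ∏ i, (c * scalarWeight N (z i))) := by
      rw [← h1]; infer_instance
    rw [ginibreEntries, h1]
    exact pi_withDensity (μ := fun _ : Fin N => (volume : Measure (Fin N → ℂ))) fun _ => hw'
  refine ⟨(c ^ N) ^ N, h2.trans ?_⟩
  congr 1
  ext x
  rw [gaussianWeight_of_eq]
  simp only [Finset.prod_mul_distrib, Finset.prod_const, Finset.card_univ, Fintype.card_fin,
    vectorWeight]

theorem eigenvalueWeight_const_mul_eq {N : ℕ} (hN : 1 ≤ N) : ∃ c : ℝ≥0∞, c ≠ 0 ∧ c ≠ ∞ ∧ 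
    (slaterMeasure fun i : Fin N => gaussianMonomial N i) =
      volume.withDensity fun z => c * eigenvalueWeight N z := by
  have hN0 : (0 : ℝ) < N := by exact_mod_cast hN
  set A : Fin N → ℂ := fun i =>
    (Real.sqrt ((N : ℝ) ^ ((i : ℕ) + 1) / (Real.pi * (i : ℕ).factorial)) : ℂ) with hA
  have hA0 : ∀ i, 0 < ‖A i‖ ^ 2 := by
    intro i
    have : 0 < (N : ℝ) ^ ((i : ℕ) + 1) / (Real.pi * (i : ℕ).factorial) := by
      have := Real.pi_pos
      positivity
    rw [hA, Complex.norm_real, Real.norm_of_nonneg (Real.sqrt_nonneg _), Real.sq_sqrt this.le]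
    exact this
  have hpos : 0 < ((Fintype.card (Fin N)).factorial : ℝ)⁻¹ * ∏ i, ‖A i‖ ^ 2 :=
    mul_pos (by positivity) (Finset.prod_pos fun i _ => hA0 i)
  refine ⟨ENNReal.ofReal (((Fintype.card (Fin N)).factorial : ℝ)⁻¹ * ∏ i, ‖A i‖ ^ 2),
    (ENNReal.ofReal_pos.2 hpos).ne', ENNReal.ofReal_ne_top, ?_⟩
  rw [slaterMeasure]
  congr 1
  ext z
  rw [eigenvalueWeight, ← ENNReal.ofReal_mul hpos.le, 
    norm_sq_slaterDet_vandermonde (OrderIso.refl (Fin N)) (A := A) (y := fun w => w)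
      (u := fun w => (Real.exp (-(N : ℝ) * ‖w‖ ^ 2 / 2) : ℂ))]
  · have h1 : ∀ w : ℂ, ‖(Real.exp (-(N : ℝ) * ‖w‖ ^ 2 / 2) : ℂ)‖ ^ 2 =
        Real.exp (-(N : ℝ) * ‖w‖ ^ 2) := by
      intro w
      rw [Complex.norm_real, Real.norm_of_nonneg (Real.exp_nonneg _), ← Real.exp_nat_mul]
      congr 1
      push_cast
      ring
    have h2 : ∀ i : Fin N, Finset.univ.filter (fun j => i < j) = Finset.Ioi i := by
      intro i; ext j; simp
    simp only [h1, h2]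
    congr 1
    ring
  · intro j w
    rw [gaussianMonomial, mul_comm (w ^ _)]
    rfl

/-- The eigenvalues of a Ginibre matrix form a determinantal projection process. -/
theorem ginibreEntries_eigenvalues {N : ℕ} (hN : 1 ≤ N) {P : Multiset ℂ → Prop}
    (hP : MeasurableSet {z : Fin N → ℂ | P (coordMultiset z)}) :
    ginibreEntries N {x | P (eigenvalues x)} =
      slaterMeasure (fun i : Fin N => gaussianMonomial N i) {z | P (coordMultiset z)} := by
  classical
  have hN0 : (0 : ℝ) < N := by exact_mod_cast hN
  obtain ⟨c, hc⟩ := exists_ginibreEntries_eq_withDensity hN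
  obtain ⟨b, hb0, hbt, hb⟩ := eigenvalueWeight_const_mul_eq hN
  obtain ⟨C, hC⟩ := hasEigenvalueDensity hN0 N
  have hw := measurable_gaussianWeight_of (s := N) (n := N)
  have he := measurable_eigenvalueWeight (s := N) (n := N)
  have key : ∀ g : Multiset ℂ → ℝ≥0∞, Measurable (fun z : Fin N → ℂ => g (coordMultiset z)) →
      ∫⁻ x, g (eigenvalues x) ∂ginibreEntries N = c * C * b⁻¹ *
        ∫⁻ z, g (coordMultiset z) ∂slaterMeasure (fun i : Fin N => gaussianMonomial N i) := by
    intro g hg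
    have hg' := measurable_comp_eigenvalues hg
    rw [hc, hb, lintegral_withDensity_eq_lintegral_mul _ (hw.const_mul c) hg',
      lintegral_withDensity_eq_lintegral_mul _ (he.const_mul b) hg]
    have hwg : Measurable fun x : Fin N → Fin N → ℂ =>
        g (eigenvalues x) * gaussianWeight N (Matrix.of x) := hg'.mul hw
    have heg : Measurable fun z : Fin N → ℂ => g (coordMultiset z) * eigenvalueWeight N z :=
      hg.mul he
    simp only [Pi.mul_apply, mul_assoc, mul_comm (gaussianWeight _ _), mul_comm (eigenvalueWeight _ _)]
    rw [lintegral_const_mul _ hwg, lintegral_const_mul _ heg, hC g hg,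
      ENNReal.inv_mul_cancel_left hb0 hbt]
  have hor : IsOrthonormalFamily fun i : Fin N => gaussianMonomial N i :=
    (isOrthonormalFamily_gaussianMonomial hN0).comp_injective Fin.val_injective
  have hp1 := hor.isProbabilityMeasure_slaterMeasure
  have hprob : IsProbabilityMeasure (complexGaussian (1 / (N : ℝ≥0))) := by
    rw [complexGaussian]
    exact Measure.isProbabilityMeasure_map (MeasurableEquiv.measurable _).aemeasurable
  have hp2 : IsProbabilityMeasure (ginibreEntries N) := by
    rw [ginibreEntries]; infer_instance
  -- Both laws are probability measures, so testing with `1` determines the product of all the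
  -- unknown constants.
  have h1 : 1 = c * C * b⁻¹ := by simpa using key (fun _ => 1) measurable_const
  have h2 := key (fun s => if P s then 1 else 0) (Measurable.ite hP measurable_const measurable_const)
  rw [← h1, one_mul] at h2
  have hP' : MeasurableSet {x : Fin N → Fin N → ℂ | P (eigenvalues x)} := by
    have := measurable_comp_eigenvalues (g := fun s => P s) (measurableSet_setOfPred.1 hP)
    exact measurableSet_setOfPred.2 this
  rw [← lintegral_indicator_one hP', ← lintegral_indicator_one hP]
  simpa only [Set.indicator, Set.mem_ofPred_eq, Pi.one_apply] using h2

end GinibreLaw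

/-! ### Residue classes and independent superposition -/

section Superposition

theorem measurePreserving_slaterMeasure_comp_equiv {ι ι' : Type*} [Fintype ι] [DecidableEq ι]
    [Fintype ι'] [DecidableEq ι'] {φ : ι → ℂ → ℂ} (hφ : ∀ i, Measurable (φ i)) (e : ι' ≃ ι) :
    MeasurePreserving (fun z j => z (e j)) (slaterMeasure φ) (slaterMeasure fun j => φ (e j)) := by
  have hmp : MeasurePreserving (fun (z : ι → ℂ) j => z (e j)) volume volume :=
    measurePreserving_comp_perm e
  refine ⟨hmp.measurable, ?_⟩
  have hdens : ∀ z : ι → ℂ, slaterDet (fun j => φ (e j)) (fun _ => ()) (fun j => z (e j)) =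
      slaterDet φ (fun _ => ()) z := fun z => by
    rw [slaterDet, slaterDet, ← Matrix.det_submatrix_equiv_self e]
    rfl
  ext S hS
  have hm : Measurable fun z : ι' → ℂ => ENNReal.ofReal (((Fintype.card ι').factorial : ℝ)⁻¹ *
      ‖slaterDet (fun j => φ (e j)) (fun _ => ()) z‖ ^ 2) :=
    measurable_ofReal_norm_sq_slaterDet (fun _ => ()) (fun j => hφ (e j)) _
  rw [Measure.map_apply hmp.measurable hS, slaterMeasure, slaterMeasure,
    withDensity_apply _ (hmp.measurable hS), withDensity_apply _ hS,
    ← hmp.setLIntegral_comp_preimage hS hm]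
  simp only [hdens, Fintype.card_congr e]

theorem coordMultiset_eq_sum {ι : Type*} [Fintype ι] (z : ι → ℂ) :
    coordMultiset z = ∑ i, {z i} := by
  rw [← Multiset.sum_map_singleton (coordMultiset z), coordMultiset, Multiset.map_map]
  rfl

theorem coordMultiset_sigma {K : Type*} [Fintype K] {J : K → Type*} [∀ k, Fintype (J k)]
    (z : (Σ k, J k) → ℂ) : coordMultiset z = ∑ k, coordMultiset fun j => z ⟨k, j⟩ := by
  simp only [coordMultiset_eq_sum, Fintype.sum_sigma]

theorem pointConfiguration_coordMultiset {ι : Type*} [Fintype ι] (z : ι → ℂ) :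
    pointConfiguration (coordMultiset z) = ∑ i, Measure.dirac (z i) := by
  rw [pointConfiguration, coordMultiset, Multiset.map_map]
  rfl

theorem measurable_pointConfiguration {ι X : Type*} [Fintype ι] [MeasurableSpace X]
    {f : X → ι → ℂ} (hf : Measurable f) :
    Measurable fun x => pointConfiguration (coordMultiset (f x)) := by
  simp only [pointConfiguration_coordMultiset]
  refine Measure.measurable_of_measurable_coe _ fun S hS => ?_
  simp only [Measure.coe_finsetSum, Finset.sum_apply]
  exact Finset.measurable_sum _ fun i _ => (Measure.measurable_coe hS).comp
    (Measure.measurable_dirac.comp ((measurable_pi_apply i).comp hf))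

variable {N M : ℕ}

theorem eq_of_mem_progression {k k' : Finset.Icc 1 M} {j j' : ℕ} (hj : j ∈ progression N M k)
    (hj' : j' ∈ progression N M k') (h : j ≡ j' [MOD M]) : k = k' := by
  have hk := Finset.mem_Icc.1 k.2
  have hk' := Finset.mem_Icc.1 k'.2
  have h1 : (k : ℕ) ≡ k' [MOD M] :=
    ((Finset.mem_filter.1 hj).2.symm.trans h).trans (Finset.mem_filter.1 hj').2
  refine Subtype.ext ?_
  rcases le_total (k : ℕ) k' with hle | hle
  · have h2 := (Nat.modEq_iff_dvd' hle).1 h1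
    have h3 := Nat.eq_zero_of_dvd_of_lt h2 (by omega)
    omega
  · have h2 := (Nat.modEq_iff_dvd' hle).1 h1.symm
    have h3 := Nat.eq_zero_of_dvd_of_lt h2 (by omega)
    omega

/-- The progressions `I_1, …, I_M` partition `{1, …, N}`. -/
theorem exists_sigma_progression_equiv (N : ℕ) (hM : 1 ≤ M) :
    ∃ e : (Σ k : Finset.Icc 1 M, progression N M k) ≃ Fin N, ∀ x, (e x : ℕ) = (x.2 : ℕ) - 1 := by
  have hlt : ∀ x : Σ k : Finset.Icc 1 M, progression N M k, (x.2 : ℕ) - 1 < N := by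
    intro x
    have := Finset.mem_Icc.1 (Finset.mem_filter.1 x.2.2).1
    omega
  refine ⟨Equiv.ofBijective (fun x => ⟨(x.2 : ℕ) - 1, hlt x⟩) ⟨?_, ?_⟩, fun x => rfl⟩
  · rintro ⟨k, j⟩ ⟨k', j'⟩ h
    have hj := one_le_of_mem_progression j
    have hj' := one_le_of_mem_progression j'
    have h1 : (j : ℕ) - 1 = j' - 1 := congrArg Fin.val h
    have h2 : (j : ℕ) = j' := by omega
    obtain rfl := eq_of_mem_progression j.2 j'.2 (by rw [h2])
    obtain rfl := Subtype.ext h2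
    rfl
  · intro i
    have hmod := Nat.mod_lt i (by omega : 0 < M)
    -- The index `i : Fin N` stands for the integer `i + 1`, whose residue has the representative `i
    -- % M + 1` in `{1, …, M}`.
    refine ⟨⟨⟨(i : ℕ) % M + 1, Finset.mem_Icc.2 ⟨by omega, by omega⟩⟩, ⟨i + 1, ?_⟩⟩, ?_⟩
    · exact Finset.mem_filter.2 ⟨Finset.mem_Icc.2 ⟨by omega, by omega⟩,
        ((Nat.mod_modEq i M).symm.add_right 1)⟩
    · exact Fin.ext (by simp)

/-- Events that depend only on `M`-th powers have the same probability for the full Ginibre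
eigenvalue process and for independent blocks. -/
theorem slaterMeasure_eq_pi_rootDistribution (hN : 1 ≤ N) (hM : 1 ≤ M) {P : Multiset ℂ → Prop}
    (hP : MeasurableSet {z : (Σ k : Finset.Icc 1 M, progression N M k) → ℂ |
      P ((coordMultiset z).map (· ^ M))}) :
    slaterMeasure (fun x : Σ k : Finset.Icc 1 M, progression N M k =>
        gaussianMonomial N ((x.2 : ℕ) - 1)) {z | P ((coordMultiset z).map (· ^ M))} =
      (Measure.pi fun k : Finset.Icc 1 M => rootDistribution N M k)
        {z | P ((superposition z).map (· ^ M))} := by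
  have hN0 : (0 : ℝ) < N := by exact_mod_cast hN
  obtain ⟨e, he⟩ := exists_sigma_progression_equiv N hM
  set φ : (Σ k : Finset.Icc 1 M, progression N M k) → ℂ → ℂ := fun x =>
    gaussianMonomial N ((x.2 : ℕ) - 1) with hφ
  have hor : IsOrthonormalFamily φ :=
    (isOrthonormalFamily_gaussianMonomial hN0).comp_injective
      (e := fun x : Σ k : Finset.Icc 1 M, progression N M k => (x.2 : ℕ) - 1) fun x y hxy =>
      e.injective (Fin.ext (by rw [he, he]; exact hxy))
  have hM0 : M ≠ 0 := by omega
  have hω := Complex.isPrimitiveRoot_exp M hM0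
  set ω := Complex.exp (2 * Real.pi * Complex.I / M)
  have hω1 : ‖ω‖ = 1 := hω.norm'_eq_one hM0
  have hdec := hor.slaterMeasure_eq_setLIntegral Sigma.fst hP ?_ ?_
  · have hpi : (volume.withDensity
        fun z : (Σ k : Finset.Icc 1 M, progression N M k) → ℂ => ENNReal.ofReal
        (((classPerms (Sigma.fst : (Σ k : Finset.Icc 1 M, progression N M k) → _)).card : ℝ)⁻¹ * ‖slaterDet φ Sigma.fst z‖ ^ 2)) =
        (Measure.pi fun k : Finset.Icc 1 M => slaterMeasure fun j : progression N M k => φ ⟨k, j⟩).map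
        (MeasurableEquiv.piCurry
          fun (k : Finset.Icc 1 M) (_ : progression N M k) => ℂ).symm := by
      rw [hor.pi_slaterMeasure]
      congr!
    rw [hdec, ← withDensity_apply _ hP, hpi, Measure.map_apply (MeasurableEquiv.measurable _) hP]
    have hroot : (fun k : Finset.Icc 1 M => slaterMeasure fun j : progression N M k => φ ⟨k, j⟩) =
        fun k : Finset.Icc 1 M => rootDistribution N M k :=
      funext fun k => (rootDistribution_eq_slaterMeasure hN k.2).symm
    rw [hroot]
    congr 1
    ext z
    simp only [Set.mem_preimage, Set.mem_ofPred_eq]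
    rw [coordMultiset_sigma]
    rfl
  · intro σ z
    simp only [Set.mem_ofPred_eq]
    rw [coordMultiset_comp_equiv]
  · intro τ hτ
    rw [mem_classPerms] at hτ
    push Not at hτ
    obtain ⟨i₀, hi₀⟩ := hτ
    -- Rotate a coordinate whose residue class is changed by `τ`. The event sees only `M`-th powers,
    -- so a primitive `M`-th root of unity leaves it invariant.
    refine setIntegral_prod_mul_conj_eq_zero (i₀ := i₀) hω1 (fun z => ?_)
      (fun w => gaussianMonomial_rotate _ ω w hω1) (fun w => gaussianMonomial_rotate _ ω w hω1) ?_
    · have h1 : ∀ i, ((if i = i₀ then ω else 1) * z i) ^ M = z i ^ M := by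
        intro i
        rw [mul_pow]
        split_ifs <;> simp [hω.pow_eq_one]
      simp only [Set.mem_ofPred_eq, coordMultiset, Multiset.map_map, Function.comp_def, h1]
    -- If the resulting factor were `1`, two powers of a primitive `M`-th root of unity would agree,
    -- so the exponents would be congruent modulo `M` and the classes equal.
    · intro hcd
      have hd : ‖ω ^ (((τ i₀).2 : ℕ) - 1)‖ = 1 := by rw [norm_pow, hω1, one_pow]
      have hcd' : ω ^ ((i₀.2 : ℕ) - 1) = ω ^ (((τ i₀).2 : ℕ) - 1) := by
        have h2 : conj (ω ^ (((τ i₀).2 : ℕ) - 1)) * ω ^ (((τ i₀).2 : ℕ) - 1) = 1 := by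
          rw [mul_comm, Complex.mul_conj, Complex.normSq_eq_norm_sq, hd]; simp
        calc _ = ω ^ ((i₀.2 : ℕ) - 1) *
              (conj (ω ^ (((τ i₀).2 : ℕ) - 1)) * ω ^ (((τ i₀).2 : ℕ) - 1)) := by rw [h2, mul_one]
          _ = _ := by rw [← mul_assoc, hcd, one_mul]
      have hu := hω.isUnit_unit hM0
      have h3 : (hω.isUnit hM0).unit ^ ((i₀.2 : ℕ) - 1) =
          (hω.isUnit hM0).unit ^ (((τ i₀).2 : ℕ) - 1) := Units.ext hcd'
      rw [pow_eq_pow_iff_modEq, ← hu.eq_orderOf] at h3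
      replace h3 := h3.add_right 1
      rw [Nat.sub_add_cancel (one_le_of_mem_progression _),
        Nat.sub_add_cancel (one_le_of_mem_progression _)] at h3
      exact hi₀ (eq_of_mem_progression i₀.2.2 (τ i₀).2.2 h3).symm

theorem superposition_eq_coordMultiset (z : ∀ k : Finset.Icc 1 M, progression N M k → ℂ) :
    superposition z = coordMultiset
      fun x : Σ k : Finset.Icc 1 M, progression N M k => z x.1 x.2 :=
  (coordMultiset_sigma fun x : Σ k : Finset.Icc 1 M, progression N M k => z x.1 x.2).symm

theorem map_superposition (g : ℂ → ℂ) (z : ∀ k : Finset.Icc 1 M, progression N M k → ℂ) :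
    (superposition z).map g = superposition fun k j => g (z k j) := by
  simp only [superposition_eq_coordMultiset, coordMultiset, Multiset.map_map]
  rfl

theorem measurable_pointConfiguration_superposition : Measurable
    fun z : ∀ k : Finset.Icc 1 M, progression N M k → ℂ => pointConfiguration (superposition z) := by
  simp only [superposition_eq_coordMultiset]
  exact measurable_pointConfiguration (by fun_prop)

end Superposition

/-! ### Assembling the decomposition -/

/-- An event about the configuration of `M`-th powers is symmetric and invariant under rotating any
single point by an `M`-th root of unity, exactly as decoupling requires. The full process is first
reindexed by the disjoint union of the progressions. -/
theorem identDistrib_pow_eigenvalues {N M : ℕ} (hN : 1 ≤ N) (hM : 1 ≤ M) :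
    IdentDistrib
      (fun x => pointConfiguration ((eigenvalues x).map (· ^ M)))
      (fun z => pointConfiguration ((superposition z).map (· ^ M)))
      (ginibreEntries N)
      (Measure.pi fun k : Finset.Icc 1 M => rootDistribution N M k) := by
  have hN0 : (0 : ℝ) < N := by exact_mod_cast hN
  have hcoord : ∀ {ι : Type} [Fintype ι], Measurable
      fun z : ι → ℂ => pointConfiguration ((coordMultiset z).map (· ^ M)) := by
    intro ι _
    have := measurable_pointConfiguration (f := fun (z : ι → ℂ) i => z i ^ M) (by fun_prop)
    simpa only [coordMultiset, Multiset.map_map, Function.comp_def] using this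
  have h1 : Measurable fun x : Fin N → Fin N → ℂ =>
      pointConfiguration ((eigenvalues x).map (· ^ M)) :=
    measurable_comp_eigenvalues (g := fun s => pointConfiguration (s.map (· ^ M))) hcoord
  have h2 : Measurable fun z : ∀ k : Finset.Icc 1 M, progression N M k → ℂ =>
      pointConfiguration ((superposition z).map (· ^ M)) := by
    simp only [map_superposition]
    exact measurable_pointConfiguration_superposition.comp (g := fun z => pointConfiguration
      (superposition z)) (f := fun (z : ∀ k : Finset.Icc 1 M, progression N M k → ℂ) k j =>
        z k j ^ M) (by fun_prop)
  refine ⟨h1.aemeasurable, h2.aemeasurable, ?_⟩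
  ext T hT
  rw [Measure.map_apply h1 hT, Measure.map_apply h2 hT]
  obtain ⟨e, he⟩ := exists_sigma_progression_equiv N hM
  have hmp := measurePreserving_slaterMeasure_comp_equiv
    (φ := fun i : Fin N => gaussianMonomial N i)
    (fun i => (isOrthonormalFamily_gaussianMonomial hN0).measurable _) e
  have hS := hcoord (ι := Σ k : Finset.Icc 1 M, progression N M k) hT
  refine (ginibreEntries_eigenvalues hN
    (P := fun s => pointConfiguration (s.map (· ^ M)) ∈ T) (hcoord hT)).trans ?_
  refine Eq.trans ?_ (slaterMeasure_eq_pi_rootDistribution hN hM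
    (P := fun s => pointConfiguration s ∈ T) hS)
  have h3 := hmp.measure_preimage hS.nullMeasurableSet
  simp only [he] at h3
  rw [← Set.preimage_ofPred_eq] 
  refine Eq.trans ?_ h3
  congr 1
  ext z
  simp only [Set.mem_preimage, Set.mem_ofPred_eq]
  rw [coordMultiset_comp_equiv e z]

theorem map_pow_pi_rootDistribution {N M : ℕ}
    (hroot : ∀ k ∈ Finset.Icc 1 M, IsProbabilityMeasure (rootDistribution N M k)) :
    (Measure.pi fun k : Finset.Icc 1 M => rootDistribution N M k).map
      (fun z k j => z k j ^ M) = Measure.pi fun k : Finset.Icc 1 M => powerGinibre N M k := by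
  have := fun k : Finset.Icc 1 M => hroot k k.2
  have h1 : ∀ k : Finset.Icc 1 M, MeasurePreserving
      (fun (z : progression N M k → ℂ) j => z j ^ M) (rootDistribution N M k)
      (powerGinibre N M k) := fun k => ⟨by fun_prop, map_pow_rootDistribution k.2⟩
  have h2 : ∀ k : Finset.Icc 1 M, IsProbabilityMeasure (powerGinibre N M k) := fun k =>
    (h1 k).map_eq ▸ Measure.isProbabilityMeasure_map (h1 k).aemeasurable
  exact (measurePreserving_pi _ _ h1).map_eq

theorem theorem2p5 (N M : ℕ) (hN : 1 ≤ N) (hM : 1 ≤ M) :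
    -- the blocks are genuine joint laws, `Gin(N,M,k)` being determinantal and the image of
    -- `R(N,M,k)` under the power map
    (∀ k ∈ Finset.Icc 1 M,
      IsProbabilityMeasure (rootDistribution N M k) ∧
      IsProbabilityMeasure (powerGinibre N M k) ∧
      (rootDistribution N M k).map (fun z i => z i ^ M) = powerGinibre N M k ∧
      IsDeterminantal (powerGinibre N M k)) ∧
    -- `Gin(N)^M` is the superposition of the `M`-th powers of independent `R(N,M,k)`
    IdentDistrib
      (fun x => pointConfiguration ((eigenvalues x).map (· ^ M)))
      (fun z => pointConfiguration ((superposition z).map (· ^ M)))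
      (ginibreEntries N)
      (Measure.pi fun k : Finset.Icc 1 M => rootDistribution N M k) ∧
    -- `Gin(N)^M` is the superposition of independent `Gin(N,M,k)`
    IdentDistrib
      (fun x => pointConfiguration ((eigenvalues x).map (· ^ M)))
      (fun w => pointConfiguration (superposition w))
      (ginibreEntries N)
      (Measure.pi fun k : Finset.Icc 1 M => powerGinibre N M k) := by
  have hroot : ∀ k ∈ Finset.Icc 1 M, IsProbabilityMeasure (rootDistribution N M k) :=
    fun k hk => by
      rw [rootDistribution_eq_slaterMeasure hN hk]
      exact (isOrthonormalFamily_rootFamily hN).isProbabilityMeasure_slaterMeasure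
  have hident := identDistrib_pow_eigenvalues hN hM
  refine ⟨fun k hk => ?_, hident, hident.trans ?_⟩
  · obtain ⟨e, he, heq⟩ := powerGinibre_eq_slaterMeasure hN hk
    have hor := (isOrthonormalFamily_powerGinibreMonomial hN hk).comp_injective he
    refine ⟨hroot k hk, ?_, map_pow_rootDistribution hk, ?_⟩
    · rw [heq]
      exact hor.isProbabilityMeasure_slaterMeasure
    · rw [heq]
      exact hor.isDeterminantal_slaterMeasure
  · have hpow : Measurable fun (z : ∀ k : Finset.Icc 1 M, progression N M k → ℂ) k j =>
        z k j ^ M := by fun_prop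
    have hsup := measurable_pointConfiguration_superposition (N := N) (M := M)
    refine ⟨hident.aemeasurable_snd, hsup.aemeasurable, ?_⟩
    rw [← map_pow_pi_rootDistribution hroot, Measure.map_map hsup hpow]
    simp only [map_superposition, Function.comp_def]
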